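/- Let $n\ge 2$, let $\Omega\subset\mathbb R^n$ be a bounded domain with Lipschitz boundary, let $A$ be an open set (possibly empty) with Lipschitz boundary, finitely many connected components and $\overline A\subset\Omega$, and assume that $B:=\Omega\setminus\overline A$ is a domain. Let $1<p,q<\infty$ and let $\sigma(x,E)$, for $x\in\Omega$, $E>0$, be a conductivity with values in $\mathbb R\cup\{+\infty\}$ such that: (P1) in $B$ and in $A$, $\sigma(\cdot,E)$ is measurable for every $E>0$ and $\sigma(x,\cdot)$ is continuous on $(0,\infty)$ for a.e. $x$; (P2) there are constants $0<\underline\sigma\le\overline\sigma$ and $E_0>0$ such that for a.e. $x\in B$ and all $E>0$, $\underline\sigma(E/E_0)^{p-2}\le\sigma(x,E)\le\overline\sigma[1+(E/E_0)^{p-2}]$ if $p\ge2$, and $\underline\sigma(E/E_0)^{p-2}\le\sigma(x,E)\le\overline\sigma(E/E_0)^{p-2}$ if $p<2$; (P3) there is $\kappa>0$ such that for a.e. $x\in B$ and all $\mathbf E_1,\mathbf E_2\in\mathbb R^n$, the number $(\sigma(x,|\mathbf E_2|)\mathbf E_2-\sigma(x,|\mathbf E_1|)\mathbf E_1)\cdot(\mathbf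 E_2-\mathbf E_1)$ is at least $\kappa|\mathbf E_2-\mathbf E_1|^p$ if $p\ge2$, and at least $\kappa(1+|\mathbf E_2|^2+|\mathbf E_1|^2)^{\frac{p-2}2}|\mathbf E_2-\mathbf E_1|^2$ if $p<2$ (with $\sigma(x,|\mathbf E|)\mathbf E:=0$ for $\mathbf E=0$). Let $X^p_\diamond(\partial\Omega)$ be the set of elements of the trace space $W^{1,p}(\Omega)/W^{1,p}_0(\Omega)$ whose trace has vanishing mean on $\partial\Omega$ with respect to the surface measure. Put $Q_\sigma(x,E)=\int_0^E\sigma(x,\xi)\,\xi\,d\xi$. Suppose that one of the following holds, and for $f\in X^p_\diamond(\partial\Omega)$ consider the corresponding minimum problem: (i) $A=\emptyset$; minimize $\mathbb E_\sigma(u)=\int_\Omega Q_\sigma(x,|\nabla u|)\,dx$ over $u\in W^{1,p}(\Omega)$, $u=f$ on $\partial\Omega$; (ii) $\sigma$ satisfies (P2) and (P3) with $A,q$ in place of $B,p$ (possibly with other constants); minimize $\mathbb E_\sigma(u)=\int_\Omega Q_\sigma(x,|\nabla u|)\,dx\in[0,\infty]$ over $u\in W^{1,p}(\Omega)\cup W^{1,q}(\Omega)=W^{1,\min\{p,q\}}(\Omega)$,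 $u=f$ on $\partial\Omega$; (iii) (perfect insulator) $\sigma(x,E)=0$ for a.e. $x\in A$ and all $E>0$; minimize $\mathbb E_\sigma(u)=\int_B Q_\sigma(x,|\nabla u|)\,dx$ over $u\in W^{1,p}(B)$, $u=f$ on $\partial\Omega$; (iv) (perfect conductor) $\sigma(x,E)=+\infty$ for a.e. $x\in A$ and all $E>0$; minimize $\mathbb E_\sigma(u)=\int_B Q_\sigma(x,|\nabla u|)\,dx$ over $u\in W^{1,p}(\Omega)$, $u=f$ on $\partial\Omega$, $\nabla u=0$ a.e. in $A$. In each case the minimum is finite and is attained at a function $u^f$ that is unique up to null sets. For $f,\varphi\in X^p_\diamond(\partial\Omega)$ let $\langle\Lambda_\sigma(f),\varphi\rangle$ be the pairing of the Neumann datum $\sigma(x,|\nabla u^f|)\partial_nu^f|_{\partial\Omega}$ with $\varphi$, in the weak form $$\langle\Lambda_\sigma(f),\varphi\rangle=\int\sigma(x,|\nabla u^f|)\,\nabla u^f\cdot\nabla\Phi\,dx,$$ where the integral is over $\Omega$ in cases (i), (ii) and over $B$ in cases (iii), (iv), and $\Phi$ is any function of finite energy that is admissible in the minimum problem with boundary datum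 $\varphi$. Such $\Phi$ exist, the integral converges, and it does not depend on the choice of $\Phi$. Let $\langle\overline\Lambda_\sigma(f),\varphi\rangle=\int_0^1\langle\Lambda_\sigma(\alpha f),\varphi\rangle\,d\alpha$. Then, in all four cases, for every $f\in X^p_\diamond(\partial\Omega)$, the function $\alpha\mapsto\langle\Lambda_\sigma(\alpha f),f\rangle$ is integrable on $[0,1]$ and $$\mathbb E_\sigma(u^f)=\langle\overline\Lambda_\sigma(f),f\rangle .$$ -/

import Mathlib

open MeasureTheory Set Filter Topology
open scoped ENNReal RealInnerProductSpace ContDiff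

noncomputable section

namespace NonlinearConduction

/-- `ℝⁿ` with its Euclidean norm. -/
abbrev Space (n : ℕ) : Type := EuclideanSpace ℝ (Fin n)

variable {n : ℕ}

/-! ### Domains -/

/-- The boundary of `U` is Lipschitz: near each boundary point there is a direction `ν` and a
Lipschitz function `γ` of the coordinates orthogonal to `ν` such that `U` is locally the set of
points strictly above the graph of `γ` in the direction `ν`. -/
def HasLipschitzBoundary (U : Set (Space n)) : Prop :=
  ∀ x₀ ∈ frontier U, ∃ (ν : Space n) (γ : Space n → ℝ) (L : NNReal) (δ : ℝ),
    ‖ν‖ = 1 ∧ LipschitzWith L γ ∧ (∀ (x : Space n) (t : ℝ), γ (x + t • ν) = γ x) ∧ 0 < δ ∧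
      ∀ x ∈ Metric.ball x₀ δ, (x ∈ U ↔ γ x < ⟪x, ν⟫)

/-- `Ω` is a bounded Lipschitz domain, `A` is open with Lipschitz boundary, compactly contained in
`Ω`, with finitely many connected components, and `Ω \ closure A` is a domain. `A = ∅` is allowed. -/
structure IsTwoPhaseDomain (Ω A : Set (Space n)) : Prop where
  isOpen_Ω : IsOpen Ω
  isBounded_Ω : Bornology.IsBounded Ω
  isConnected_Ω : IsConnected Ω
  lipschitz_Ω : HasLipschitzBoundary Ω
  isOpen_A : IsOpen A
  closure_A_subset : closure A ⊆ Ω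
  lipschitz_A : HasLipschitzBoundary A
  finite_components_A : {C | ∃ x ∈ A, C = connectedComponentIn A x}.Finite
  isConnected_B : IsConnected (Ω \ closure A)

/-! ### Sobolev functions -/

/-- `G` is a weak gradient of `u` in the open set `U`. -/
def HasWeakGrad (U : Set (Space n)) (u : Space n → ℝ) (G : Space n → Space n) : Prop :=
  LocallyIntegrableOn u U ∧ LocallyIntegrableOn G U ∧
    ∀ φ : Space n → ℝ, ContDiff ℝ ∞ φ → HasCompactSupport φ → tsupport φ ⊆ U →
      ∀ e : Space n, ∫ x in U, u x * fderiv ℝ φ x e = -∫ x in U, φ x * ⟪G x, e⟫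

/-- The weak gradient of `u` in `U` (determined a.e. in `U` when it exists). -/
def weakGrad (U : Set (Space n)) (u : Space n → ℝ) : Space n → Space n :=
  Classical.epsilon (HasWeakGrad U u)

/-- `u ∈ W^{1,p}(U)`. -/
def MemSobolev (p : ℝ) (U : Set (Space n)) (u : Space n → ℝ) : Prop :=
  MemLp u (ENNReal.ofReal p) (volume.restrict U) ∧
    ∃ G, HasWeakGrad U u G ∧ MemLp G (ENNReal.ofReal p) (volume.restrict U)

/-- The `W^{1,p}(U)`-norm. -/
def sobolevNorm (p : ℝ) (U : Set (Space n)) (u : Space n → ℝ) : ℝ≥0∞ :=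
  eLpNorm u (ENNReal.ofReal p) (volume.restrict U) +
    eLpNorm (weakGrad U u) (ENNReal.ofReal p) (volume.restrict U)

/-- The functions of `W^{1,p}(U)`, `U ⊆ Ω`, that vanish on `∂Ω`: the closure in `W^{1,p}(U)` of the
restrictions to `U` of the `C¹` functions with compact support in `Ω`. For `U = Ω` this is
`W_0^{1,p}(Ω)`. For `U = Ω \ closure A` nothing is prescribed on `∂A`. -/
def VanishesOnBoundary (p : ℝ) (Ω U : Set (Space n)) (w : Space n → ℝ) : Prop :=
  MemSobolev p U w ∧ ∃ φ : ℕ → Space n → ℝ,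
    (∀ k, ContDiff ℝ 1 (φ k) ∧ HasCompactSupport (φ k) ∧ tsupport (φ k) ⊆ Ω) ∧
      Tendsto (fun k => sobolevNorm p U (φ k - w)) atTop (𝓝 0)

/-- The surface measure on `∂Ω`: the `(n-1)`-dimensional Hausdorff measure. -/
def surface (Ω : Set (Space n)) : Measure (Space n) :=
  (Measure.hausdorffMeasure ((n : ℝ) - 1)).restrict (frontier Ω)

/-- `g ∈ L^p(∂Ω)` is the trace on `∂Ω` of `f ∈ W^{1,p}(Ω)`. -/
def HasTrace (p : ℝ) (Ω : Set (Space n)) (f g : Space n → ℝ) : Prop :=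
  MemLp g (ENNReal.ofReal p) (surface Ω) ∧ ∃ φ : ℕ → Space n → ℝ,
    (∀ k, ContDiff ℝ 1 (φ k)) ∧
      Tendsto (fun k => sobolevNorm p Ω (φ k - f)) atTop (𝓝 0) ∧
      Tendsto (fun k => eLpNorm (φ k - g) (ENNReal.ofReal p) (surface Ω)) atTop (𝓝 0)

/-- The boundary data `X^p_⋄(∂Ω)`, each element of the trace space `W^{1,p}(Ω) / W_0^{1,p}(Ω)`
being given by a representative `f ∈ W^{1,p}(Ω)`, with vanishing mean of the trace on `∂Ω`. -/
def MemBoundaryData (p : ℝ) (Ω : Set (Space n)) (f : Space n → ℝ) : Prop :=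
  MemSobolev p Ω f ∧ ∃ g, HasTrace p Ω f g ∧ ∫ x, g x ∂(surface Ω) = 0

/-! ### Assumptions on the conductivity

The conductivity `σ x E` is `EReal`-valued, since it equals `+∞` in a perfect conductor. Only its
values at field strengths `E > 0` matter. -/

/-- Carathéodory condition in `U`. -/
def IsCaratheodory (U : Set (Space n)) (σ : Space n → ℝ → EReal) : Prop :=
  (∀ E > 0, AEMeasurable (fun x => σ x E) (volume.restrict U)) ∧
    ∀ᵐ x ∂(volume.restrict U), ContinuousOn (σ x) (Ioi 0)

/-- Growth of exponent `p` in `U`. -/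
def HasGrowth (p : ℝ) (U : Set (Space n)) (σ : Space n → ℝ → EReal) : Prop :=
  ∃ σlow σup E₀ : ℝ, 0 < σlow ∧ σlow ≤ σup ∧ 0 < E₀ ∧
    ∀ᵐ x ∂(volume.restrict U), ∀ E > 0,
      ((σlow * (E / E₀) ^ (p - 2) : ℝ) : EReal) ≤ σ x E ∧
      (2 ≤ p → σ x E ≤ ((σup * (1 + (E / E₀) ^ (p - 2)) : ℝ) : EReal)) ∧
      (p < 2 → σ x E ≤ ((σup * (E / E₀) ^ (p - 2) : ℝ) : EReal))

/-- Strong monotonicity of exponent `p` in `U`. -/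
def IsStronglyMonotone (p : ℝ) (U : Set (Space n)) (σ : Space n → ℝ → EReal) : Prop :=
  ∃ κ : ℝ, 0 < κ ∧ ∀ᵐ x ∂(volume.restrict U), ∀ e₁ e₂ : Space n,
    (2 ≤ p → κ * ‖e₂ - e₁‖ ^ p ≤
      ⟪(σ x ‖e₂‖).toReal • e₂ - (σ x ‖e₁‖).toReal • e₁, e₂ - e₁⟫) ∧
    (p < 2 → κ * (1 + ‖e₂‖ ^ 2 + ‖e₁‖ ^ 2) ^ ((p - 2) / 2) * ‖e₂ - e₁‖ ^ 2 ≤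
      ⟪(σ x ‖e₂‖).toReal • e₂ - (σ x ‖e₁‖).toReal • e₁, e₂ - e₁⟫)

/-- The four cases for the material in `A`. -/
inductive InnerPhase
  /-- there is no inner material, `A = ∅` -/
  | absent
  /-- a material of `q`-growth -/
  | growth
  /-- a perfect electric insulator -/
  | insulator
  /-- a perfect electric conductor -/
  | conductor

/-- The data of a conduction problem; `p` and `q` are the growth exponents in `Ω \ closure A` and
in `A`, and `σ` is the conductivity. -/
structure Medium (n : ℕ) where
  Ω : Set (Space n)
  A : Set (Space n)
  p : ℝ
  q : ℝ
  σ : Space n → ℝ → EReal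
  phase : InnerPhase

namespace Medium

variable (m : Medium n)

/-- The region of the outer material. -/
def B : Set (Space n) := m.Ω \ closure m.A

/-- The assumption on the inner material in each of the four cases. -/
def InnerAssumption : Prop :=
  match m.phase with
  | .absent => m.A = ∅
  | .growth => HasGrowth m.q m.A m.σ ∧ IsStronglyMonotone m.q m.A m.σ
  | .insulator => ∀ᵐ x ∂(volume.restrict m.A), ∀ E > 0, m.σ x E = 0
  | .conductor => ∀ᵐ x ∂(volume.restrict m.A), ∀ E > 0, m.σ x E = ⊤

/-! ### The minimum problems -/

/-- The set on which the potentials live: `Ω`, except `B` for an insulator in `A`. -/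
def potentialDomain : Set (Space n) :=
  match m.phase with
  | .absent => m.Ω
  | .growth => m.Ω
  | .insulator => m.B
  | .conductor => m.Ω

/-- The potentials are sought in `W^{1,p}`, except for an inner material of `q`-growth, where they
are sought in `W^{1,p}(Ω) ∪ W^{1,q}(Ω) = W^{1,min(p,q)}(Ω)`. -/
def exponent : ℝ :=
  match m.phase with
  | .absent => m.p
  | .growth => min m.p m.q
  | .insulator => m.p
  | .conductor => m.p

/-- The set over which the energy density is integrated. -/
def energyDomain : Set (Space n) :=
  match m.phase with
  | .absent => m.Ω
  | .growth => m.Ω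
  | .insulator => m.B
  | .conductor => m.B

/-- The gradient of a potential. -/
def grad (u : Space n → ℝ) : Space n → Space n := weakGrad m.potentialDomain u

/-- The energy density `Q_σ(x, E) = ∫₀ᴱ σ(x, ξ) ξ dξ`. -/
def energyDensity (x : Space n) (E : ℝ) : ℝ := ∫ ξ in (0 : ℝ)..E, (m.σ x ξ).toReal * ξ

/-- The Dirichlet energy, with values in `[0, +∞]`. -/
def energy (u : Space n → ℝ) : ℝ≥0∞ :=
  ∫⁻ x in m.energyDomain, ENNReal.ofReal (m.energyDensity x ‖m.grad u x‖)

/-- `u` is an admissible potential with `u = f` on `∂Ω`; for a perfect conductor in `A` its gradient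
has to vanish in `A`. -/
def IsAdmissible (f u : Space n → ℝ) : Prop :=
  MemSobolev m.exponent m.potentialDomain u ∧
    VanishesOnBoundary m.exponent m.Ω m.potentialDomain (u - f) ∧
    (m.phase = .conductor → ∀ᵐ x ∂(volume.restrict m.A), m.grad u x = 0)

/-- `u` minimizes the Dirichlet energy among the admissible potentials with `u = f` on `∂Ω`. -/
def IsMinimizer (f u : Space n → ℝ) : Prop :=
  m.IsAdmissible f u ∧ ∀ v, m.IsAdmissible f v → m.energy u ≤ m.energy v

/-- The solution `u^f`. -/
def solution (f : Space n → ℝ) : Space n → ℝ := Classical.epsilon (m.IsMinimizer f)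

/-! ### The Dirichlet-to-Neumann operator -/

/-- `Φ` is an admissible potential of finite energy that extends the boundary datum `φ`. -/
def IsExtension (φ Φ : Space n → ℝ) : Prop := m.IsAdmissible φ Φ ∧ m.energy Φ ≠ ⊤

/-- The density `σ(x, |∇u|) ∇u · ∇Φ` of the virtual power. -/
def powerDensity (u Φ : Space n → ℝ) (x : Space n) : ℝ :=
  (m.σ x ‖m.grad u x‖).toReal * ⟪m.grad u x, m.grad Φ x⟫

/-- The pairing `⟨Λ_σ(f), φ⟩` of the boundary flux `σ(x, |∇u^f|) ∂ₙu^f` with `φ`, in its weak form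
`∫ σ(x, |∇u^f|) ∇u^f · ∇Φ dx`, where `Φ` is an extension of `φ`. -/
def dtn (f φ : Space n → ℝ) : ℝ :=
  ∫ x in m.energyDomain,
    m.powerDensity (m.solution f) (Classical.epsilon (m.IsExtension φ)) x

/-- The pairing `⟨Λ̄_σ(f), φ⟩ = ∫₀¹ ⟨Λ_σ(α f), φ⟩ dα` of the average DtN operator. -/
def averageDtn (f φ : Space n → ℝ) : ℝ := ∫ α in (0 : ℝ)..1, m.dtn (α • f) φ

end Medium

end NonlinearConduction

end

open NonlinearConduction

open MeasureTheory Set Filter Topology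
open scoped ENNReal RealInnerProductSpace ContDiff

noncomputable section

namespace NonlinearConduction

variable {n : ℕ}

/-! ### Weak gradients -/

section WeakGrad

variable {U V : Set (Space n)} {u v : Space n → ℝ} {G H : Space n → Space n}

/-! Let g(α) be the energy of the solution with datum αf, and h(α) = ⟨Λ(αf), f⟩. The energy density
Q is convex and its gradient is the flux σ(x, |e|) e, so the energy lies above its tangent at
u^{αf}. At the competitor u^{βf} the linear term is the virtual power of u^{βf} − u^{αf}, a
potential that extends (β − α)f. Since the pairing does not depend on the extension, (β − α) h(α) ≤
g(β) − g(α) (`mul_dtn_le`). Thus h selects subgradients of g on the line: h is monotone, hence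
integrable and continuous off a countable set; g is continuous, and g' = h wherever h is continuous.
So the integral of h over [0, 1] is g(1) − g(0), and g(0) = 0
(`monotone_and_integral_of_subgradient`). Differentiability of α ↦ u^{αf} is never needed.

The rest of the work gives solutions and an Euler–Lagrange equation valid for all test potentials of
finite energy. Strong monotonicity of the flux yields quantitative midpoint convexity of Q
(`le_potential_midpoint`, `exists_rpow_norm_sub_le`), so the gradients of a minimizing sequence are
Cauchy in L^s, where s is the exponent of the problem (`cauchy_of_tendsto_energy`). A Poincaré
inequality upgrades this to convergence of the potentials, Fatou's lemma shows that the limit is a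
minimizer, and the same Cauchy estimate gives uniqueness. The Poincaré inequality has to hold on the
perforated region B for functions that vanish on ∂Ω only (`poincareOn_of_isTwoPhaseDomain`). It is
carried by translations from the exterior of Ω through B and up to ∂A.

The four cases are unified by `IsEnergyIntegrand`, whose clauses do not mention the growth exponents
of the materials and therefore add up over B and A, and by `Medium.IsRegular`. Extensions of finite
energy come from multiplying the datum by a function that vanishes near A. -/

lemma integrable_smul_of_tsupport_subset {F : Type*} [NormedAddCommGroup F] [NormedSpace ℝ F]
    {f : Space n → F} (hf : LocallyIntegrableOn f U) {ψ : Space n → ℝ} (hψ : Continuous ψ)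
    (hc : HasCompactSupport ψ) (hs : tsupport ψ ⊆ U) : Integrable (fun x => ψ x • f x) := by
  have h1 : IntegrableOn (fun x => ψ x • f x) (tsupport ψ) :=
    (hf.integrableOn_compact_subset hs hc.isCompact).continuousOn_smul hψ.continuousOn
      hc.isCompact
  refine (integrableOn_iff_integrable_of_support_subset ?_).1 h1
  intro x hx
  apply subset_tsupport
  simp only [Function.mem_support, ne_eq, smul_eq_zero, not_or] at hx
  exact hx.1

lemma setIntegral_eq_of_tsupport_subset {F : Type*} [NormedAddCommGroup F] [NormedSpace ℝ F]
    {f : Space n → F} {ψ : Space n → ℝ} (hs : tsupport ψ ⊆ U) :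
    ∫ x in U, ψ x • f x = ∫ x, ψ x • f x := by
  apply setIntegral_eq_integral_of_forall_compl_eq_zero
  intro x hx
  rw [image_eq_zero_of_notMem_tsupport (fun h => hx (hs h)), zero_smul]

lemma continuous_fderiv_apply_of_contDiff {φ : Space n → ℝ} (hφ : ContDiff ℝ 1 φ) (e : Space n) :
    Continuous (fun x => fderiv ℝ φ x e) :=
  (hφ.continuous_fderiv one_ne_zero).clm_apply continuous_const

lemma tsupport_fderiv_apply_subset' (φ : Space n → ℝ) (e : Space n) :
    tsupport (fun x => fderiv ℝ φ x e) ⊆ tsupport φ :=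
  (closure_mono (fun x hx => by
    simp only [Function.mem_support] at hx ⊢
    intro h
    exact hx (by simp [h]))).trans (tsupport_fderiv_subset ℝ)

/-- The defining identity of weak gradients, with integrals over the whole space. -/
lemma hasWeakGrad_iff : HasWeakGrad U u G ↔
    LocallyIntegrableOn u U ∧ LocallyIntegrableOn G U ∧
    ∀ φ : Space n → ℝ, ContDiff ℝ ∞ φ → HasCompactSupport φ → tsupport φ ⊆ U →
      ∀ e : Space n, ∫ x, fderiv ℝ φ x e • u x = -⟪∫ x, φ x • G x, e⟫ := by
  unfold HasWeakGrad
  refine and_congr_right fun hu => and_congr_right fun hG => ?_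
  refine forall_congr' fun φ => forall_congr' fun hφ => forall_congr' fun hc =>
    forall_congr' fun hs => forall_congr' fun e => ?_
  have h1 : ∫ x in U, u x * fderiv ℝ φ x e = ∫ x, fderiv ℝ φ x e • u x := by
    rw [← setIntegral_eq_of_tsupport_subset ((tsupport_fderiv_apply_subset' φ e).trans hs)]
    simp [mul_comm]
  have h2 : ∫ x in U, φ x * ⟪G x, e⟫ = ⟪∫ x, φ x • G x, e⟫ := by
    have : (fun x => φ x * ⟪G x, e⟫) = fun x => φ x • ⟪G x, e⟫ := rfl
    rw [this, setIntegral_eq_of_tsupport_subset hs, real_inner_comm,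
      ← integral_inner (integrable_smul_of_tsupport_subset hG hφ.continuous hc hs)]
    refine integral_congr_ae (Eventually.of_forall fun x => ?_)
    simp only [smul_eq_mul, inner_smul_right, real_inner_comm]
  rw [h1, h2]

lemma HasWeakGrad.ae_eq (hU : IsOpen U) (h : HasWeakGrad U u G) (h' : HasWeakGrad U u H) :
    G =ᵐ[volume.restrict U] H := by
  rw [hasWeakGrad_iff] at h h'
  have := hU.ae_eq_zero_of_integral_contDiff_smul_eq_zero (h.2.1.sub h'.2.1) (fun φ hφ hc hs => by
    have i1 := integrable_smul_of_tsupport_subset h.2.1 hφ.continuous hc hs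
    have i2 := integrable_smul_of_tsupport_subset h'.2.1 hφ.continuous hc hs
    simp only [Pi.sub_apply, smul_sub]
    rw [integral_sub i1 i2]
    refine ext_inner_right ℝ fun e => ?_
    have a := h.2.2 φ hφ hc hs e
    have b := h'.2.2 φ hφ hc hs e
    rw [inner_sub_left, inner_zero_left]
    linarith)
  filter_upwards [ae_restrict_mem hU.measurableSet, ae_restrict_of_ae this] with x hx h
  exact sub_eq_zero.1 (h hx)

/-- The function `weakGrad` is an `epsilon` choice, so it obeys the defining identity as soon as
some weak gradient exists. -/
lemma HasWeakGrad.weakGrad (h : HasWeakGrad U u G) : HasWeakGrad U u (weakGrad U u) :=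
  Classical.epsilon_spec (p := HasWeakGrad U u) ⟨G, h⟩

lemma HasWeakGrad.weakGrad_ae_eq (hU : IsOpen U) (h : HasWeakGrad U u G) :
    NonlinearConduction.weakGrad U u =ᵐ[volume.restrict U] G :=
  h.weakGrad.ae_eq hU h

lemma HasWeakGrad.add (hu : HasWeakGrad U u G) (hv : HasWeakGrad U v H) :
    HasWeakGrad U (u + v) (G + H) := by
  rw [hasWeakGrad_iff] at *
  refine ⟨hu.1.add hv.1, hu.2.1.add hv.2.1, fun φ hφ hc hs e => ?_⟩
  have hφ1 : ContDiff ℝ 1 φ := hφ.of_le (by simp)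
  have hs' := (tsupport_fderiv_apply_subset' φ e).trans hs
  have hc' := hc.of_isClosed_subset (isClosed_tsupport _) (tsupport_fderiv_apply_subset' φ e)
  have cφ := continuous_fderiv_apply_of_contDiff hφ1 e
  simp only [Pi.add_apply, smul_add]
  rw [integral_add (integrable_smul_of_tsupport_subset hu.1 cφ hc' hs')
      (integrable_smul_of_tsupport_subset hv.1 cφ hc' hs'),
    integral_add (integrable_smul_of_tsupport_subset hu.2.1 hφ.continuous hc hs)
      (integrable_smul_of_tsupport_subset hv.2.1 hφ.continuous hc hs), inner_add_left,
    hu.2.2 φ hφ hc hs e, hv.2.2 φ hφ hc hs e]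
  ring

lemma HasWeakGrad.const_smul (c : ℝ) (hu : HasWeakGrad U u G) :
    HasWeakGrad U (c • u) (c • G) := by
  rw [hasWeakGrad_iff] at *
  refine ⟨hu.1.smul c, hu.2.1.smul c, fun φ hφ hc hs e => ?_⟩
  simp only [Pi.smul_apply, smul_comm _ c]
  rw [integral_smul, integral_smul, hu.2.2 φ hφ hc hs e, inner_smul_left]
  simp

lemma HasWeakGrad.sub (hu : HasWeakGrad U u G) (hv : HasWeakGrad U v H) :
    HasWeakGrad U (u - v) (G - H) := by
  have := hu.add (hv.const_smul (-1))
  simpa [sub_eq_add_neg] using this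

lemma HasWeakGrad.mono (hu : HasWeakGrad U u G) (hV : V ⊆ U) : HasWeakGrad V u G := by
  rw [hasWeakGrad_iff] at *
  exact ⟨hu.1.mono_set hV, hu.2.1.mono_set hV, fun φ hφ hc hs e =>
    hu.2.2 φ hφ hc (hs.trans hV) e⟩

lemma inner_gradient_left {φ : Space n → ℝ} (x e : Space n) :
    ⟪gradient φ x, e⟫ = fderiv ℝ φ x e := by
  simp [gradient]

lemma enorm_gradient (φ : Space n → ℝ) (x : Space n) :
    ‖gradient φ x‖ₑ = ‖fderiv ℝ φ x‖ₑ := by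
  simp [gradient, enorm_eq_nnnorm]

lemma continuous_gradient {φ : Space n → ℝ} (hφ : ContDiff ℝ 1 φ) : Continuous (gradient φ) :=
  (InnerProductSpace.toDual ℝ (Space n)).symm.continuous.comp (hφ.continuous_fderiv one_ne_zero)

lemma HasWeakGrad.of_contDiff (hu : ContDiff ℝ 1 u) : HasWeakGrad U u (gradient u) := by
  have cu := hu.continuous.locallyIntegrable (μ := volume)
  have cG := (continuous_gradient hu).locallyIntegrable (μ := volume)
  rw [hasWeakGrad_iff]
  refine ⟨cu.locallyIntegrableOn U, cG.locallyIntegrableOn U, fun φ hφ hc hs e => ?_⟩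
  have hφ1 : ContDiff ℝ 1 φ := hφ.of_le (by simp)
  have hc' := hc.of_isClosed_subset (isClosed_tsupport _) (tsupport_fderiv_apply_subset' φ e)
  have i1 := integrable_smul_of_tsupport_subset (cu.locallyIntegrableOn univ)
    (continuous_fderiv_apply_of_contDiff hφ1 e) hc' (subset_univ _)
  have i2 := integrable_smul_of_tsupport_subset (cu.locallyIntegrableOn univ)
    hφ.continuous hc (subset_univ _)
  have i3 := integrable_smul_of_tsupport_subset (cG.locallyIntegrableOn univ)
    hφ.continuous hc (subset_univ _)
  have i4 := i3.inner_const (𝕜 := ℝ) e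
  have := integral_mul_fderiv_eq_neg_fderiv_mul_of_integrable (μ := (volume : Measure (Space n)))
    (f := u) (g := φ) (v := e)
    (by simpa [inner_smul_left, inner_gradient_left, mul_comm] using i4)
    (by simpa [mul_comm] using i1) (by simpa [mul_comm] using i2)
    (fun x _ => hu.differentiable one_ne_zero x) (fun x _ => hφ1.differentiable one_ne_zero x)
  rw [real_inner_comm, ← integral_inner i3]
  simp only [real_inner_comm _ e, real_inner_smul_left, inner_gradient_left, smul_eq_mul]
  simp only [mul_comm (fderiv ℝ φ _ _), mul_comm (φ _)]
  exact this

/-- Leibniz rule for the product with a smooth function. -/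
lemma HasWeakGrad.smooth_mul {η : Space n → ℝ} (hη : ContDiff ℝ ∞ η) (hU : IsOpen U)
    (hu : HasWeakGrad U u G) :
    HasWeakGrad U (fun x => η x * u x) (fun x => η x • G x + u x • gradient η x) := by
  have hη1 : ContDiff ℝ 1 η := hη.of_le (by simp)
  rw [hasWeakGrad_iff] at *
  obtain ⟨hu1, hu2, hu3⟩ := hu
  have l1 : LocallyIntegrableOn (fun x => η x • u x) U :=
    hu1.continuousOn_smul hU.isLocallyClosed hη.continuous.continuousOn
  have l2 : LocallyIntegrableOn (fun x => η x • G x) U :=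
    hu2.continuousOn_smul hU.isLocallyClosed hη.continuous.continuousOn
  have l3 : LocallyIntegrableOn (fun x => u x • gradient η x) U :=
    hu1.smul_continuousOn hU.isLocallyClosed (continuous_gradient hη1).continuousOn
  refine ⟨l1, l2.add l3, fun φ hφ hc hs e => ?_⟩
  have hφ1 : ContDiff ℝ 1 φ := hφ.of_le (by simp)
  have hs' := (tsupport_fderiv_apply_subset' φ e).trans hs
  have hc' := hc.of_isClosed_subset (isClosed_tsupport _) (tsupport_fderiv_apply_subset' φ e)
  have cφ := continuous_fderiv_apply_of_contDiff hφ1 e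
  -- The product ηφ is itself an admissible test function for `u`; the term of its derivative that
  -- contains ∇η becomes the second summand of the new gradient.
  have key := hu3 (fun x => η x * φ x) (hη.mul hφ) hc.mul_left
    ((tsupport_mul_subset_right (f := η) (g := φ)).trans hs) e
  have hd : ∀ x, fderiv ℝ (fun x => η x * φ x) x e
      = η x * fderiv ℝ φ x e + φ x * fderiv ℝ η x e := by
    intro x
    rw [fderiv_fun_mul (hη1.differentiable one_ne_zero x) (hφ1.differentiable one_ne_zero x)]
    simp
  have i1 := integrable_smul_of_tsupport_subset l1 cφ hc' hs'
  have i2 := integrable_smul_of_tsupport_subset l2 hφ.continuous hc hs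
  have i3 := integrable_smul_of_tsupport_subset l3 hφ.continuous hc hs
  have e1 : ∫ x, fderiv ℝ (fun x => η x * φ x) x e • u x
      = (∫ x, fderiv ℝ φ x e • (η x • u x)) + ⟪∫ x, φ x • u x • gradient η x, e⟫ := by
    rw [real_inner_comm, ← integral_inner i3, ← integral_add i1 (i3.const_inner (𝕜 := ℝ) e)]
    refine integral_congr_ae (Eventually.of_forall fun x => ?_)
    simp only [hd, real_inner_comm _ e, real_inner_smul_left, inner_gradient_left, smul_eq_mul]
    ring
  have e2 : ∫ x, (η x * φ x) • G x = ∫ x, φ x • η x • G x := by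
    simp only [smul_smul, mul_comm]
  rw [e1, e2] at key
  simp only [smul_add]
  rw [integral_add i2 i3, inner_add_left]
  simp only [smul_eq_mul] at key ⊢
  linarith

end WeakGrad

/-! ### Lipschitz boundaries -/

/-- At a Lipschitz boundary point there is a direction that leads out of the closure. -/
lemma HasLipschitzBoundary.exists_exterior_direction {U : Set (Space n)}
    (h : HasLipschitzBoundary U) {x₀ : Space n} (hx₀ : x₀ ∈ frontier U) :
    ∃ (ν : Space n) (δ : ℝ), ‖ν‖ = 1 ∧ 0 < δ ∧ ∀ x ∈ Metric.ball x₀ δ, x ∉ U →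
      ∀ τ : ℝ, 0 < τ → x - τ • ν ∈ Metric.ball x₀ δ → x - τ • ν ∉ closure U := by
  obtain ⟨ν, γ, L, δ, hν, hγ, hinv, hδ, hU⟩ := h x₀ hx₀
  refine ⟨ν, δ, hν, hδ, fun x hx hxU τ hτ hy hcl => ?_⟩
  have h1 : ⟪x, ν⟫ ≤ γ x := not_lt.1 fun h => hxU ((hU x hx).2 h)
  have h2 : ⟪x - τ • ν, ν⟫ < γ (x - τ • ν) := by
    have : γ (x - τ • ν) = γ x := by
      rw [sub_eq_add_neg, ← neg_smul, hinv]
    rw [this, inner_sub_left, real_inner_smul_left, real_inner_self_eq_norm_sq, hν]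
    linarith
  -- Within the ball, the region strictly below the graph is open and misses `U`, so it also misses
  -- the closure of `U`.
  have ho : IsOpen (Metric.ball x₀ δ ∩ {z | ⟪z, ν⟫ < γ z}) :=
    Metric.isOpen_ball.inter (isOpen_lt (by fun_prop) hγ.continuous)
  obtain ⟨z, ⟨hz1, hz2⟩, hz3⟩ := mem_closure_iff.1 hcl _ ho ⟨hy, h2⟩
  exact absurd ((hU z hz1).1 hz3) (not_lt.2 (le_of_lt hz2))

/-- Locally the frontier lies on the graph of γ over the hyperplane orthogonal to ν. As γ is
constant along ν, the translates of the graph by ν/(k+1) are pairwise disjoint; infinitely many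
disjoint translates by bounded vectors are possible only for a null set. -/
lemma HasLipschitzBoundary.volume_frontier {U : Set (Space n)}
    (h : HasLipschitzBoundary U) (hU : IsOpen U) : volume (frontier U) = 0 := by
  refine measure_null_of_locally_null _ fun x₀ hx₀ => ?_
  obtain ⟨ν, γ, L, δ, hν, hγ, hinv, hδ, hUγ⟩ := h x₀ hx₀
  have hgraph : frontier U ∩ Metric.ball x₀ δ ⊆ {x | γ x = ⟪x, ν⟫} := by
    rintro x ⟨hx, hxb⟩
    have h1 : ⟪x, ν⟫ ≤ γ x := not_lt.1 fun h => by
      have := (hUγ x hxb).2 h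
      rw [hU.frontier_eq] at hx
      exact hx.2 this
    refine le_antisymm (not_lt.1 fun h2 => ?_) h1
    have ho : IsOpen (Metric.ball x₀ δ ∩ {z | ⟪z, ν⟫ < γ z}) :=
      Metric.isOpen_ball.inter (isOpen_lt (by fun_prop) hγ.continuous)
    obtain ⟨z, ⟨hz1, hz2⟩, hz3⟩ := mem_closure_iff.1 (frontier_subset_closure hx) _ ho ⟨hxb, h2⟩
    exact absurd ((hUγ z hz1).1 hz3) (not_lt.2 (le_of_lt hz2))
  have hnull : volume {x : Space n | γ x = ⟪x, ν⟫} = 0 := by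
    refine Measure.addHaar_eq_zero_of_disjoint_translates volume
      (fun k : ℕ => (1 / ((k : ℝ) + 1)) • ν) ?_ ?_
      (isClosed_eq hγ.continuous (by fun_prop)).measurableSet
    · refine (Metric.isBounded_closedBall (x := (0 : Space n)) (r := 1)).subset ?_
      rintro _ ⟨k, rfl⟩
      have : (1 : ℝ) ≤ k + 1 := by
        have : (0 : ℝ) ≤ k := by positivity
        linarith
      simp only [mem_closedBall_zero_iff, norm_smul, hν, mul_one, Real.norm_eq_abs]
      rw [abs_of_pos (by positivity)]
      exact (div_le_one (by positivity)).2 this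
    · intro k l hkl
      refine Set.disjoint_left.2 fun z hz hz' => hkl ?_
      simp only [singleton_add, mem_image, mem_ofPred_eq] at hz hz'
      obtain ⟨a, ha, rfl⟩ := hz
      obtain ⟨b, hb, hab⟩ := hz'
      have e1 : γ a = γ b := by
        rw [← hinv a (1 / ((k : ℝ) + 1)), ← hinv b (1 / ((l : ℝ) + 1)), add_comm a, add_comm b, hab]
      have e2 := congrArg (fun z => ⟪z, ν⟫) hab
      simp only [inner_add_left, real_inner_smul_left, real_inner_self_eq_norm_sq, hν] at e2
      have e3 : (1 / ((k : ℝ) + 1)) = 1 / ((l : ℝ) + 1) := by linarith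
      rw [one_div, one_div, inv_inj] at e3
      exact_mod_cast add_right_cancel e3
  refine ⟨frontier U ∩ Metric.ball x₀ δ, ?_, measure_mono_null hgraph hnull⟩
  exact inter_mem_nhdsWithin _ (Metric.ball_mem_nhds _ hδ)

/-! ### The Poincaré inequality -/

/-- The second alternative lets translated points leave `T` where the integrand vanishes. It is used
for segments that leave Ω, outside of which test functions and their derivatives are zero. -/
lemma setLIntegral_comp_add_le {f : Space n → ℝ≥0∞} {S T : Set (Space n)} (hS : MeasurableSet S)
    (v : Space n) (h : ∀ x ∈ S, x + v ∈ T ∨ f (x + v) = 0) :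
    ∫⁻ x in S, f (x + v) ≤ ∫⁻ x in T, f x := by
  rw [← lintegral_indicator hS]
  calc ∫⁻ x, S.indicator (fun x => f (x + v)) x ≤ ∫⁻ x, T.indicator f (x + v) := by
        refine lintegral_mono fun x => ?_
        by_cases hx : x ∈ S
        · rw [indicator_of_mem hx]
          rcases h x hx with h | h
          · rw [indicator_of_mem h]
          · simp [h]
        · simp [hx]
    _ = ∫⁻ x, T.indicator f x := lintegral_add_right_eq_self (T.indicator f) v
    _ ≤ _ := lintegral_indicator_le _ _

/-- Integrate the derivative of φ along the segment from x to x + v, apply Jensen's inequality on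
[0, 1], and use (a + b)^s ≤ 2^(s−1)(a^s + b^s). -/
lemma enorm_rpow_le_translate {s : ℝ} (hs : 1 ≤ s) {φ : Space n → ℝ} (hφ : ContDiff ℝ 1 φ)
    (x v : Space n) :
    ‖φ x‖ₑ ^ s ≤ 2 ^ (s - 1) * (‖φ (x + v)‖ₑ ^ s +
      ‖v‖ₑ ^ s * ∫⁻ t in Icc (0 : ℝ) 1, ‖fderiv ℝ φ (x + t • v)‖ₑ ^ s) := by
  have hs0 : 0 ≤ s := by linarith
  set ψ : ℝ → ℝ := fun t => φ (x + t • v) with hψ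
  have hψc : ContDiff ℝ 1 ψ := hφ.comp (by fun_prop)
  have hd : ∀ t, deriv ψ t = fderiv ℝ φ (x + t • v) v := fun t => by
    have h1 : HasDerivAt (fun t : ℝ => x + t • v) v t := by
      simpa using ((hasDerivAt_id t).smul_const v).const_add x
    exact ((hφ.differentiable one_ne_zero _).hasFDerivAt.comp_hasDerivAt t h1).deriv
  have h1 : ‖φ x‖ₑ ≤ ‖φ (x + v)‖ₑ + ∫⁻ t in Icc (0 : ℝ) 1, ‖deriv ψ t‖ₑ := by
    have := enorm_sub_le_lintegral_deriv_of_contDiffOn_Icc (hψc.contDiffOn (s := Icc 0 1))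
      zero_le_one
    simp only [hψ, one_smul, zero_smul, add_zero] at this
    calc ‖φ x‖ₑ = ‖φ (x + v) - (φ (x + v) - φ x)‖ₑ := by congr 1; ring
      _ ≤ ‖φ (x + v)‖ₑ + ‖φ (x + v) - φ x‖ₑ := enorm_sub_le
      _ ≤ _ := by gcongr
  have h2 : (∫⁻ t in Icc (0 : ℝ) 1, ‖deriv ψ t‖ₑ) ^ s
      ≤ ∫⁻ t in Icc (0 : ℝ) 1, ‖deriv ψ t‖ₑ ^ s := by
    have : IsProbabilityMeasure ((volume : Measure ℝ).restrict (Icc 0 1)) :=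
      ⟨by simp⟩
    have h := eLpNorm'_le_eLpNorm'_of_exponent_le (μ := (volume : Measure ℝ).restrict (Icc 0 1))
      (f := deriv ψ) zero_lt_one hs
      (hψc.continuous_deriv_one).aestronglyMeasurable
    simp only [eLpNorm', ENNReal.rpow_one, ne_eq, one_ne_zero, not_false_eq_true, div_self] at h
    calc _ ≤ ((∫⁻ t in Icc (0 : ℝ) 1, ‖deriv ψ t‖ₑ ^ s) ^ (1 / s)) ^ s := by gcongr
      _ = _ := by
        rw [← ENNReal.rpow_mul, one_div, inv_mul_cancel₀ (by linarith), ENNReal.rpow_one]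
  have h3 : ∫⁻ t in Icc (0 : ℝ) 1, ‖deriv ψ t‖ₑ ^ s
      ≤ ‖v‖ₑ ^ s * ∫⁻ t in Icc (0 : ℝ) 1, ‖fderiv ℝ φ (x + t • v)‖ₑ ^ s := by
    have hc : Continuous fun t : ℝ => fderiv ℝ φ (x + t • v) :=
      (hφ.continuous_fderiv one_ne_zero).comp (by fun_prop)
    rw [← lintegral_const_mul _ (by fun_prop)]
    refine lintegral_mono fun t => ?_
    rw [hd, ← ENNReal.mul_rpow_of_nonneg _ _ hs0, mul_comm]
    gcongr
    exact ContinuousLinearMap.le_opENorm _ _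
  calc ‖φ x‖ₑ ^ s ≤ (‖φ (x + v)‖ₑ + ∫⁻ t in Icc (0 : ℝ) 1, ‖deriv ψ t‖ₑ) ^ s := by gcongr
    _ ≤ 2 ^ (s - 1) * (‖φ (x + v)‖ₑ ^ s + (∫⁻ t in Icc (0 : ℝ) 1, ‖deriv ψ t‖ₑ) ^ s) := by
      exact ENNReal.rpow_add_le_mul_rpow_add_rpow _ _ hs
    _ ≤ _ := by
      gcongr
      exact h2.trans h3

/-- On `S`, the `C¹` functions with compact support in `Ω` are controlled by their gradients
in `E`. -/
def PoincareOn (s : ℝ) (Ω E S : Set (Space n)) : Prop :=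
  ∃ C : ℝ≥0∞, C ≠ ⊤ ∧ ∀ φ : Space n → ℝ, ContDiff ℝ 1 φ → tsupport φ ⊆ Ω →
    ∫⁻ x in S, ‖φ x‖ₑ ^ s ≤ C * ∫⁻ x in E, ‖fderiv ℝ φ x‖ₑ ^ s

namespace PoincareOn

variable {s : ℝ} {Ω E S T : Set (Space n)}

lemma mono (h : PoincareOn s Ω E T) (hST : S ⊆ T) : PoincareOn s Ω E S := by
  obtain ⟨C, hC, h⟩ := h
  exact ⟨C, hC, fun φ h1 h3 => (lintegral_mono_set hST).trans (h φ h1 h3)⟩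

lemma union (h : PoincareOn s Ω E S) (h' : PoincareOn s Ω E T) : PoincareOn s Ω E (S ∪ T) := by
  obtain ⟨C, hC, h⟩ := h
  obtain ⟨C', hC', h'⟩ := h'
  refine ⟨C + C', ENNReal.add_ne_top.2 ⟨hC, hC'⟩, fun φ h1 h3 => ?_⟩
  rw [add_mul]
  exact (lintegral_union_le _ _ _).trans (add_le_add (h φ h1 h3) (h' φ h1 h3))

lemma of_disjoint (hs : 0 < s) (hS : MeasurableSet S) (h : Disjoint S Ω) :
    PoincareOn s Ω E S := by
  refine ⟨0, by simp, fun φ h1 h3 => ?_⟩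
  rw [setLIntegral_congr_fun hS (g := fun _ => 0)]
  · simp
  · intro x hx
    have : φ x = 0 := image_eq_zero_of_notMem_tsupport fun h' => (h.subset_compl_right hx) (h3 h')
    simp [this, hs]

/-- An estimate on `T` is transported to sets that `v` moves into `T`. The price is the integral of
the gradient over the swept segments, which only have to stay in `E` as long as they are in Ω. -/
lemma translate (hs : 1 ≤ s) (hS : MeasurableSet S) (hT : PoincareOn s Ω E T) (v : Space n)
    (hv : ∀ x ∈ S, x + v ∈ T) (hE : ∀ x ∈ S, ∀ t ∈ Icc (0 : ℝ) 1, x + t • v ∈ Ω → x + t • v ∈ E) :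
    PoincareOn s Ω E S := by
  have hs0 : 0 < s := by linarith
  obtain ⟨C, hC, h⟩ := hT
  refine ⟨2 ^ (s - 1) * (C + ‖v‖ₑ ^ s), ENNReal.mul_ne_top
    (ENNReal.rpow_ne_top_of_nonneg (by linarith) (by simp)) (ENNReal.add_ne_top.2 ⟨hC,
      ENNReal.rpow_ne_top_of_nonneg hs0.le (by simp)⟩), fun φ h1 h3 => ?_⟩
  have cφ := h1.continuous
  have cd := h1.continuous_fderiv one_ne_zero
  have cφv : Continuous fun x => φ (x + v) := cφ.comp (by fun_prop)
  have m1 : Measurable fun x => ‖φ (x + v)‖ₑ ^ s := cφv.measurable.enorm.pow_const s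
  have cuv : Continuous fun z : Space n × ℝ => fderiv ℝ φ (z.1 + z.2 • v) :=
    cd.comp (by fun_prop)
  have m2 : Measurable fun z : Space n × ℝ => ‖fderiv ℝ φ (z.1 + z.2 • v)‖ₑ ^ s := by fun_prop
  have m3 : Measurable fun x => ∫⁻ t in Icc (0 : ℝ) 1, ‖fderiv ℝ φ (x + t • v)‖ₑ ^ s :=
    m2.lintegral_prod_right'
  calc ∫⁻ x in S, ‖φ x‖ₑ ^ s
      ≤ ∫⁻ x in S, 2 ^ (s - 1) * (‖φ (x + v)‖ₑ ^ s +
      ‖v‖ₑ ^ s * ∫⁻ t in Icc (0 : ℝ) 1, ‖fderiv ℝ φ (x + t • v)‖ₑ ^ s) :=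
        lintegral_mono fun x => enorm_rpow_le_translate hs h1 x v
    _ = 2 ^ (s - 1) * ((∫⁻ x in S, ‖φ (x + v)‖ₑ ^ s) +
      ‖v‖ₑ ^ s * ∫⁻ t in Icc (0 : ℝ) 1, ∫⁻ x in S, ‖fderiv ℝ φ (x + t • v)‖ₑ ^ s) := by
        rw [lintegral_const_mul _ (by fun_prop), lintegral_add_left m1,
          lintegral_const_mul _ m3, lintegral_lintegral_swap m2.aemeasurable]
    _ ≤ 2 ^ (s - 1) * ((C * ∫⁻ x in E, ‖fderiv ℝ φ x‖ₑ ^ s) +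
      ‖v‖ₑ ^ s * ∫⁻ t in Icc (0 : ℝ) 1, ∫⁻ x in E, ‖fderiv ℝ φ x‖ₑ ^ s) := by
        refine mul_le_mul_right (add_le_add ?_ (mul_le_mul_right ?_ _)) _
        · exact (setLIntegral_comp_add_le (f := fun x => ‖φ x‖ₑ ^ s) hS v
            (fun x hx => Or.inl (hv x hx))).trans (h φ h1 h3)
        · refine setLIntegral_mono' measurableSet_Icc fun t ht => ?_
          refine setLIntegral_comp_add_le (f := fun x => ‖fderiv ℝ φ x‖ₑ ^ s) hS (t • v)
            fun x hx => ?_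
          by_cases hx' : x + t • v ∈ Ω
          · exact Or.inl (hE x hx t ht hx')
          · right
            have : fderiv ℝ φ (x + t • v) = 0 :=
              image_eq_zero_of_notMem_tsupport fun h' => hx' (h3 (tsupport_fderiv_subset ℝ h'))
            have h0 : ‖fderiv ℝ φ (x + t • v)‖ₑ = 0 := by
              rw [← enorm_gradient, gradient, this, map_zero, enorm_zero]
            simp [h0, hs0]
    _ = _ := by
        simp only [lintegral_const, MeasurableSet.univ, Measure.restrict_apply, univ_inter,
          Real.volume_Icc, sub_zero, ENNReal.ofReal_one, mul_one]
        ring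

end PoincareOn

/-- The centres of balls on which the estimate holds form an open set `G`, which is relatively
closed off the closure of A because the estimate can be translated a short way. It contains a
boundary point of Ω, since test functions vanish on balls outside Ω. Connectedness of B spreads it
over B, and compactness of the closure of B leaves finitely many local estimates to add. Next to ∂A
the estimate is imported from inside B along the exterior direction of the Lipschitz boundary. -/
theorem poincareOn_of_isTwoPhaseDomain (hn : 2 ≤ n) {Ω A : Set (Space n)}
    (hdom : IsTwoPhaseDomain Ω A) {s : ℝ} (hs : 1 ≤ s) :
    PoincareOn s Ω (Ω \ closure A) (Ω \ closure A) := by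
  set B := Ω \ closure A with hB
  have hs0 : 0 < s := by linarith
  have hBo : IsOpen B := hdom.isOpen_Ω.sdiff isClosed_closure
  set G : Set (Space n) := {x | ∃ r > 0, PoincareOn s Ω B (Metric.ball x r)} with hG
  have hGo : IsOpen G := by
    rw [Metric.isOpen_iff]
    rintro x ⟨r, hr, h⟩
    refine ⟨r, hr, fun y hy => ⟨r - dist y x, sub_pos.2 hy, h.mono ?_⟩⟩
    exact Metric.ball_subset_ball' (by linarith)
  have hGc : ∀ y ∈ closure G, y ∉ closure A → y ∈ G := by
    intro y hy hyA
    obtain ⟨ρ, hρ, hρA⟩ := Metric.isOpen_iff.1 isClosed_closure.isOpen_compl y hyA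
    obtain ⟨x, ⟨r, hr, hx⟩, hyx⟩ := Metric.mem_closure_iff.1 hy (ρ / 2) (by linarith)
    -- With this radius the translate by x − y lands in the good ball around x, and all swept
    -- segments stay in the ball of radius ρ around y, which avoids the closure of A.
    refine ⟨min r (ρ / 2), by positivity, hx.translate hs measurableSet_ball (x - y) ?_ ?_⟩
    · intro z hz
      rw [Metric.mem_ball, dist_eq_norm] at hz ⊢
      have : z + (x - y) - x = z - y := by abel
      rw [this]
      exact hz.trans_le (min_le_left _ _)
    · intro z hz t ht hzΩ
      refine ⟨hzΩ, hρA ?_⟩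
      rw [Metric.mem_ball, dist_eq_norm] at hz ⊢
      rw [dist_eq_norm, norm_sub_rev] at hyx
      calc ‖z + t • (x - y) - y‖ = ‖(z - y) + t • (x - y)‖ := by congr 1; abel
        _ ≤ ‖z - y‖ + ‖t • (x - y)‖ := norm_add_le _ _
        _ = ‖z - y‖ + t * ‖x - y‖ := by rw [norm_smul, Real.norm_of_nonneg ht.1]
        _ ≤ ‖z - y‖ + 1 * ‖x - y‖ := by gcongr; exact ht.2
        _ < ρ := by linarith [min_le_right r (ρ / 2)]
  -- a small ball outside `Ω` starts the propagation
  have hfr : (frontier Ω).Nonempty := by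
    rw [nonempty_iff_ne_empty]
    -- Without a frontier, Ω would be clopen and nonempty, hence the whole space, which is unbounded
    -- as n ≥ 2.
    intro he
    have hcl : IsClopen Ω := isClopen_iff_frontier_eq_empty.2 he
    have hu := hcl.eq_univ hdom.isConnected_Ω.nonempty
    have hb := hdom.isBounded_Ω
    rw [hu] at hb
    have : Nonempty (Fin n) := ⟨⟨0, by omega⟩⟩
    exact NormedSpace.unbounded_univ ℝ (Space n) hb
  obtain ⟨x₀, hx₀⟩ := hfr
  have hx₀Ω : x₀ ∉ Ω := by
    rw [hdom.isOpen_Ω.frontier_eq] at hx₀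
    exact hx₀.2
  have hx₀A : x₀ ∉ closure A := fun h => hx₀Ω (hdom.closure_A_subset h)
  have hx₀G : x₀ ∈ G := by
    refine hGc x₀ ?_ hx₀A
    obtain ⟨ν, δ, hν, hδ, hext⟩ := hdom.lipschitz_Ω.exists_exterior_direction hx₀
    rw [Metric.mem_closure_iff]
    intro ε hε
    set τ := min (ε / 2) (δ / 2) with hτ
    have hτ0 : 0 < τ := by positivity
    have hd : dist x₀ (x₀ - τ • ν) = τ := by
      rw [dist_eq_norm, sub_sub_cancel, norm_smul, hν, mul_one, Real.norm_of_nonneg hτ0.le]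
    refine ⟨x₀ - τ • ν, ?_, by rw [hd]; linarith [min_le_left (ε / 2) (δ / 2)]⟩
    have h1 := hext x₀ (Metric.mem_ball_self hδ) hx₀Ω τ hτ0 (by
      rw [Metric.mem_ball, dist_comm, hd]; linarith [min_le_right (ε / 2) (δ / 2)])
    obtain ⟨r, hr, hrΩ⟩ := Metric.isOpen_iff.1 isClosed_closure.isOpen_compl _ h1
    exact ⟨r, hr, PoincareOn.of_disjoint hs0 measurableSet_ball
      ((disjoint_compl_left_iff_subset.2 subset_closure).mono_left hrΩ)⟩
  have hBG : B ⊆ G := by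
    refine hdom.isConnected_B.isPreconnected.subset_of_closure_inter_subset hGo ?_
      (fun y hy => hGc y hy.1 hy.2.2)
    -- `G` is a neighbourhood of x₀ ∈ ∂Ω, so it meets Ω near x₀, away from the closure of A. This
    -- puts a point of B into `G`.
    obtain ⟨z, hz1, hz2⟩ := mem_closure_iff.1 (frontier_subset_closure hx₀)
      (G ∩ (closure A)ᶜ) (hGo.inter isClosed_closure.isOpen_compl) ⟨hx₀G, hx₀A⟩
    exact ⟨z, ⟨hz2, hz1.2⟩, hz1.1⟩
  have hcomp : IsCompact (closure B) :=
    (hdom.isBounded_Ω.subset sdiff_subset).isCompact_closure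
  have hfin : PoincareOn s Ω B (closure B ∩ B) := by
    -- The estimate is localized to S ∩ B because near ∂A a full ball would contain points of A,
    -- from which segments may run through A.
    refine hcomp.induction_on (p := fun S => PoincareOn s Ω B (S ∩ B)) ?_ ?_ ?_ ?_
    · exact ⟨0, by simp, by simp⟩
    · exact fun S T hST h => h.mono (inter_subset_inter_left _ hST)
    · intro S T h h'
      rw [union_inter_distrib_right]
      exact h.union h'
    · intro x hx
      by_cases hxA : x ∈ closure A
      · have hxnA : x ∉ A := by
          intro h
          obtain ⟨z, hz1, hz2⟩ := mem_closure_iff.1 hx A hdom.isOpen_A h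
          exact hz2.2 (subset_closure hz1)
        have hxf : x ∈ frontier A := by
          rw [hdom.isOpen_A.frontier_eq]
          exact ⟨hxA, hxnA⟩
        obtain ⟨ν, δ, hν, hδ, hext⟩ := hdom.lipschitz_A.exists_exterior_direction hxf
        obtain ⟨ρ, hρ, hρΩ⟩ := Metric.isOpen_iff.1 hdom.isOpen_Ω x (hdom.closure_A_subset hxA)
        -- The shift by −τν carries x into B. Segments in this direction that start in B stay
        -- outside the closure of A, by `exists_exterior_direction`.
        set τ := min (ρ / 2) (δ / 2) with hτ
        have hτ0 : 0 < τ := by positivity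
        have hτρ : τ ≤ ρ / 2 := min_le_left _ _
        have hτδ : τ ≤ δ / 2 := min_le_right _ _
        have hd : dist (x - τ • ν) x = τ := by
          rw [dist_comm, dist_eq_norm, sub_sub_cancel, norm_smul, hν, mul_one,
            Real.norm_of_nonneg hτ0.le]
        have hyB : x - τ • ν ∈ B := by
          refine ⟨hρΩ ?_, hext x (Metric.mem_ball_self hδ) hxnA τ hτ0 ?_⟩
          · rw [Metric.mem_ball, hd]; linarith
          · rw [Metric.mem_ball, hd]; linarith
        obtain ⟨r, hr, hrG⟩ := hBG hyB
        refine ⟨Metric.ball x (min r (δ / 2)),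
          mem_nhdsWithin_of_mem_nhds (Metric.ball_mem_nhds _ (by positivity)), ?_⟩
        refine hrG.translate hs (measurableSet_ball.inter hBo.measurableSet) (-(τ • ν)) ?_ ?_
        · rintro z ⟨hz, -⟩
          rw [Metric.mem_ball, dist_eq_norm] at hz ⊢
          have : z + -(τ • ν) - (x - τ • ν) = z - x := by abel
          rw [this]
          exact hz.trans_le (min_le_left _ _)
        · rintro z ⟨hz, hzB⟩ t ht hzΩ
          rw [Metric.mem_ball, dist_eq_norm] at hz
          have hz' : ‖z - x‖ < δ / 2 := hz.trans_le (min_le_right _ _)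
          refine ⟨hzΩ, ?_⟩
          rcases ht.1.eq_or_lt with rfl | ht0
          · simpa using hzB.2
          · have e : z + t • -(τ • ν) = z - (t * τ) • ν := by
              rw [smul_neg, smul_smul, sub_eq_add_neg]
            rw [e]
            refine hext z ?_ (fun h => hzB.2 (subset_closure h)) (t * τ) (by positivity) ?_
            · rw [Metric.mem_ball, dist_eq_norm]; linarith
            · rw [Metric.mem_ball, dist_eq_norm]
              calc ‖z - (t * τ) • ν - x‖ = ‖(z - x) - (t * τ) • ν‖ := by congr 1; abel
                _ ≤ ‖z - x‖ + ‖(t * τ) • ν‖ := norm_sub_le _ _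
                _ = ‖z - x‖ + t * τ := by
                  rw [norm_smul, hν, mul_one, Real.norm_of_nonneg (by positivity)]
                _ ≤ ‖z - x‖ + 1 * τ := by gcongr; exact ht.2
                _ < δ := by linarith
      · obtain ⟨r, hr, hrG⟩ := hGc x (closure_mono hBG hx) hxA
        exact ⟨Metric.ball x r, mem_nhdsWithin_of_mem_nhds (Metric.ball_mem_nhds _ hr),
          hrG.mono inter_subset_left⟩
  exact hfin.mono (subset_inter subset_closure Subset.rfl)

/-! ### Sobolev functions -/

section LpTools

variable {α F : Type*} [MeasurableSpace α] {μ : Measure α} [NormedAddCommGroup F]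

lemma exists_tendsto_eLpNorm_of_cauchy [CompleteSpace F] {p : ℝ≥0∞} (hp : 1 ≤ p) {f : ℕ → α → F}
    (hf : ∀ k, MemLp (f k) p μ)
    (hc : ∀ ε > 0, ∃ N, ∀ j ≥ N, ∀ k ≥ N, eLpNorm (f j - f k) p μ < ε) :
    ∃ g, MemLp g p μ ∧ Tendsto (fun k => eLpNorm (f k - g) p μ) atTop (𝓝 0) := by
  have : Fact (1 ≤ p) := ⟨hp⟩
  have hcau : CauchySeq fun k => (hf k).toLp (f k) := by
    rw [EMetric.cauchySeq_iff]
    intro ε hε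
    obtain ⟨N, hN⟩ := hc ε hε
    refine ⟨N, fun j hj k hk => ?_⟩
    rw [Lp.edist_toLp_toLp]
    exact hN j hj k hk
  obtain ⟨g, hg⟩ := cauchySeq_tendsto_of_complete hcau
  refine ⟨g, Lp.memLp g, ?_⟩
  rw [tendsto_iff_edist_tendsto_0] at hg
  refine hg.congr fun k => ?_
  rw [Lp.edist_def]
  exact eLpNorm_congr_ae ((hf k).coeFn_toLp.sub (ae_eq_refl _))

end LpTools

section Sobolev

variable {s : ℝ} {Ω U V : Set (Space n)} {u v : Space n → ℝ} {G H : Space n → Space n}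

lemma one_le_ofReal (hs : 1 ≤ s) : (1 : ℝ≥0∞) ≤ ENNReal.ofReal s := by
  simpa using ENNReal.ofReal_le_ofReal hs

lemma HasWeakGrad.aestronglyMeasurable (h : HasWeakGrad U u G) :
    AEStronglyMeasurable u (volume.restrict U) ∧ AEStronglyMeasurable G (volume.restrict U) :=
  ⟨h.1.aestronglyMeasurable, h.2.1.aestronglyMeasurable⟩

lemma HasWeakGrad.sobolevNorm_eq (hU : IsOpen U) (h : HasWeakGrad U u G) :
    sobolevNorm s U u = eLpNorm u (ENNReal.ofReal s) (volume.restrict U) +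
      eLpNorm G (ENNReal.ofReal s) (volume.restrict U) := by
  rw [sobolevNorm, eLpNorm_congr_ae (h.weakGrad_ae_eq hU)]

lemma HasWeakGrad.sobolevNorm_add_le (hU : IsOpen U) (hs : 1 ≤ s) (hu : HasWeakGrad U u G)
    (hv : HasWeakGrad U v H) :
    sobolevNorm s U (u + v) ≤ sobolevNorm s U u + sobolevNorm s U v := by
  rw [(hu.add hv).sobolevNorm_eq hU, hu.sobolevNorm_eq hU, hv.sobolevNorm_eq hU]
  refine (add_le_add
    (eLpNorm_add_le hu.aestronglyMeasurable.1 hv.aestronglyMeasurable.1 (one_le_ofReal hs))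
    (eLpNorm_add_le hu.aestronglyMeasurable.2 hv.aestronglyMeasurable.2
      (one_le_ofReal hs))).trans_eq ?_
  ring

lemma HasWeakGrad.sobolevNorm_smul (hU : IsOpen U) (c : ℝ) (hu : HasWeakGrad U u G) :
    sobolevNorm s U (c • u) = ‖c‖ₑ * sobolevNorm s U u := by
  rw [(hu.const_smul c).sobolevNorm_eq hU, hu.sobolevNorm_eq hU, eLpNorm_const_smul,
    eLpNorm_const_smul, mul_add]

/-- Restriction to a smaller open set and a smaller exponent is continuous. -/
lemma HasWeakGrad.sobolevNorm_mono (hU : IsOpen U) (hV : IsOpen V) (hVU : V ⊆ U)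
    {p : ℝ} (hs : 0 < s) (hsp : s ≤ p) (hu : HasWeakGrad U u G) :
    sobolevNorm s V u ≤ sobolevNorm p U u * volume V ^ (1 / s - 1 / p) := by
  have hVm := hu.mono hVU
  rw [hVm.sobolevNorm_eq hV, hu.sobolevNorm_eq hU, add_mul]
  have key : ∀ {F : Type} [NormedAddCommGroup F] {f : Space n → F},
      AEStronglyMeasurable f (volume.restrict V) →
      eLpNorm f (ENNReal.ofReal s) (volume.restrict V) ≤
        eLpNorm f (ENNReal.ofReal p) (volume.restrict U) * volume V ^ (1 / s - 1 / p) := by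
    intro F _ f hf
    refine (eLpNorm_le_eLpNorm_mul_rpow_measure_univ (ENNReal.ofReal_le_ofReal hsp) hf).trans ?_
    rw [ENNReal.toReal_ofReal hs.le, ENNReal.toReal_ofReal (hs.le.trans hsp),
      Measure.restrict_apply_univ]
    gcongr
  exact add_le_add (key hVm.aestronglyMeasurable.1) (key hVm.aestronglyMeasurable.2)

lemma HasWeakGrad.memSobolev (h : HasWeakGrad U u G)
    (hu : MemLp u (ENNReal.ofReal s) (volume.restrict U))
    (hG : MemLp G (ENNReal.ofReal s) (volume.restrict U)) : MemSobolev s U u :=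
  ⟨hu, G, h, hG⟩

namespace MemSobolev

lemma hasWeakGrad (h : MemSobolev s U u) : HasWeakGrad U u (weakGrad U u) := by
  obtain ⟨-, G, hG, -⟩ := h
  exact hG.weakGrad

lemma memLp_weakGrad (hU : IsOpen U) (h : MemSobolev s U u) :
    MemLp (weakGrad U u) (ENNReal.ofReal s) (volume.restrict U) := by
  obtain ⟨-, G, hG, hGp⟩ := h
  exact (memLp_congr_ae (hG.weakGrad_ae_eq hU)).2 hGp

lemma add (hU : IsOpen U) (hu : MemSobolev s U u) (hv : MemSobolev s U v) :
    MemSobolev s U (u + v) :=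
  (hu.hasWeakGrad.add hv.hasWeakGrad).memSobolev (hu.1.add hv.1)
    ((hu.memLp_weakGrad hU).add (hv.memLp_weakGrad hU))

lemma const_smul (hU : IsOpen U) (c : ℝ) (hu : MemSobolev s U u) : MemSobolev s U (c • u) :=
  (hu.hasWeakGrad.const_smul c).memSobolev (hu.1.const_smul c)
    ((hu.memLp_weakGrad hU).const_smul c)

lemma sub (hU : IsOpen U) (hu : MemSobolev s U u) (hv : MemSobolev s U v) :
    MemSobolev s U (u - v) :=
  (hu.hasWeakGrad.sub hv.hasWeakGrad).memSobolev (hu.1.sub hv.1)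
    ((hu.memLp_weakGrad hU).sub (hv.memLp_weakGrad hU))

lemma weakGrad_add (hU : IsOpen U) (hu : MemSobolev s U u) (hv : MemSobolev s U v) :
    weakGrad U (u + v) =ᵐ[volume.restrict U] weakGrad U u + weakGrad U v :=
  (hu.hasWeakGrad.add hv.hasWeakGrad).weakGrad_ae_eq hU

lemma weakGrad_sub (hU : IsOpen U) (hu : MemSobolev s U u) (hv : MemSobolev s U v) :
    weakGrad U (u - v) =ᵐ[volume.restrict U] weakGrad U u - weakGrad U v :=
  (hu.hasWeakGrad.sub hv.hasWeakGrad).weakGrad_ae_eq hU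

lemma weakGrad_smul (hU : IsOpen U) (c : ℝ) (hu : MemSobolev s U u) :
    weakGrad U (c • u) =ᵐ[volume.restrict U] c • weakGrad U u :=
  (hu.hasWeakGrad.const_smul c).weakGrad_ae_eq hU

lemma mono (hU : IsOpen U) (hVU : V ⊆ U) (hVf : volume V ≠ ⊤) {p : ℝ}
    (hsp : s ≤ p) (hu : MemSobolev p U u) : MemSobolev s V u := by
  have : IsFiniteMeasure (volume.restrict V) := ⟨by simpa using hVf.lt_top⟩
  have hle := Measure.restrict_mono hVU (le_refl (volume : Measure (Space n)))
  exact (hu.hasWeakGrad.mono hVU).memSobolev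
    ((hu.1.mono_measure hle).mono_exponent (ENNReal.ofReal_le_ofReal hsp))
    (((hu.memLp_weakGrad hU).mono_measure hle).mono_exponent (ENNReal.ofReal_le_ofReal hsp))

end MemSobolev

lemma eLpNorm_gradient (hs : 0 < s) (φ : Space n → ℝ) :
    eLpNorm (gradient φ) (ENNReal.ofReal s) (volume.restrict U) =
      (∫⁻ x in U, ‖fderiv ℝ φ x‖ₑ ^ s) ^ (1 / s) := by
  rw [eLpNorm_eq_lintegral_rpow_enorm_toReal (by simpa using hs) (by simp),
    ENNReal.toReal_ofReal hs.le]
  simp_rw [enorm_gradient]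

/-- Weak gradients pass to limits in `L¹`. -/
lemma HasWeakGrad.of_tendsto {w : ℕ → Space n → ℝ} {Gw : ℕ → Space n → Space n}
    (hw : ∀ k, HasWeakGrad U (w k) (Gw k))
    (hu : IntegrableOn u U) (hG : IntegrableOn G U)
    (h1 : Tendsto (fun k => eLpNorm (w k - u) 1 (volume.restrict U)) atTop (𝓝 0))
    (h2 : Tendsto (fun k => eLpNorm (Gw k - G) 1 (volume.restrict U)) atTop (𝓝 0)) :
    HasWeakGrad U u G := by
  have key : ∀ {F : Type} [NormedAddCommGroup F] [NormedSpace ℝ F] {f : ℕ → Space n → F}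
      {g : Space n → F} {ψ : Space n → ℝ}, Continuous ψ → HasCompactSupport ψ → tsupport ψ ⊆ U →
      (∀ k, LocallyIntegrableOn (f k) U) → LocallyIntegrableOn g U →
      Tendsto (fun k => eLpNorm (f k - g) 1 (volume.restrict U)) atTop (𝓝 0) →
      Tendsto (fun k => ∫ x, ψ x • f k x) atTop (𝓝 (∫ x, ψ x • g x)) := by
    intro F _ _ f g ψ hψ hc hs hf hg ht
    obtain ⟨C, hC⟩ := hc.exists_bound_of_continuous hψ
    simp only [← setIntegral_eq_of_tsupport_subset hs]
    refine tendsto_integral_of_L1 _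
      (integrable_smul_of_tsupport_subset hg hψ hc hs).restrict.aestronglyMeasurable
      (Eventually.of_forall fun k =>
        (integrable_smul_of_tsupport_subset (hf k) hψ hc hs).restrict) ?_
    have hlim : Tendsto (fun k => ENNReal.ofReal C * eLpNorm (f k - g) 1 (volume.restrict U))
        atTop (𝓝 0) := by
      simpa using ENNReal.Tendsto.const_mul ht (Or.inr ENNReal.ofReal_ne_top)
    refine tendsto_of_tendsto_of_tendsto_of_le_of_le tendsto_const_nhds hlim
      (fun _ => zero_le) fun k => ?_
    rw [eLpNorm_one_eq_lintegral_enorm, ← lintegral_const_mul' _ _ ENNReal.ofReal_ne_top]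
    refine lintegral_mono fun x => ?_
    rw [← smul_sub, enorm_smul]
    gcongr
    · rw [← ofReal_norm]
      exact ENNReal.ofReal_le_ofReal (hC x)
    · exact le_rfl
  rw [hasWeakGrad_iff]
  refine ⟨hu.locallyIntegrableOn, hG.locallyIntegrableOn, fun φ hφ hc hs e => ?_⟩
  have hφ1 : ContDiff ℝ 1 φ := hφ.of_le (by simp)
  have t1 := key (continuous_fderiv_apply_of_contDiff hφ1 e)
    (hc.of_isClosed_subset (isClosed_tsupport _) (tsupport_fderiv_apply_subset' φ e))
    ((tsupport_fderiv_apply_subset' φ e).trans hs) (fun k => (hw k).1) hu.locallyIntegrableOn h1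
  have t2 := key hφ.continuous hc hs (fun k => (hw k).2.1) hG.locallyIntegrableOn h2
  refine tendsto_nhds_unique t1 ?_
  have t3 : Tendsto (fun k => -⟪∫ x, φ x • Gw k x, e⟫) atTop (𝓝 (-⟪∫ x, φ x • G x, e⟫)) :=
    (t2.inner tendsto_const_nhds).neg
  exact t3.congr fun k => ((hasWeakGrad_iff.1 (hw k)).2.2 φ hφ hc hs e).symm

/-! ### Functions that vanish on the outer boundary -/

namespace VanishesOnBoundary

lemma add (hU : IsOpen U) (hs : 1 ≤ s) (hu : VanishesOnBoundary s Ω U u)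
    (hv : VanishesOnBoundary s Ω U v) : VanishesOnBoundary s Ω U (u + v) := by
  obtain ⟨hu, φ, hφ, hφt⟩ := hu
  obtain ⟨hv, ψ, hψ, hψt⟩ := hv
  refine ⟨hu.add hU hv, fun k => φ k + ψ k, fun k => ⟨(hφ k).1.add (hψ k).1,
    (hφ k).2.1.add (hψ k).2.1, (tsupport_add (φ k) (ψ k)).trans
      (union_subset (hφ k).2.2 (hψ k).2.2)⟩, ?_⟩
  refine tendsto_of_tendsto_of_tendsto_of_le_of_le tendsto_const_nhds
    (by simpa using hφt.add hψt) (fun _ => zero_le) fun k => ?_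
  have e : φ k + ψ k - (u + v) = (φ k - u) + (ψ k - v) := by abel
  rw [e]
  exact ((HasWeakGrad.of_contDiff (hφ k).1).sub hu.hasWeakGrad).sobolevNorm_add_le hU hs
    ((HasWeakGrad.of_contDiff (hψ k).1).sub hv.hasWeakGrad)

lemma const_smul (hU : IsOpen U) (c : ℝ) (hu : VanishesOnBoundary s Ω U u) :
    VanishesOnBoundary s Ω U (c • u) := by
  obtain ⟨hu, φ, hφ, hφt⟩ := hu
  refine ⟨hu.const_smul hU c, fun k => c • φ k, fun k => ⟨(hφ k).1.const_smul c,
    (hφ k).2.1.smul_left (f := fun _ => c),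
    (tsupport_smul_subset_right (fun _ => c) (φ k)).trans (hφ k).2.2⟩, ?_⟩
  have := ENNReal.Tendsto.const_mul (a := ‖c‖ₑ) hφt (Or.inr enorm_ne_top)
  rw [mul_zero] at this
  refine this.congr fun k => ?_
  rw [← smul_sub,
    ((HasWeakGrad.of_contDiff (hφ k).1).sub hu.hasWeakGrad).sobolevNorm_smul hU]

lemma sub (hU : IsOpen U) (hs : 1 ≤ s) (hu : VanishesOnBoundary s Ω U u)
    (hv : VanishesOnBoundary s Ω U v) : VanishesOnBoundary s Ω U (u - v) := by
  have := hu.add hU hs (hv.const_smul hU (-1))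
  simpa [sub_eq_add_neg] using this

/-- Diagonal argument: for each k a test function within 1/(k + 1) of `w k` is chosen. -/
lemma of_tendsto (hU : IsOpen U) (hs : 1 ≤ s) {w : ℕ → Space n → ℝ}
    (hw : ∀ k, VanishesOnBoundary s Ω U (w k)) (hu : MemSobolev s U u)
    (ht : Tendsto (fun k => sobolevNorm s U (w k - u)) atTop (𝓝 0)) :
    VanishesOnBoundary s Ω U u := by
  have h : ∀ k : ℕ, ∃ φ : Space n → ℝ, (ContDiff ℝ 1 φ ∧ HasCompactSupport φ ∧ tsupport φ ⊆ Ω) ∧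
      sobolevNorm s U (φ - w k) < ((k : ℝ≥0∞) + 1)⁻¹ := by
    intro k
    obtain ⟨-, φ, hφ, hφt⟩ := hw k
    have hpos : (0 : ℝ≥0∞) < ((k : ℝ≥0∞) + 1)⁻¹ :=
      ENNReal.inv_pos.2 (ENNReal.add_ne_top.2 ⟨ENNReal.natCast_ne_top k, ENNReal.one_ne_top⟩)
    obtain ⟨j, hj⟩ := (hφt.eventually (gt_mem_nhds hpos)).exists
    exact ⟨φ j, hφ j, hj⟩
  choose φ hφ hφt using h
  refine ⟨hu, φ, hφ, ?_⟩
  have h0 : Tendsto (fun k : ℕ => ((k : ℝ≥0∞) + 1)⁻¹) atTop (𝓝 0) := by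
    have := (tendsto_add_atTop_iff_nat 1).2 ENNReal.tendsto_inv_nat_nhds_zero
    simpa using this
  refine tendsto_of_tendsto_of_tendsto_of_le_of_le tendsto_const_nhds
    (by simpa using h0.add ht) (fun _ => zero_le) fun k => ?_
  have e : φ k - u = (φ k - w k) + (w k - u) := by abel
  rw [e]
  refine (((HasWeakGrad.of_contDiff (hφ k).1).sub (hw k).1.hasWeakGrad).sobolevNorm_add_le hU hs
    ((hw k).1.hasWeakGrad.sub hu.hasWeakGrad)).trans ?_
  gcongr
  exact (hφt k).le

end VanishesOnBoundary

/-- The Poincaré inequality for functions that vanish on the outer boundary. -/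
lemma PoincareOn.exists_eLpNorm_le (hP : PoincareOn s Ω U U) (hU : IsOpen U) (hs : 1 ≤ s) :
    ∃ C : ℝ≥0∞, C ≠ ⊤ ∧ ∀ w, VanishesOnBoundary s Ω U w →
      eLpNorm w (ENNReal.ofReal s) (volume.restrict U) ≤
        C * eLpNorm (weakGrad U w) (ENNReal.ofReal s) (volume.restrict U) := by
  have hs0 : 0 < s := by linarith
  obtain ⟨C, hC, h⟩ := hP
  refine ⟨C ^ (1 / s), ENNReal.rpow_ne_top_of_nonneg (by positivity) hC, ?_⟩
  set K := C ^ (1 / s) with hK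
  have hKt : K ≠ ⊤ := ENNReal.rpow_ne_top_of_nonneg (by positivity) hC
  have hφ : ∀ φ : Space n → ℝ, ContDiff ℝ 1 φ → tsupport φ ⊆ Ω →
      eLpNorm φ (ENNReal.ofReal s) (volume.restrict U) ≤
        K * eLpNorm (gradient φ) (ENNReal.ofReal s) (volume.restrict U) := by
    intro φ h1 h2
    rw [eLpNorm_gradient hs0, eLpNorm_eq_lintegral_rpow_enorm_toReal (by simpa using hs0) (by simp),
      ENNReal.toReal_ofReal hs0.le, ← ENNReal.mul_rpow_of_nonneg _ _ (by positivity)]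
    gcongr
    exact h φ h1 h2
  rintro w ⟨hw, φ, hφ', ht⟩
  have hlim : Tendsto (fun k => K * (eLpNorm (weakGrad U w) (ENNReal.ofReal s) (volume.restrict U)
      + sobolevNorm s U (φ k - w)) + sobolevNorm s U (φ k - w)) atTop
      (𝓝 (K * eLpNorm (weakGrad U w) (ENNReal.ofReal s) (volume.restrict U))) := by
    have := (ENNReal.Tendsto.const_mul (ht.const_add
      (eLpNorm (weakGrad U w) (ENNReal.ofReal s) (volume.restrict U))) (Or.inr hKt)).add ht
    simpa using this
  refine ge_of_tendsto' hlim fun k => ?_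
  have hg := HasWeakGrad.of_contDiff (U := U) (hφ' k).1
  have hd := hg.sub hw.hasWeakGrad
  have hle1 : eLpNorm (φ k - w) (ENNReal.ofReal s) (volume.restrict U)
      ≤ sobolevNorm s U (φ k - w) := le_self_add
  have hle2 : eLpNorm (gradient (φ k) - weakGrad U w) (ENNReal.ofReal s) (volume.restrict U)
      ≤ sobolevNorm s U (φ k - w) := by
    rw [hd.sobolevNorm_eq hU]
    exact le_add_self
  have hle3 : eLpNorm (gradient (φ k)) (ENNReal.ofReal s) (volume.restrict U) ≤
      eLpNorm (weakGrad U w) (ENNReal.ofReal s) (volume.restrict U)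
        + sobolevNorm s U (φ k - w) := by
    have h := eLpNorm_add_le hw.hasWeakGrad.aestronglyMeasurable.2 hd.aestronglyMeasurable.2
      (one_le_ofReal hs)
    rw [add_sub_cancel] at h
    exact h.trans (by gcongr)
  calc eLpNorm w (ENNReal.ofReal s) (volume.restrict U)
      = eLpNorm (φ k - (φ k - w)) (ENNReal.ofReal s) (volume.restrict U) := by
        rw [sub_sub_cancel]
    _ ≤ eLpNorm (φ k) (ENNReal.ofReal s) (volume.restrict U)
      + eLpNorm (φ k - w) (ENNReal.ofReal s) (volume.restrict U) :=
        eLpNorm_sub_le hg.aestronglyMeasurable.1 hd.aestronglyMeasurable.1 (one_le_ofReal hs)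
    _ ≤ K * eLpNorm (gradient (φ k)) (ENNReal.ofReal s) (volume.restrict U)
      + sobolevNorm s U (φ k - w) := add_le_add (hφ _ (hφ' k).1 (hφ' k).2.2) hle1
    _ ≤ _ := by gcongr

/-- Functions vanishing on the outer boundary whose gradients form a Cauchy sequence converge. -/
lemma PoincareOn.exists_tendsto_of_cauchy (hP : PoincareOn s Ω U U) (hU : IsOpen U)
    (hUf : volume U ≠ ⊤) (hs : 1 ≤ s) {w : ℕ → Space n → ℝ}
    (hw : ∀ k, VanishesOnBoundary s Ω U (w k))
    (hc : ∀ ε > 0, ∃ N, ∀ j ≥ N, ∀ k ≥ N, eLpNorm (weakGrad U (w j) - weakGrad U (w k))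
      (ENNReal.ofReal s) (volume.restrict U) < ε) :
    ∃ v, VanishesOnBoundary s Ω U v ∧ Tendsto (fun k => eLpNorm (weakGrad U (w k) - weakGrad U v)
      (ENNReal.ofReal s) (volume.restrict U)) atTop (𝓝 0) := by
  have : IsFiniteMeasure (volume.restrict U) := ⟨by simpa using hUf.lt_top⟩
  obtain ⟨C, hC, hP⟩ := hP.exists_eLpNorm_le hU hs
  have hs1 := one_le_ofReal hs
  -- Gradients converge to `G` by completeness, and the functions converge to `v` because the
  -- Poincaré inequality makes them Cauchy too. On a set of finite measure both limits hold in L¹,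
  -- which identifies `G` as the gradient of `v`.
  obtain ⟨G, hG, hGt⟩ := exists_tendsto_eLpNorm_of_cauchy hs1
    (fun k => (hw k).1.memLp_weakGrad hU) hc
  obtain ⟨v, hv, hvt⟩ := exists_tendsto_eLpNorm_of_cauchy hs1 (fun k => (hw k).1.1) (by
    intro ε hε
    have h0 : Tendsto (fun d : ℝ≥0∞ => C * d) (𝓝 0) (𝓝 0) := by
      simpa using ENNReal.Tendsto.const_mul (tendsto_id (α := ℝ≥0∞) (x := 𝓝 0)) (Or.inr hC)
    obtain ⟨d, hd0, hd⟩ : ∃ d : ℝ≥0∞, 0 < d ∧ C * d < ε := by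
      have hev := (h0.mono_left (nhdsWithin_le_nhds (s := Ioi (0 : ℝ≥0∞)))).eventually
        (gt_mem_nhds hε)
      obtain ⟨d, hd, hd'⟩ := (hev.and self_mem_nhdsWithin).exists
      exact ⟨d, hd', hd⟩
    obtain ⟨N, hN⟩ := hc d hd0
    refine ⟨N, fun j hj k hk => lt_of_le_of_lt ?_ hd⟩
    refine (hP _ ((hw j).sub hU hs (hw k))).trans ?_
    rw [eLpNorm_congr_ae ((hw j).1.weakGrad_sub hU (hw k).1)]
    gcongr
    exact (hN j hj k hk).le)
  have to1 : ∀ {F : Type} [NormedAddCommGroup F] {f : ℕ → Space n → F} {g : Space n → F},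
      (∀ k, AEStronglyMeasurable (f k - g) (volume.restrict U)) →
      Tendsto (fun k => eLpNorm (f k - g) (ENNReal.ofReal s) (volume.restrict U)) atTop (𝓝 0) →
      Tendsto (fun k => eLpNorm (f k - g) 1 (volume.restrict U)) atTop (𝓝 0) := by
    intro F _ f g hm ht
    have hlim := ENNReal.Tendsto.mul_const
      (b := (volume.restrict U) univ ^ (1 / (1 : ℝ≥0∞).toReal - 1 / (ENNReal.ofReal s).toReal)) ht
      (Or.inr (ENNReal.rpow_ne_top_of_nonneg (by
        rw [ENNReal.toReal_ofReal (by linarith), ENNReal.toReal_one, div_one, sub_nonneg]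
        exact (div_le_one (by linarith)).2 hs) (measure_ne_top _ _)))
    rw [zero_mul] at hlim
    exact tendsto_of_tendsto_of_tendsto_of_le_of_le tendsto_const_nhds hlim (fun _ => zero_le)
      fun k => eLpNorm_le_eLpNorm_mul_rpow_measure_univ hs1 (hm k)
  have hgrad : HasWeakGrad U v G := HasWeakGrad.of_tendsto (fun k => (hw k).1.hasWeakGrad)
    (hv.integrable hs1) (hG.integrable hs1)
    (to1 (fun k => (hw k).1.1.1.sub hv.1) hvt)
    (to1 (fun k => ((hw k).1.memLp_weakGrad hU).1.sub hG.1) hGt)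
  have hGt' : Tendsto (fun k => eLpNorm (weakGrad U (w k) - weakGrad U v)
      (ENNReal.ofReal s) (volume.restrict U)) atTop (𝓝 0) := by
    refine hGt.congr fun k => eLpNorm_congr_ae ?_
    exact (ae_eq_refl _).sub (hgrad.weakGrad_ae_eq hU).symm
  have hvS := hgrad.memSobolev hv hG
  refine ⟨v, VanishesOnBoundary.of_tendsto hU hs hw hvS ?_, hGt'⟩
  have := hvt.add hGt'
  rw [add_zero] at this
  exact this.congr fun k =>
    (((hw k).1.hasWeakGrad.sub hvS.hasWeakGrad).sobolevNorm_eq hU).symm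

end Sobolev

/-! ### Pointwise properties of the energy density -/

/-- The bounds at a fixed point `x` for the conductivity `g = σ(x, ·)`, with uniform constants. -/
structure IsConductivity (n : ℕ) (r c C κ : ℝ) (g : ℝ → ℝ) : Prop where
  continuousOn : ContinuousOn g (Ioi 0)
  lower : ∀ E > 0, c * E ^ (r - 1) ≤ g E * E
  upper_zero : ∀ E > 0, g E * E ≤ C * (E + E ^ (r - 1))
  upper_infty : ∀ E > 0, g E * E ≤ C * (1 + E ^ (r - 1))
  strongMono : ∀ e₁ e₂ : Space n,
    (2 ≤ r → κ * ‖e₂ - e₁‖ ^ r ≤ ⟪g ‖e₂‖ • e₂ - g ‖e₁‖ • e₁, e₂ - e₁⟫) ∧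
    (r < 2 → κ * (1 + ‖e₂‖ ^ 2 + ‖e₁‖ ^ 2) ^ ((r - 2) / 2) * ‖e₂ - e₁‖ ^ 2 ≤
      ⟪g ‖e₂‖ • e₂ - g ‖e₁‖ • e₁, e₂ - e₁⟫)

/-- The energy density of the conductivity `g`. -/
def potential (g : ℝ → ℝ) (E : ℝ) : ℝ := ∫ ξ in (0 : ℝ)..E, g ξ * ξ

namespace IsConductivity

variable {r c C κ : ℝ} {g : ℝ → ℝ}

lemma mono_inner (hg : IsConductivity n r c C κ g) (hκ : 0 ≤ κ) (e₁ e₂ : Space n) :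
    0 ≤ ⟪g ‖e₂‖ • e₂ - g ‖e₁‖ • e₁, e₂ - e₁⟫ := by
  rcases le_or_gt 2 r with h | h
  · exact le_trans (by positivity) ((hg.strongMono e₁ e₂).1 h)
  · exact le_trans (by positivity) ((hg.strongMono e₁ e₂).2 h)

lemma const_mul_nonneg (hg : IsConductivity n r c C κ g) (hc : 0 ≤ c) {E : ℝ} (hE : 0 ≤ E) :
    0 ≤ g E * E := by
  rcases hE.eq_or_lt with rfl | hE
  · simp
  · exact le_trans (by positivity) (hg.lower E hE)

lemma nonneg (hg : IsConductivity n r c C κ g) (hc : 0 ≤ c) {E : ℝ} (hE : 0 < E) : 0 ≤ g E :=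
  nonneg_of_mul_nonneg_left (hg.const_mul_nonneg hc hE.le) hE

/-- Monotonicity of the vector flux is tested on two multiples of one unit vector, which exists
because the dimension is positive. -/
lemma monotone (hn : 2 ≤ n) (hg : IsConductivity n r c C κ g) (hκ : 0 ≤ κ) {E F : ℝ} (hE : 0 ≤ E)
    (hEF : E ≤ F) : g E * E ≤ g F * F := by
  rcases hEF.eq_or_lt with rfl | hlt
  · exact le_rfl
  have hF : 0 ≤ F := hE.trans hEF
  have : Nonempty (Fin n) := ⟨⟨0, by omega⟩⟩
  obtain ⟨e, he⟩ := exists_norm_eq (Space n) zero_le_one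
  have h := hg.mono_inner hκ (E • e) (F • e)
  rw [norm_smul, norm_smul, he, Real.norm_of_nonneg hE, Real.norm_of_nonneg hF, mul_one, mul_one,
    smul_smul, smul_smul, ← sub_smul, ← sub_smul, real_inner_smul_left, real_inner_smul_right,
    real_inner_self_eq_norm_sq, he] at h
  have : 0 < F - E := sub_pos.2 hlt
  have := nonneg_of_mul_nonneg_left (a := g F * F - g E * E) (b := F - E) (by linarith) this
  linarith

lemma continuous_flux (hg : IsConductivity n r c C κ g) (hr : 1 < r) (hc : 0 ≤ c)
    {F : Type*} [NormedAddCommGroup F] [NormedSpace ℝ F] :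
    Continuous fun e : F => g ‖e‖ • e := by
  rw [continuous_iff_continuousAt]
  intro e
  rcases eq_or_ne e 0 with rfl | he
  · rw [ContinuousAt, smul_zero]
    -- At the origin continuity comes from `upper_zero`, whose right side tends to 0; `upper_infty`
    -- would only give boundedness.
    have hlim : Tendsto (fun e : F => C * (‖e‖ + ‖e‖ ^ (r - 1))) (𝓝 0) (𝓝 0) := by
      have : Continuous fun e : F => C * (‖e‖ + ‖e‖ ^ (r - 1)) :=
        continuous_const.mul (continuous_norm.add
          (continuous_norm.rpow_const fun _ => Or.inr (by linarith)))
      have h := this.tendsto 0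
      simpa [Real.zero_rpow (by linarith : r - 1 ≠ 0)] using h
    refine squeeze_zero_norm (fun e => ?_) hlim
    rcases eq_or_ne e 0 with rfl | he
    · simp [Real.zero_rpow (by linarith : r - 1 ≠ 0)]
    · have he' : 0 < ‖e‖ := norm_pos_iff.2 he
      rw [norm_smul, Real.norm_of_nonneg (hg.nonneg hc he')]
      exact hg.upper_zero _ he'
  · have : ContinuousAt g ‖e‖ := hg.continuousOn.continuousAt (Ioi_mem_nhds (norm_pos_iff.2 he))
    exact ContinuousAt.smul (this.comp continuous_norm.continuousAt) continuousAt_id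

/-- With |E| in place of E the integrand of the energy density is continuous on all of ℝ, whatever
`g` does off (0, ∞), so all its interval integrals exist. -/
lemma continuous_abs (hg : IsConductivity n r c C κ g) (hr : 1 < r) (hc : 0 ≤ c) :
    Continuous fun E : ℝ => g |E| * |E| := by
  have := (hg.continuous_flux hr hc (F := ℝ)).norm
  refine this.congr fun E => ?_
  rcases eq_or_ne E 0 with rfl | hE
  · simp
  · rw [norm_smul, Real.norm_eq_abs E, Real.norm_of_nonneg (hg.nonneg hc (abs_pos.2 hE))]

lemma potential_eq {E : ℝ} (hE : 0 ≤ E) : potential g E = ∫ ξ in (0 : ℝ)..E, g |ξ| * |ξ| := by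
  refine intervalIntegral.integral_congr fun ξ hξ => ?_
  rw [uIcc_of_le hE] at hξ
  simp [abs_of_nonneg hξ.1]

lemma continuous_potential (hg : IsConductivity n r c C κ g) (hr : 1 < r) (hc : 0 ≤ c) :
    Continuous fun e : Space n => potential g ‖e‖ := by
  have h := hg.continuous_abs hr hc
  simp only [potential_eq (norm_nonneg _)]
  exact (intervalIntegral.continuous_primitive (fun a b => h.intervalIntegrable a b) 0).comp
    continuous_norm

lemma potential_sub (hg : IsConductivity n r c C κ g) (hr : 1 < r) (hc : 0 ≤ c) {E F : ℝ}
    (hE : 0 ≤ E) (hF : 0 ≤ F) :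
    potential g F - potential g E = ∫ ξ in E..F, g |ξ| * |ξ| := by
  have h := hg.continuous_abs hr hc
  rw [potential_eq hE, potential_eq hF, intervalIntegral.integral_interval_sub_left
    (h.intervalIntegrable _ _) (h.intervalIntegrable _ _)]

/-- The potential is a primitive of the nondecreasing function E ↦ g(E) E, so it lies above its
tangents. -/
lemma le_potential_sub (hn : 2 ≤ n) (hg : IsConductivity n r c C κ g) (hr : 1 < r) (hc : 0 ≤ c)
    (hκ : 0 ≤ κ) {E F : ℝ} (hE : 0 ≤ E) (hF : 0 ≤ F) :
    g E * E * (F - E) ≤ potential g F - potential g E := by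
  have h := hg.continuous_abs hr hc
  rcases le_total E F with hEF | hEF
  · rw [hg.potential_sub hr hc hE hF]
    have := intervalIntegral.integral_mono_on hEF
      (intervalIntegrable_const (c := g E * E) (μ := volume)) (h.intervalIntegrable _ _) (fun ξ hξ => by
        rw [abs_of_nonneg (hE.trans hξ.1)]
        exact hg.monotone hn hκ hE hξ.1)
    rw [intervalIntegral.integral_const, smul_eq_mul] at this
    linarith
  · have h1 := hg.potential_sub hr hc hF hE
    have := intervalIntegral.integral_mono_on hEF (h.intervalIntegrable _ _)
      (intervalIntegrable_const (c := g E * E) (μ := volume)) (fun ξ hξ => by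
        rw [abs_of_nonneg (hF.trans hξ.1)]
        exact hg.monotone hn hκ (hF.trans hξ.1) hξ.2)
    rw [intervalIntegral.integral_const, smul_eq_mul] at this
    linarith

/-- Convexity of the energy density. -/
lemma le_potential_norm_sub (hn : 2 ≤ n) (hg : IsConductivity n r c C κ g) (hr : 1 < r)
    (hc : 0 ≤ c) (hκ : 0 ≤ κ) (a b : Space n) :
    ⟪g ‖a‖ • a, b - a⟫ ≤ potential g ‖b‖ - potential g ‖a‖ := by
  refine le_trans ?_ (hg.le_potential_sub hn hr hc hκ (norm_nonneg a) (norm_nonneg b))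
  rcases eq_or_ne a 0 with rfl | ha
  · simp
  have h0 := hg.nonneg hc (norm_pos_iff.2 ha)
  rw [real_inner_smul_left, inner_sub_right, real_inner_self_eq_norm_sq]
  -- As g‖a‖ ≥ 0, Cauchy–Schwarz reduces the claim to the scalar tangent inequality at ‖a‖.
  have h1 := real_inner_le_norm a b
  nlinarith

lemma potential_zero : potential g 0 = 0 := by simp [potential]

lemma potential_lower (hg : IsConductivity n r c C κ g) (hr : 1 < r) (hc : 0 ≤ c) {E : ℝ}
    (hE : 0 ≤ E) : c / r * E ^ r ≤ potential g E := by
  have h := hg.continuous_abs hr hc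
  have hcont : Continuous fun ξ : ℝ => c * |ξ| ^ (r - 1) :=
    continuous_const.mul (_root_.continuous_abs.rpow_const fun _ => Or.inr (by linarith))
  have h1 := intervalIntegral.integral_mono_on (μ := volume) hE
    (hcont.intervalIntegrable 0 E) (h.intervalIntegrable 0 E) (fun ξ hξ => by
      rcases hξ.1.eq_or_lt with rfl | h0
      · simp [Real.zero_rpow (by linarith : r - 1 ≠ 0)]
      · rw [abs_of_pos h0]
        exact hg.lower ξ h0)
  have h2 : ∫ ξ in (0 : ℝ)..E, c * |ξ| ^ (r - 1) = c / r * E ^ r := by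
    rw [intervalIntegral.integral_congr (g := fun ξ => c * ξ ^ (r - 1)) (fun ξ hξ => by
      rw [uIcc_of_le hE] at hξ
      simp [abs_of_nonneg hξ.1]), intervalIntegral.integral_const_mul,
      integral_rpow (Or.inl (by linarith))]
    simp [Real.zero_rpow (by linarith : r ≠ 0)]
    ring
  rw [potential_eq hE]
  linarith

lemma potential_nonneg (hg : IsConductivity n r c C κ g) (hr : 1 < r) (hc : 0 ≤ c) {E : ℝ}
    (hE : 0 ≤ E) : 0 ≤ potential g E :=
  le_trans (by positivity) (hg.potential_lower hr hc hE)

/-- Growth of the flux `g |a| a`. -/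
lemma abs_inner_flux_le (hg : IsConductivity n r c C κ g) (hr : 1 < r) (hc : 0 ≤ c) (hC : 0 ≤ C)
    (a b : Space n) :
    |g ‖a‖ * ⟪a, b⟫| ≤ 2 * C * (1 + ‖a‖ ^ r + ‖b‖ ^ r) := by
  rcases eq_or_ne a 0 with rfl | ha
  · simp only [inner_zero_left, mul_zero, abs_zero]
    positivity
  have ha' := norm_pos_iff.2 ha
  have h0 := hg.nonneg hc ha'
  have h1 : |g ‖a‖ * ⟪a, b⟫| ≤ g ‖a‖ * ‖a‖ * ‖b‖ := by
    rw [abs_mul, abs_of_nonneg h0, mul_assoc]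
    exact mul_le_mul_of_nonneg_left (abs_real_inner_le_norm a b) h0
  have h2 := mul_le_mul_of_nonneg_right (hg.upper_infty _ ha') (norm_nonneg b)
  -- One number M ≥ 1 dominates both norms, so each mixed product is at most a power M^r, which in
  -- turn is bounded by the sum of the three candidates.
  set M := max 1 (max ‖a‖ ‖b‖) with hM
  have M1 : 1 ≤ M := le_max_left _ _
  have Ma : ‖a‖ ≤ M := (le_max_left _ _).trans (le_max_right _ _)
  have Mb : ‖b‖ ≤ M := (le_max_right _ _).trans (le_max_right _ _)
  have h3 : (1 + ‖a‖ ^ (r - 1)) * ‖b‖ ≤ 2 * M ^ r := by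
    have e1 : ‖a‖ ^ (r - 1) ≤ M ^ (r - 1) := Real.rpow_le_rpow ha'.le Ma (by linarith)
    have e2 : 1 ≤ M ^ (r - 1) := Real.one_le_rpow M1 (by linarith)
    have e3 : M ^ r = M ^ (r - 1) * M := by
      rw [← Real.rpow_add_one (by linarith)]
      congr 1; ring
    calc (1 + ‖a‖ ^ (r - 1)) * ‖b‖ ≤ (M ^ (r - 1) + M ^ (r - 1)) * M := by gcongr
      _ = _ := by rw [e3]; ring
  have h4 : M ^ r ≤ 1 + ‖a‖ ^ r + ‖b‖ ^ r := by
    have pa : 0 ≤ ‖a‖ ^ r := by positivity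
    have pb : 0 ≤ ‖b‖ ^ r := by positivity
    rcases max_choice 1 (max ‖a‖ ‖b‖) with h | h
    · rw [hM, h, Real.one_rpow]; linarith
    · rcases max_choice ‖a‖ ‖b‖ with h' | h'
      · rw [hM, h, h']; linarith
      · rw [hM, h, h']; linarith
  calc |g ‖a‖ * ⟪a, b⟫| ≤ C * ((1 + ‖a‖ ^ (r - 1)) * ‖b‖) := by linarith
    _ ≤ C * (2 * (1 + ‖a‖ ^ r + ‖b‖ ^ r)) :=
      mul_le_mul_of_nonneg_left (by linarith) hC
    _ = _ := by ring

/-- The tangent inequality at `a`, evaluated at 0, bounds the potential by the flux times `a`, to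
which the growth bound applies. -/
lemma potential_upper (hn : 2 ≤ n) (hg : IsConductivity n r c C κ g) (hr : 1 < r) (hc : 0 ≤ c)
    (hκ : 0 ≤ κ) (hC : 0 ≤ C) (a : Space n) :
    potential g ‖a‖ ≤ 4 * C * (1 + ‖a‖ ^ r) := by
  have h1 := hg.le_potential_norm_sub hn hr hc hκ a 0
  have h2 := (abs_le.1 (hg.abs_inner_flux_le hr hc hC a a)).2
  rw [zero_sub, inner_neg_right, real_inner_smul_left, norm_zero, potential_zero] at h1
  have : 0 ≤ ‖a‖ ^ r := by positivity
  nlinarith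

/-- Strong midpoint convexity of the energy density. -/
lemma le_potential_midpoint (hn : 2 ≤ n) (hg : IsConductivity n r c C κ g) (hr : 1 < r)
    (hc : 0 ≤ c) (hκ : 0 ≤ κ) (a b : Space n) :
    (2 ≤ r → κ / 2 * ((1 / 2) ^ r * ‖a - b‖ ^ r) ≤ potential g ‖a‖ + potential g ‖b‖
      - 2 * potential g ‖(1 / 2 : ℝ) • (a + b)‖) ∧
    (r < 2 → κ / 8 * ((1 + ‖a‖ ^ 2 + ‖b‖ ^ 2) ^ ((r - 2) / 2) * ‖a - b‖ ^ 2) ≤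
      potential g ‖a‖ + potential g ‖b‖ - 2 * potential g ‖(1 / 2 : ℝ) • (a + b)‖) := by
  set m : Space n := (1 / 2 : ℝ) • (a + b) with hm
  -- The points p and q lie halfway between the midpoint m and the ends. Summing the tangent
  -- inequalities p → a, m → p, q → b, m → q cancels the flux at m and leaves ½⟪flux p − flux q, p −
  -- q⟫, to which strong monotonicity applies.
  set p : Space n := (1 / 4 : ℝ) • (3 • a + b) with hp
  set q : Space n := (1 / 4 : ℝ) • (a + 3 • b) with hq
  have d1 : a - p = (1 / 4 : ℝ) • (a - b) := by rw [hp]; module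
  have d2 : p - m = (1 / 4 : ℝ) • (a - b) := by rw [hp, hm]; module
  have d3 : b - q = (-(1 / 4) : ℝ) • (a - b) := by rw [hq]; module
  have d4 : q - m = (-(1 / 4) : ℝ) • (a - b) := by rw [hq, hm]; module
  have d5 : p - q = (1 / 2 : ℝ) • (a - b) := by rw [hp, hq]; module
  have i1 := hg.le_potential_norm_sub hn hr hc hκ p a
  have i2 := hg.le_potential_norm_sub hn hr hc hκ m p
  have i3 := hg.le_potential_norm_sub hn hr hc hκ q b
  have i4 := hg.le_potential_norm_sub hn hr hc hκ m q
  rw [d1, real_inner_smul_right] at i1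
  rw [d2, real_inner_smul_right] at i2
  rw [d3, real_inner_smul_right] at i3
  rw [d4, real_inner_smul_right] at i4
  have key : 1 / 2 * ⟪g ‖p‖ • p - g ‖q‖ • q, p - q⟫ ≤
      potential g ‖a‖ + potential g ‖b‖ - 2 * potential g ‖m‖ := by
    rw [d5, real_inner_smul_right, inner_sub_left]
    linarith
  have nd : ‖p - q‖ = 1 / 2 * ‖a - b‖ := by
    rw [d5, norm_smul]; norm_num
  constructor
  · intro h
    have := (hg.strongMono q p).1 h
    rw [nd, Real.mul_rpow (by norm_num) (norm_nonneg _)] at this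
    linarith
  · intro h
    have := (hg.strongMono q p).2 h
    rw [nd] at this
    -- Since p + q = a + b and p − q is half of a − b, the parallelogram law shows that the sum of
    -- squares does not grow. The exponent of the weight is negative, so the weight at (p, q) is the
    -- larger one.
    have hle : 1 + ‖p‖ ^ 2 + ‖q‖ ^ 2 ≤ 1 + ‖a‖ ^ 2 + ‖b‖ ^ 2 := by
      have e1 : p + q = a + b := by rw [hp, hq]; module
      have e2 := parallelogram_law_with_norm ℝ p q
      have e3 := parallelogram_law_with_norm ℝ a b
      rw [e1, nd] at e2
      nlinarith [sq_nonneg ‖a - b‖]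
    have hpow : (1 + ‖a‖ ^ 2 + ‖b‖ ^ 2) ^ ((r - 2) / 2)
        ≤ (1 + ‖p‖ ^ 2 + ‖q‖ ^ 2) ^ ((r - 2) / 2) :=
      Real.rpow_le_rpow_of_nonpos (by positivity) hle (by linarith)
    have : κ * (1 + ‖a‖ ^ 2 + ‖b‖ ^ 2) ^ ((r - 2) / 2) * (1 / 2 * ‖a - b‖) ^ 2 ≤
        κ * (1 + ‖p‖ ^ 2 + ‖q‖ ^ 2) ^ ((r - 2) / 2) * (1 / 2 * ‖a - b‖) ^ 2 := by gcongr
    nlinarith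

end IsConductivity

/-- Split at the threshold η with η^s = ε: below it t^s ≤ ε, above it t^(s−r) ≤ η^(s−r). This allows
an exponent `s` below the growth exponent `r`. -/
lemma rpow_le_add_mul_rpow {s r ε : ℝ} (hs : 0 < s) (hsr : s ≤ r) (hε : 0 < ε) :
    ∃ K : ℝ, 0 < K ∧ ∀ t : ℝ, 0 ≤ t → t ^ s ≤ ε + K * t ^ r := by
  set η := ε ^ (1 / s) with hη
  have hη0 : 0 < η := by positivity
  refine ⟨η ^ (s - r), by positivity, fun t ht => ?_⟩
  rcases le_or_gt t η with h | h
  · have : t ^ s ≤ ε := by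
      calc t ^ s ≤ η ^ s := by gcongr
        _ = ε := by rw [hη, ← Real.rpow_mul hε.le, one_div, inv_mul_cancel₀ hs.ne', Real.rpow_one]
    have : 0 ≤ η ^ (s - r) * t ^ r := by positivity
    linarith
  · have ht0 : 0 < t := hη0.trans h
    have e : t ^ s = t ^ (s - r) * t ^ r := by
      rw [← Real.rpow_add ht0]; congr 1; ring
    have : t ^ (s - r) ≤ η ^ (s - r) := Real.rpow_le_rpow_of_nonpos hη0 h.le (by linarith)
    have h2 : t ^ (s - r) * t ^ r ≤ η ^ (s - r) * t ^ r := by gcongr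
    linarith

/-- Uniform convexity of the energy density. -/
lemma exists_rpow_norm_sub_le (hn : 2 ≤ n) {r c C κ s ε : ℝ} (hr : 1 < r) (hc : 0 < c)
    (hκ : 0 < κ) (hs : 0 < s) (hsr : s ≤ r) (hε : 0 < ε) :
    ∃ K : ℝ, 0 < K ∧ ∀ g, IsConductivity n r c C κ g → ∀ a b : Space n,
      ‖a - b‖ ^ s ≤ ε * (1 + potential g ‖a‖ + potential g ‖b‖) + K * (potential g ‖a‖
        + potential g ‖b‖ - 2 * potential g ‖(1 / 2 : ℝ) • (a + b)‖) := by
  obtain ⟨K₁, hK₁, h₁⟩ := rpow_le_add_mul_rpow hs hsr (half_pos hε)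
  have hr0 : 0 < r := by linarith
  rcases le_or_gt 2 r with h | h
  · refine ⟨K₁ * (2 / κ * 2 ^ r), by positivity, fun g hg a b => ?_⟩
    have h2 := (hg.le_potential_midpoint hn hr hc.le hκ.le a b).1 h
    have pa := hg.potential_nonneg hr hc.le (norm_nonneg a)
    have pb := hg.potential_nonneg hr hc.le (norm_nonneg b)
    have h3 := h₁ ‖a - b‖ (norm_nonneg _)
    set Δ := potential g ‖a‖ + potential g ‖b‖ - 2 * potential g ‖(1 / 2 : ℝ) • (a + b)‖
    have h4 : ‖a - b‖ ^ r ≤ 2 / κ * 2 ^ r * Δ := by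
      calc ‖a - b‖ ^ r = 2 / κ * 2 ^ r * (κ / 2 * ((1 / 2) ^ r * ‖a - b‖ ^ r)) := by
            rw [Real.div_rpow (by norm_num) (by norm_num), Real.one_rpow]
            field_simp
        _ ≤ _ := by gcongr
    calc ‖a - b‖ ^ s ≤ ε / 2 + K₁ * ‖a - b‖ ^ r := h3
      _ ≤ ε * (1 + potential g ‖a‖ + potential g ‖b‖) + K₁ * (2 / κ * 2 ^ r * Δ) := by
        gcongr
        nlinarith
      _ = _ := by ring
  · -- Young's inequality with the weight `(1 + |a|² + |b|²)^{(r-2)/2}`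
    set M := (3 : ℝ) ^ r * (1 + r / c) with hM
    have hM0 : 0 < M := by positivity
    -- M is such that W^r ≤ M(1 + Q(a) + Q(b)), with W the square root of 1 + |a|² + |b|². With this
    -- ε the weight term, multiplied by K₁, contributes exactly ε/2 of that sum.
    obtain ⟨K₂, hK₂, h₂⟩ := rpow_le_add_mul_rpow (s := r) (r := 2) hr0 h.le
      (ε := ε / (2 * K₁ * M)) (by positivity)
    refine ⟨K₁ * (K₂ * (8 / κ)), by positivity, fun g hg a b => ?_⟩
    have h2 := (hg.le_potential_midpoint hn hr hc.le hκ.le a b).2 h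
    have pa := hg.potential_nonneg hr hc.le (norm_nonneg a)
    have pb := hg.potential_nonneg hr hc.le (norm_nonneg b)
    have h3 := h₁ ‖a - b‖ (norm_nonneg _)
    set Δ := potential g ‖a‖ + potential g ‖b‖ - 2 * potential g ‖(1 / 2 : ℝ) • (a + b)‖
    set W := Real.sqrt (1 + ‖a‖ ^ 2 + ‖b‖ ^ 2) with hW
    have hW0 : 0 < W := Real.sqrt_pos.2 (by positivity)
    have hWpow : (1 + ‖a‖ ^ 2 + ‖b‖ ^ 2) ^ ((r - 2) / 2) = W ^ (r - 2) := by
      rw [hW, Real.sqrt_eq_rpow, ← Real.rpow_mul (by positivity)]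
      congr 1; ring
    rw [hWpow] at h2
    have h4 : W ^ (r - 2) * ‖a - b‖ ^ 2 ≤ 8 / κ * Δ := by
      calc W ^ (r - 2) * ‖a - b‖ ^ 2 = 8 / κ * (κ / 8 * (W ^ (r - 2) * ‖a - b‖ ^ 2)) := by
            field_simp
        _ ≤ _ := by gcongr
    have h5 : W ^ r ≤ M * (1 + potential g ‖a‖ + potential g ‖b‖) := by
      have w1 : W ≤ 3 * max 1 (max ‖a‖ ‖b‖) := by
        have M1 : 1 ≤ max 1 (max ‖a‖ ‖b‖) := le_max_left _ _
        have Ma : ‖a‖ ≤ max 1 (max ‖a‖ ‖b‖) := (le_max_left _ _).trans (le_max_right _ _)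
        have Mb : ‖b‖ ≤ max 1 (max ‖a‖ ‖b‖) := (le_max_right _ _).trans (le_max_right _ _)
        rw [hW]
        refine Real.sqrt_le_iff.2 ⟨by positivity, ?_⟩
        nlinarith [norm_nonneg a, norm_nonneg b]
      have w2 : (max 1 (max ‖a‖ ‖b‖)) ^ r ≤ 1 + ‖a‖ ^ r + ‖b‖ ^ r := by
        have pa : 0 ≤ ‖a‖ ^ r := by positivity
        have pb : 0 ≤ ‖b‖ ^ r := by positivity
        rcases max_choice 1 (max ‖a‖ ‖b‖) with h | h
        · rw [h, Real.one_rpow]; linarith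
        · rcases max_choice ‖a‖ ‖b‖ with h' | h'
          · rw [h, h']; linarith
          · rw [h, h']; linarith
      have w3 : ∀ e : Space n, ‖e‖ ^ r ≤ r / c * potential g ‖e‖ := fun e => by
        have := hg.potential_lower hr hc.le (norm_nonneg e)
        calc ‖e‖ ^ r = r / c * (c / r * ‖e‖ ^ r) := by field_simp
          _ ≤ _ := by gcongr
      have w4 : 0 ≤ r / c := by positivity
      calc W ^ r ≤ (3 * max 1 (max ‖a‖ ‖b‖)) ^ r := by gcongr
        _ = 3 ^ r * (max 1 (max ‖a‖ ‖b‖)) ^ r := Real.mul_rpow (by norm_num) (by positivity)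
        _ ≤ 3 ^ r * (1 + r / c * potential g ‖a‖ + r / c * potential g ‖b‖) := by
          gcongr
          linarith [w3 a, w3 b]
        _ ≤ 3 ^ r * ((1 + r / c) * (1 + potential g ‖a‖ + potential g ‖b‖)) := by
          gcongr
          nlinarith
        _ = _ := by rw [hM]; ring
    have h6 : ‖a - b‖ ^ r ≤ ε / (2 * K₁ * M) * W ^ r + K₂ * (W ^ (r - 2) * ‖a - b‖ ^ 2) := by
      -- The scalar inequality is used at ‖a − b‖ / W and multiplied by W^r, which produces the
      -- weight W^(r−2) of the monotonicity assumption.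
      have := mul_le_mul_of_nonneg_right (h₂ (‖a - b‖ / W) (by positivity))
        (show 0 ≤ W ^ r by positivity)
      rw [Real.div_rpow (norm_nonneg _) hW0.le, Real.div_rpow (norm_nonneg _) hW0.le,
        div_mul_cancel₀ _ (by positivity)] at this
      refine this.trans_eq ?_
      rw [Real.rpow_sub hW0, Real.rpow_two, Real.rpow_two]
      field_simp
    calc ‖a - b‖ ^ s ≤ ε / 2 + K₁ * ‖a - b‖ ^ r := h3
      _ ≤ ε / 2 + K₁ * (ε / (2 * K₁ * M) * (M * (1 + potential g ‖a‖ + potential g ‖b‖))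
          + K₂ * (8 / κ * Δ)) := by
        gcongr
        refine h6.trans ?_
        gcongr
      _ = ε / 2 + ε / 2 * (1 + potential g ‖a‖ + potential g ‖b‖)
          + K₁ * (K₂ * (8 / κ)) * Δ := by
        field_simp
        ring
      _ ≤ _ := by
        gcongr
        nlinarith

/-! ### Carathéodory integrands -/

lemma add_rpow_le_mul_add_rpow {a b r : ℝ} (ha : 0 ≤ a) (hb : 0 ≤ b) (hr : 1 ≤ r) :
    (a + b) ^ r ≤ 2 ^ (r - 1) * (a ^ r + b ^ r) := by
  lift a to NNReal using ha
  lift b to NNReal using hb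
  exact_mod_cast NNReal.rpow_add_le_mul_rpow_add_rpow a b hr

section Caratheodory

variable {μ ν : Measure (Space n)} {τ : Space n → ℝ → ℝ}

/-- A Carathéodory function on `(0, ∞)` agrees almost everywhere with a jointly measurable one. -/
lemma exists_measurable_uncurry_of_caratheodory (hm : ∀ E > 0, AEMeasurable (fun x => τ x E) μ)
    (hc : ∀ᵐ x ∂μ, ContinuousOn (τ x) (Ioi 0)) :
    ∃ T : Space n → ℝ → ℝ, Measurable (Function.uncurry T) ∧ ∀ᵐ x ∂μ, ∀ E > 0, T x E = τ x E := by
  classical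
  -- The exponential parametrizes (0, ∞) by ℝ. Countably many values E = exp q determine the
  -- continuous function, so a single null set `N` can be discarded for all E at once.
  have hq : ∀ q : ℚ, AEMeasurable (fun x => τ x (Real.exp q)) μ := fun q =>
    hm _ (Real.exp_pos _)
  have hbad : ∀ᵐ x ∂μ, ContinuousOn (τ x) (Ioi 0) ∧
      ∀ q : ℚ, τ x (Real.exp q) = (hq q).mk _ x :=
    hc.and (ae_all_iff.2 fun q => (hq q).ae_eq_mk)
  obtain ⟨N, hbN, hNm, hN0⟩ := exists_measurable_superset_of_null (ae_iff.1 hbad)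
  have hgood : ∀ x ∉ N, ContinuousOn (τ x) (Ioi 0) ∧
      ∀ q : ℚ, τ x (Real.exp q) = (hq q).mk _ x := fun x hx => by
    by_contra h
    exact hx (hbN h)
  set T' : ℝ → Space n → ℝ := fun t x => if x ∈ N then 0 else τ x (Real.exp t) with hT'
  have hcont : ∀ x, Continuous fun t => T' t x := by
    intro x
    by_cases hx : x ∈ N
    · simp only [hT', hx, if_true]; exact continuous_const
    · simp only [hT', hx, if_false]
      exact (hgood x hx).1.comp_continuous Real.continuous_exp fun t => Real.exp_pos t
  have hmeasq : ∀ q : ℚ, Measurable (T' q) := by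
    intro q
    have : T' q = fun x => if x ∈ N then 0 else (hq q).mk _ x := by
      ext x
      by_cases hx : x ∈ N
      · simp [hT', hx]
      · simp [hT', hx, (hgood x hx).2 q]
    rw [this]
    exact Measurable.ite hNm measurable_const (hq q).measurable_mk
  have hmeas : ∀ t, Measurable (T' t) := by
    intro t
    obtain ⟨z, hz, hzt⟩ := mem_closure_iff_seq_limit.1 ((Rat.denseRange_cast (𝕜 := ℝ)) t)
    choose q hq' using hz
    refine measurable_of_tendsto_metrizable (f := fun k => T' (q k)) (fun k => hmeasq (q k)) ?_
    rw [tendsto_pi_nhds]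
    intro x
    have h : Tendsto (fun k => ((q k : ℚ) : ℝ)) atTop (𝓝 t) := by simpa only [hq'] using hzt
    exact ((hcont x).tendsto t).comp h
  refine ⟨fun x E => T' (Real.log E) x, ?_, ?_⟩
  · have h := measurable_uncurry_of_continuous_of_measurable hcont hmeas
    exact h.comp ((Real.measurable_log.comp measurable_snd).prodMk measurable_fst)
  · have : ∀ᵐ x ∂μ, x ∉ N := measure_eq_zero_iff_ae_notMem.1 hN0
    filter_upwards [this] with x hx E hE
    simp [hT', hx, Real.exp_log hE]

lemma aemeasurable_flux_of_caratheodory (hm : ∀ E > 0, AEMeasurable (fun x => τ x E) μ)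
    (hc : ∀ᵐ x ∂μ, ContinuousOn (τ x) (Ioi 0)) {G : Space n → Space n} (hG : AEMeasurable G μ) :
    AEMeasurable (fun x => τ x ‖G x‖ • G x) μ := by
  obtain ⟨T, hT, hTτ⟩ := exists_measurable_uncurry_of_caratheodory hm hc
  refine ⟨fun x => T x ‖hG.mk G x‖ • hG.mk G x, ?_, ?_⟩
  · exact (hT.comp (measurable_id.prodMk hG.measurable_mk.norm)).smul hG.measurable_mk
  · filter_upwards [hTτ, hG.ae_eq_mk] with x hx hGx
    rw [← hGx]
    rcases eq_or_ne (G x) 0 with h | h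
    · simp [h]
    · rw [hx _ (norm_pos_iff.2 h)]

lemma aemeasurable_potential_of_caratheodory (hm : ∀ E > 0, AEMeasurable (fun x => τ x E) μ)
    (hc : ∀ᵐ x ∂μ, ContinuousOn (τ x) (Ioi 0)) {G : Space n → Space n} (hG : AEMeasurable G μ) :
    AEMeasurable (fun x => potential (τ x) ‖G x‖) μ := by
  obtain ⟨T, hT, hTτ⟩ := exists_measurable_uncurry_of_caratheodory hm hc
  have hGm := hG.measurable_mk
  -- Rescaling ξ = ‖G x‖ t makes the interval of integration independent of x, so that the
  -- parametric integral is visibly measurable.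
  refine ⟨fun x => ‖hG.mk G x‖ * ∫ t in (0 : ℝ)..1,
    T x (‖hG.mk G x‖ * t) * (‖hG.mk G x‖ * t), ?_, ?_⟩
  · refine hGm.norm.mul ?_
    simp only [intervalIntegral.integral_of_le zero_le_one]
    have h1 : Measurable fun z : Space n × ℝ => ‖hG.mk G z.1‖ * z.2 :=
      (hGm.norm.comp measurable_fst).mul measurable_snd
    have h2 : Measurable fun z : Space n × ℝ => T z.1 (‖hG.mk G z.1‖ * z.2) *
        (‖hG.mk G z.1‖ * z.2) := (hT.comp (measurable_fst.prodMk h1)).mul h1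
    exact (h2.stronglyMeasurable.integral_prod_right' (ν := volume.restrict (Ioc 0 1))).measurable
  · filter_upwards [hTτ, hG.ae_eq_mk] with x hx hGx
    rw [← hGx, intervalIntegral.mul_integral_comp_mul_left (f := fun ξ => T x ξ * ξ), mul_zero, mul_one]
    refine intervalIntegral.integral_congr fun ξ hξ => ?_
    rw [uIcc_of_le (norm_nonneg _)] at hξ
    rcases hξ.1.eq_or_lt with rfl | h
    · simp
    · simp [hx ξ h]

/-- The properties of the energy density `potential (τ x)` on which the variational problem rests:
measurability, convexity, continuity, uniform convexity with exponent `s`, and the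
doubling condition. -/
structure IsEnergyIntegrand (μ : Measure (Space n)) (s : ℝ) (τ : Space n → ℝ → ℝ) : Prop where
  aemeasurable_flux : ∀ {G : Space n → Space n}, AEMeasurable G μ →
    AEMeasurable (fun x => τ x ‖G x‖ • G x) μ
  aemeasurable_potential : ∀ {G : Space n → Space n}, AEMeasurable G μ →
    AEMeasurable (fun x => potential (τ x) ‖G x‖) μ
  convex : ∀ᵐ x ∂μ, ∀ a b : Space n,
    ⟪τ x ‖a‖ • a, b - a⟫ ≤ potential (τ x) ‖b‖ - potential (τ x) ‖a‖
  continuous_flux : ∀ᵐ x ∂μ, Continuous fun a : Space n => τ x ‖a‖ • a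
  continuous_potential : ∀ᵐ x ∂μ, Continuous fun a : Space n => potential (τ x) ‖a‖
  nonneg : ∀ᵐ x ∂μ, ∀ a : Space n, 0 ≤ potential (τ x) ‖a‖
  uniformConvex : ∀ ε > 0, ∃ K > 0, ∀ᵐ x ∂μ, ∀ a b : Space n,
    ‖a - b‖ ^ s ≤ ε * (1 + potential (τ x) ‖a‖ + potential (τ x) ‖b‖)
      + K * (potential (τ x) ‖a‖ + potential (τ x) ‖b‖
        - 2 * potential (τ x) ‖(1 / 2 : ℝ) • (a + b)‖)
  flux_le : ∃ C, 0 ≤ C ∧ ∀ᵐ x ∂μ, ∀ a b : Space n,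
    |τ x ‖a‖ * ⟪a, b⟫| ≤ C * (1 + potential (τ x) ‖a‖ + potential (τ x) ‖b‖)
  doubling : ∀ T : ℝ, ∃ C, 0 ≤ C ∧ ∀ᵐ x ∂μ, ∀ (a b : Space n) (t : ℝ), |t| ≤ T →
    potential (τ x) ‖a + t • b‖ ≤ C * (1 + potential (τ x) ‖a‖ + potential (τ x) ‖b‖)

namespace IsEnergyIntegrand

lemma of_isConductivity (hn : 2 ≤ n) {r c C κ s : ℝ} (hr : 1 < r) (hc : 0 < c) (hκ : 0 < κ)
    (hC : 0 ≤ C) (hs : 0 < s) (hsr : s ≤ r) (hm : ∀ E > 0, AEMeasurable (fun x => τ x E) μ)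
    (h : ∀ᵐ x ∂μ, IsConductivity n r c C κ (τ x)) : IsEnergyIntegrand μ s τ where
  aemeasurable_flux := aemeasurable_flux_of_caratheodory hm (h.mono fun _ h => h.continuousOn)
  aemeasurable_potential :=
    aemeasurable_potential_of_caratheodory hm (h.mono fun _ h => h.continuousOn)
  convex := h.mono fun _ h => h.le_potential_norm_sub hn hr hc.le hκ.le
  continuous_flux := h.mono fun _ h => h.continuous_flux hr hc.le
  continuous_potential := h.mono fun _ h => h.continuous_potential hr hc.le
  nonneg := h.mono fun _ h _ => h.potential_nonneg hr hc.le (norm_nonneg _)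
  uniformConvex := fun ε hε => by
    obtain ⟨K, hK, hK'⟩ := exists_rpow_norm_sub_le hn (C := C) hr hc hκ hs hsr hε
    exact ⟨K, hK, h.mono fun x hx => hK' _ hx⟩
  flux_le := by
    refine ⟨2 * C * (1 + r / c), by positivity, h.mono fun x hx a b => ?_⟩
    have w3 : ∀ e : Space n, ‖e‖ ^ r ≤ r / c * potential (τ x) ‖e‖ := fun e => by
      have := hx.potential_lower hr hc.le (norm_nonneg e)
      calc ‖e‖ ^ r = r / c * (c / r * ‖e‖ ^ r) := by field_simp
        _ ≤ _ := by gcongr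
    have pa := hx.potential_nonneg hr hc.le (norm_nonneg a)
    have pb := hx.potential_nonneg hr hc.le (norm_nonneg b)
    have hrc : 0 ≤ r / c := by positivity
    refine (hx.abs_inner_flux_le hr hc.le hC a b).trans ?_
    rw [mul_assoc (2 * C)]
    refine mul_le_mul_of_nonneg_left ?_ (by positivity)
    nlinarith [w3 a, w3 b]
  doubling := fun T => by
    -- The growth bound estimates the potential of a + t b by powers of norms; the lower bound, with
    -- factor r/c, converts these back into potentials, so that no exponent survives in the
    -- statement.
    refine ⟨4 * C * (1 + 2 ^ (r - 1) * (1 + |T| ^ r) * (r / c)), by positivity,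
      h.mono fun x hx a b t ht => ?_⟩
    have w3 : ∀ e : Space n, ‖e‖ ^ r ≤ r / c * potential (τ x) ‖e‖ := fun e => by
      have := hx.potential_lower hr hc.le (norm_nonneg e)
      calc ‖e‖ ^ r = r / c * (c / r * ‖e‖ ^ r) := by field_simp
        _ ≤ _ := by gcongr
    have pa := hx.potential_nonneg hr hc.le (norm_nonneg a)
    have pb := hx.potential_nonneg hr hc.le (norm_nonneg b)
    have hrc : 0 ≤ r / c := by positivity
    refine (hx.potential_upper hn hr hc.le hκ.le hC _).trans ?_
    rw [mul_assoc (4 * C)]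
    refine mul_le_mul_of_nonneg_left ?_ (by positivity)
    have h1 : ‖a + t • b‖ ^ r ≤ 2 ^ (r - 1) * (‖a‖ ^ r + |T| ^ r * ‖b‖ ^ r) := by
      calc ‖a + t • b‖ ^ r ≤ (‖a‖ + |T| * ‖b‖) ^ r := by
            gcongr
            refine (norm_add_le _ _).trans ?_
            rw [norm_smul, Real.norm_eq_abs]
            exact add_le_add le_rfl
              (mul_le_mul_of_nonneg_right (ht.trans (le_abs_self T)) (norm_nonneg b))
        _ ≤ 2 ^ (r - 1) * (‖a‖ ^ r + (|T| * ‖b‖) ^ r) :=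
          add_rpow_le_mul_add_rpow (norm_nonneg a) (by positivity) hr.le
        _ = _ := by rw [Real.mul_rpow (abs_nonneg _) (norm_nonneg _)]
    set k := (2 : ℝ) ^ (r - 1)
    have hk : 0 ≤ k := by positivity
    set R := |T| ^ r
    have hR : 0 ≤ R := by positivity
    have h2 : ‖a‖ ^ r + R * ‖b‖ ^ r ≤ (1 + R) * (r / c) *
        (potential (τ x) ‖a‖ + potential (τ x) ‖b‖) := by
      have e1 := mul_le_mul_of_nonneg_left (w3 b) hR
      have e2 : 0 ≤ R * (r / c) * potential (τ x) ‖a‖ := by positivity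
      have e3 : 0 ≤ (r / c) * potential (τ x) ‖b‖ := by positivity
      nlinarith [w3 a]
    have h3 := mul_le_mul_of_nonneg_left h2 hk
    have e4 : 0 ≤ k * (1 + R) * (r / c) := by positivity
    nlinarith

/-- This is where materials of p-growth and q-growth are joined: all clauses are free of the growth
exponent, and the larger of two constants serves both measures. -/
lemma add {s : ℝ} (hμ : IsEnergyIntegrand μ s τ) (hν : IsEnergyIntegrand ν s τ) :
    IsEnergyIntegrand (μ + ν) s τ where
  aemeasurable_flux := fun hG => by
    rw [aemeasurable_add_measure_iff] at hG ⊢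
    exact ⟨hμ.aemeasurable_flux hG.1, hν.aemeasurable_flux hG.2⟩
  aemeasurable_potential := fun hG => by
    rw [aemeasurable_add_measure_iff] at hG ⊢
    exact ⟨hμ.aemeasurable_potential hG.1, hν.aemeasurable_potential hG.2⟩
  convex := ae_add_measure_iff.2 ⟨hμ.convex, hν.convex⟩
  continuous_flux := ae_add_measure_iff.2 ⟨hμ.continuous_flux, hν.continuous_flux⟩
  continuous_potential := ae_add_measure_iff.2 ⟨hμ.continuous_potential, hν.continuous_potential⟩
  nonneg := ae_add_measure_iff.2 ⟨hμ.nonneg, hν.nonneg⟩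
  uniformConvex := fun ε hε => by
    obtain ⟨K, hK, h⟩ := hμ.uniformConvex ε hε
    obtain ⟨K', hK', h'⟩ := hν.uniformConvex ε hε
    have key : ∀ {k : ℝ} {x : Space n}, k ≤ max K K' →
        (∀ a b : Space n, ⟪τ x ‖a‖ • a, b - a⟫ ≤ potential (τ x) ‖b‖ - potential (τ x) ‖a‖) →
        (∀ a b : Space n, ‖a - b‖ ^ s ≤ ε * (1 + potential (τ x) ‖a‖ + potential (τ x) ‖b‖)
          + k * (potential (τ x) ‖a‖ + potential (τ x) ‖b‖
          - 2 * potential (τ x) ‖(1 / 2 : ℝ) • (a + b)‖)) →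
        ∀ a b : Space n, ‖a - b‖ ^ s ≤ ε * (1 + potential (τ x) ‖a‖ + potential (τ x) ‖b‖)
          + max K K' * (potential (τ x) ‖a‖ + potential (τ x) ‖b‖
          - 2 * potential (τ x) ‖(1 / 2 : ℝ) • (a + b)‖) := by
      intro k x hk hcv hx a b
      refine (hx a b).trans ?_
      -- The tangent inequalities at the midpoint show that the midpoint gap is nonnegative, so its
      -- factor may be enlarged to the maximum.
      have h1 := hcv ((1 / 2 : ℝ) • (a + b)) a
      have h2 := hcv ((1 / 2 : ℝ) • (a + b)) b
      have e1 : a - (1 / 2 : ℝ) • (a + b) = (1 / 2 : ℝ) • (a - b) := by module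
      have e2 : b - (1 / 2 : ℝ) • (a + b) = -((1 / 2 : ℝ) • (a - b)) := by module
      rw [e1] at h1
      rw [e2, inner_neg_right] at h2
      gcongr
      linarith
    refine ⟨max K K', lt_max_of_lt_left hK, ae_add_measure_iff.2 ⟨?_, ?_⟩⟩
    · filter_upwards [h, hμ.convex] with x hx hcv using key (le_max_left _ _) hcv hx
    · filter_upwards [h', hν.convex] with x hx hcv using key (le_max_right _ _) hcv hx
  flux_le := by
    obtain ⟨C, hC, h⟩ := hμ.flux_le
    obtain ⟨C', hC', h'⟩ := hν.flux_le
    refine ⟨max C C', le_max_of_le_left hC, ae_add_measure_iff.2 ⟨?_, ?_⟩⟩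
    · filter_upwards [h, hμ.nonneg] with x hx h0 a b
      refine (hx a b).trans (mul_le_mul_of_nonneg_right (le_max_left _ _) ?_)
      linarith [h0 a, h0 b]
    · filter_upwards [h', hν.nonneg] with x hx h0 a b
      refine (hx a b).trans (mul_le_mul_of_nonneg_right (le_max_right _ _) ?_)
      linarith [h0 a, h0 b]
  doubling := fun T => by
    obtain ⟨C, hC, h⟩ := hμ.doubling T
    obtain ⟨C', hC', h'⟩ := hν.doubling T
    refine ⟨max C C', le_max_of_le_left hC, ae_add_measure_iff.2 ⟨?_, ?_⟩⟩
    · filter_upwards [h, hμ.nonneg] with x hx h0 a b t ht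
      refine (hx a b t ht).trans (mul_le_mul_of_nonneg_right (le_max_left _ _) ?_)
      linarith [h0 a, h0 b]
    · filter_upwards [h', hν.nonneg] with x hx h0 a b t ht
      refine (hx a b t ht).trans (mul_le_mul_of_nonneg_right (le_max_right _ _) ?_)
      linarith [h0 a, h0 b]

end IsEnergyIntegrand

end Caratheodory

/-- The growth and monotonicity assumptions give pointwise bounds with uniform constants. -/
lemma exists_isConductivity {p : ℝ} {U : Set (Space n)} {σ : Space n → ℝ → EReal}
    (h1 : IsCaratheodory U σ) (h2 : HasGrowth p U σ) (h3 : IsStronglyMonotone p U σ) :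
    ∃ c C κ : ℝ, 0 < c ∧ 0 ≤ C ∧ 0 < κ ∧
      ∀ᵐ x ∂(volume.restrict U), IsConductivity n p c C κ fun E => (σ x E).toReal := by
  obtain ⟨sl, su, E₀, hsl, hslu, hE₀, h2⟩ := h2
  obtain ⟨κ, hκ, h3⟩ := h3
  have hsu : 0 < su := hsl.trans_le hslu
  -- The factor k absorbs the reference field: (E/E₀)^(p−2) E = k E^(p−1). The constant 2 su (1 + k)
  -- below covers both upper bounds for p ≥ 2 and for p < 2.
  set k := E₀ ^ (2 - p) with hk
  have hk0 : 0 < k := by positivity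
  have hpow : ∀ E > 0, (E / E₀) ^ (p - 2) * E = k * E ^ (p - 1) := by
    intro E hE
    rw [Real.div_rpow hE.le hE₀.le, hk, ← neg_sub p 2, Real.rpow_neg hE₀.le,
      show p - 1 = (p - 2) + 1 by ring, Real.rpow_add_one hE.ne']
    field_simp
  refine ⟨sl * k, 2 * su * (1 + k), κ, by positivity, by positivity, hκ, ?_⟩
  filter_upwards [h1.2, h2, h3] with x hx1 hx2 hx3
  -- The growth bounds are real numbers, so σ is finite here and passing to `toReal` loses nothing.
  have hreal : ∀ E > 0, σ x E ≠ ⊤ ∧ σ x E ≠ ⊥ := by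
    intro E hE
    obtain ⟨l, u1, u2⟩ := hx2 E hE
    constructor
    · rcases le_or_gt 2 p with h | h
      · exact ((u1 h).trans_lt (EReal.coe_lt_top _)).ne
      · exact ((u2 h).trans_lt (EReal.coe_lt_top _)).ne
    · exact ((EReal.bot_lt_coe _).trans_le l).ne'
  have hcoe : ∀ E > 0, (((σ x E).toReal : ℝ) : EReal) = σ x E := fun E hE =>
    EReal.coe_toReal (hreal E hE).1 (hreal E hE).2
  refine ⟨?_, ?_, ?_, ?_, hx3⟩
  · refine EReal.continuousOn_toReal.comp hx1 fun E hE => ?_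
    have := hreal E hE
    simp only [mem_compl_iff, mem_insert_iff, mem_singleton_iff, not_or]
    exact ⟨this.2, this.1⟩
  · intro E hE
    have := (hx2 E hE).1
    rw [← hcoe E hE, EReal.coe_le_coe_iff] at this
    have h := mul_le_mul_of_nonneg_right this (le_of_lt hE)
    rw [mul_assoc, hpow E hE] at h
    linarith
  all_goals
    intro E hE
    have hE' : 0 < E := hE
    have hEp : 0 < E ^ (p - 1) := by positivity
    have hcase : (σ x E).toReal * E ≤ su * (E + k * E ^ (p - 1)) ∧
        (p < 2 → (σ x E).toReal * E ≤ su * (k * E ^ (p - 1))) := by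
      obtain ⟨-, u1, u2⟩ := hx2 E hE
      rw [← hcoe E hE, EReal.coe_le_coe_iff] at u1 u2
      have u2' : p < 2 → (σ x E).toReal * E ≤ su * (k * E ^ (p - 1)) := fun h => by
        have := mul_le_mul_of_nonneg_right (u2 h) hE'.le
        rwa [mul_assoc, hpow E hE] at this
      refine ⟨?_, u2'⟩
      rcases le_or_gt 2 p with h | h
      · have := mul_le_mul_of_nonneg_right (u1 h) hE'.le
        rwa [mul_assoc, add_mul, hpow E hE, one_mul] at this
      · refine (u2' h).trans ?_
        gcongr
        linarith
  · refine hcase.1.trans ?_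
    have e1 : 0 ≤ su * (E + 2 * k * E + (2 + k) * E ^ (p - 1)) := by positivity
    nlinarith
  · rcases le_or_gt 2 p with h | h
    · refine hcase.1.trans ?_
      have : E ≤ 1 + E ^ (p - 1) := by
        rcases le_or_gt E 1 with h' | h'
        · linarith
        · have := Real.rpow_le_rpow_of_exponent_le h'.le (show 1 ≤ p - 1 by linarith)
          rw [Real.rpow_one] at this
          linarith
      have e0 := mul_le_mul_of_nonneg_left this hsu.le
      have e1 : 0 ≤ su * (1 + 2 * k + (1 + k) * E ^ (p - 1)) := by positivity
      nlinarith
    · refine (hcase.2 h).trans ?_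
      have e1 : 0 ≤ su * (2 + 2 * k + (2 + k) * E ^ (p - 1)) := by positivity
      nlinarith

/-! ### The variational problem -/

namespace Medium

/-- The facts about a medium that the variational problem depends on, in a form common to the four
cases for the inner material. -/
structure IsRegular (m : Medium n) : Prop where
  one_le : 1 ≤ m.exponent
  isOpen : IsOpen m.potentialDomain
  finite : volume m.potentialDomain ≠ ⊤
  measurableSet : MeasurableSet m.energyDomain
  subset : m.energyDomain ⊆ m.potentialDomain
  poincare : PoincareOn m.exponent m.Ω m.potentialDomain m.potentialDomain
  conductor : ∀ u, (m.phase = .conductor → ∀ᵐ x ∂(volume.restrict m.A), m.grad u x = 0) ↔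
    ∀ᵐ x ∂(volume.restrict m.potentialDomain), x ∉ m.energyDomain → m.grad u x = 0
  integrand : IsEnergyIntegrand (volume.restrict m.energyDomain) m.exponent
    fun x E => (m.σ x E).toReal

variable {m : Medium n} {f g u v w : Space n → ℝ}

namespace IsRegular

lemma ae_energyDomain (hm : m.IsRegular) {P : Space n → Prop}
    (h : ∀ᵐ x ∂(volume.restrict m.potentialDomain), P x) :
    ∀ᵐ x ∂(volume.restrict m.energyDomain), P x :=
  ae_mono (Measure.restrict_mono hm.subset le_rfl) h

lemma isFiniteMeasure (hm : m.IsRegular) : IsFiniteMeasure (volume.restrict m.energyDomain) :=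
  ⟨by simpa using (measure_mono hm.subset).trans_lt hm.finite.lt_top⟩

lemma aemeasurable_grad (hm : m.IsRegular) (hu : MemSobolev m.exponent m.potentialDomain u) :
    AEMeasurable (m.grad u) (volume.restrict m.energyDomain) :=
  (hu.memLp_weakGrad hm.isOpen).1.aemeasurable.mono_measure
    (Measure.restrict_mono hm.subset le_rfl)

lemma grad_add (hm : m.IsRegular) (hu : MemSobolev m.exponent m.potentialDomain u)
    (hv : MemSobolev m.exponent m.potentialDomain v) :
    ∀ᵐ x ∂(volume.restrict m.potentialDomain), m.grad (u + v) x = m.grad u x + m.grad v x :=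
  hu.weakGrad_add hm.isOpen hv

lemma grad_sub (hm : m.IsRegular) (hu : MemSobolev m.exponent m.potentialDomain u)
    (hv : MemSobolev m.exponent m.potentialDomain v) :
    ∀ᵐ x ∂(volume.restrict m.potentialDomain), m.grad (u - v) x = m.grad u x - m.grad v x :=
  hu.weakGrad_sub hm.isOpen hv

lemma grad_smul (hm : m.IsRegular) (t : ℝ) (hu : MemSobolev m.exponent m.potentialDomain u) :
    ∀ᵐ x ∂(volume.restrict m.potentialDomain), m.grad (t • u) x = t • m.grad u x :=
  hu.weakGrad_smul hm.isOpen t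

lemma aestronglyMeasurable_energyDensity (hm : m.IsRegular)
    (hu : MemSobolev m.exponent m.potentialDomain u) :
    AEStronglyMeasurable (fun x => m.energyDensity x ‖m.grad u x‖)
      (volume.restrict m.energyDomain) :=
  (hm.integrand.aemeasurable_potential (hm.aemeasurable_grad hu)).aestronglyMeasurable

lemma energyDensity_nonneg (hm : m.IsRegular) (u : Space n → ℝ) :
    0 ≤ᵐ[volume.restrict m.energyDomain] fun x => m.energyDensity x ‖m.grad u x‖ :=
  hm.integrand.nonneg.mono fun _ h => h _

lemma energy_ne_top_iff (hm : m.IsRegular) (hu : MemSobolev m.exponent m.potentialDomain u) :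
    m.energy u ≠ ⊤ ↔ IntegrableOn (fun x => m.energyDensity x ‖m.grad u x‖) m.energyDomain :=
  lintegral_ofReal_ne_top_iff_integrable (hm.aestronglyMeasurable_energyDensity hu)
    (hm.energyDensity_nonneg u)

lemma energy_toReal (hm : m.IsRegular) (hu : MemSobolev m.exponent m.potentialDomain u) :
    (m.energy u).toReal = ∫ x in m.energyDomain, m.energyDensity x ‖m.grad u x‖ :=
  (integral_eq_lintegral_of_nonneg_ae (hm.energyDensity_nonneg u)
    (hm.aestronglyMeasurable_energyDensity hu)).symm

lemma integrable_of_extension (hm : m.IsRegular) (hu : m.IsExtension f u) :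
    IntegrableOn (fun x => m.energyDensity x ‖m.grad u x‖) m.energyDomain :=
  (hm.energy_ne_top_iff hu.1.1).1 hu.2

/-- The admissible potentials of finite energy form a linear space. -/
lemma isExtension_add_smul (hm : m.IsRegular) (hu : m.IsExtension f u) (hv : m.IsExtension g v)
    (t : ℝ) : m.IsExtension (f + t • g) (u + t • v) := by
  have := hm.isFiniteMeasure
  obtain ⟨⟨hu1, hu2, hu3⟩, hu4⟩ := hu
  obtain ⟨⟨hv1, hv2, hv3⟩, hv4⟩ := hv
  have htv := hv1.const_smul hm.isOpen t
  have hmem := hu1.add hm.isOpen htv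
  have hgrad : ∀ᵐ x ∂(volume.restrict m.potentialDomain),
      m.grad (u + t • v) x = m.grad u x + t • m.grad v x := by
    filter_upwards [hm.grad_add hu1 htv, hm.grad_smul t hv1] with x h1 h2
    rw [h1, h2]
  refine ⟨⟨hmem, ?_, ?_⟩, ?_⟩
  · have e : u + t • v - (f + t • g) = (u - f) + t • (v - g) := by
      rw [smul_sub]; abel
    rw [e]
    exact hu2.add hm.isOpen hm.one_le (hv2.const_smul hm.isOpen t)
  · rw [hm.conductor] at hu3 hv3 ⊢
    filter_upwards [hgrad, hu3, hv3] with x h1 h2 h3 hx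
    rw [h1, h2 hx, h3 hx, smul_zero, add_zero]
  · rw [hm.energy_ne_top_iff hmem]
    rw [hm.energy_ne_top_iff hu1] at hu4
    rw [hm.energy_ne_top_iff hv1] at hv4
    obtain ⟨C, -, hC⟩ := hm.integrand.doubling |t|
    refine Integrable.mono' ((((integrable_const (1 : ℝ)).add hu4).add hv4).const_mul C)
      (hm.aestronglyMeasurable_energyDensity hmem) ?_
    filter_upwards [hm.ae_energyDomain hgrad, hC, hm.integrand.nonneg] with x h1 h2 h3
    have h4 : 0 ≤ m.energyDensity x ‖m.grad (u + t • v) x‖ := h3 _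
    rw [Real.norm_of_nonneg h4, h1]
    exact h2 _ _ t le_rfl

lemma isExtension_sub (hm : m.IsRegular) (hu : m.IsExtension f u) (hv : m.IsExtension g v) :
    m.IsExtension (f - g) (u - v) := by
  have := hm.isExtension_add_smul hu hv (-1)
  simpa [sub_eq_add_neg] using this

lemma isExtension_smul (hm : m.IsRegular) (hu : m.IsExtension f u) (t : ℝ) :
    m.IsExtension (t • f) (t • u) := by
  have := hm.isExtension_add_smul hu hu (t - 1)
  simpa [sub_smul] using this

lemma isExtension_midpoint (hm : m.IsRegular) (hu : m.IsExtension f u) (hv : m.IsExtension f v) :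
    m.IsExtension f ((1 / 2 : ℝ) • (u + v)) := by
  have := hm.isExtension_smul (hm.isExtension_add_smul hu hv 1) (1 / 2)
  have e : (1 / 2 : ℝ) • (f + (1 : ℝ) • f) = f := by module
  rwa [e, one_smul] at this

lemma integrable_powerDensity (hm : m.IsRegular) (hu : m.IsExtension f u)
    (hv : m.IsExtension g v) : IntegrableOn (m.powerDensity u v) m.energyDomain := by
  have := hm.isFiniteMeasure
  obtain ⟨C, -, hC⟩ := hm.integrand.flux_le
  refine Integrable.mono' ((((integrable_const (1 : ℝ)).add (hm.integrable_of_extension hu)).add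
    (hm.integrable_of_extension hv)).const_mul C) ?_ (hC.mono fun x hx => hx _ _)
  have h1 := hm.integrand.aemeasurable_flux (hm.aemeasurable_grad hu.1.1)
  have h2 := h1.inner (𝕜 := ℝ) (hm.aemeasurable_grad hv.1.1)
  refine h2.aestronglyMeasurable.congr (Eventually.of_forall fun x => ?_)
  simp only [powerDensity, real_inner_smul_left]

lemma integral_powerDensity_add_smul (hm : m.IsRegular) (hu : m.IsExtension f u)
    {f' : Space n → ℝ} (hv : m.IsExtension g v) (hw : m.IsExtension f' w) (t : ℝ) :
    ∫ x in m.energyDomain, m.powerDensity u (v + t • w) x =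
      (∫ x in m.energyDomain, m.powerDensity u v x) +
        t * ∫ x in m.energyDomain, m.powerDensity u w x := by
  rw [← integral_const_mul, ← integral_add (hm.integrable_powerDensity hu hv)
    ((hm.integrable_powerDensity hu hw).const_mul t)]
  refine integral_congr_ae ?_
  filter_upwards [hm.ae_energyDomain (hm.grad_add hv.1.1 (hw.1.1.const_smul hm.isOpen t)),
    hm.ae_energyDomain (hm.grad_smul t hw.1.1)] with x h1 h2
  simp only [powerDensity, h1, h2, inner_add_right, real_inner_smul_right]
  ring

lemma integral_powerDensity_sub (hm : m.IsRegular) (hu : m.IsExtension f u)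
    {f' : Space n → ℝ} (hv : m.IsExtension g v) (hw : m.IsExtension f' w) :
    ∫ x in m.energyDomain, m.powerDensity u (v - w) x =
      (∫ x in m.energyDomain, m.powerDensity u v x) -
        ∫ x in m.energyDomain, m.powerDensity u w x := by
  have := hm.integral_powerDensity_add_smul hu hv hw (-1)
  simpa [sub_eq_add_neg] using this

/-- Convexity of the energy. -/
lemma integral_powerDensity_le (hm : m.IsRegular) (hu : m.IsExtension f u)
    (hv : m.IsExtension g v) :
    ∫ x in m.energyDomain, m.powerDensity u (v - u) x ≤
      (m.energy v).toReal - (m.energy u).toReal := by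
  rw [hm.energy_toReal hu.1.1, hm.energy_toReal hv.1.1,
    ← integral_sub (hm.integrable_of_extension hv) (hm.integrable_of_extension hu)]
  refine integral_mono_ae (hm.integrable_powerDensity hu (hm.isExtension_sub hv hu))
    ((hm.integrable_of_extension hv).sub (hm.integrable_of_extension hu)) ?_
  filter_upwards [hm.ae_energyDomain (hm.grad_sub hv.1.1 hu.1.1), hm.integrand.convex] with x h1 h2
  simp only [powerDensity, h1]
  rw [← real_inner_smul_left]
  exact h2 _ _

/-- Two potentials of almost minimal energy have close gradients. -/
lemma lintegral_grad_sub_le (hm : m.IsRegular) {I : ℝ}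
    (hI : ∀ w, m.IsExtension f w → I ≤ (m.energy w).toReal) {ε : ℝ} (hε : 0 < ε) :
    ∃ K > 0, ∀ u v, m.IsExtension f u → m.IsExtension f v →
      ∫⁻ x in m.potentialDomain, ‖m.grad u x - m.grad v x‖ₑ ^ m.exponent ≤
        ENNReal.ofReal (ε * (volume.real m.energyDomain + (m.energy u).toReal
          + (m.energy v).toReal) + K * ((m.energy u).toReal + (m.energy v).toReal - 2 * I)) := by
  have := hm.isFiniteMeasure
  have hs0 : 0 < m.exponent := zero_lt_one.trans_le hm.one_le
  obtain ⟨K, hK, hKuc⟩ := hm.integrand.uniformConvex ε hε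
  refine ⟨K, hK, fun u v hu hv => ?_⟩
  have hmid := hm.isExtension_midpoint hu hv
  -- Off the energy domain both gradients vanish: this is the conductor constraint, and it is void
  -- in the other cases.
  have hDU : ∫⁻ x in m.potentialDomain, ‖m.grad u x - m.grad v x‖ₑ ^ m.exponent =
      ∫⁻ x in m.energyDomain, ‖m.grad u x - m.grad v x‖ₑ ^ m.exponent := by
    calc _ = ∫⁻ x in m.potentialDomain, m.energyDomain.indicator
          (fun x => ‖m.grad u x - m.grad v x‖ₑ ^ m.exponent) x := by
          refine lintegral_congr_ae ?_
          filter_upwards [(hm.conductor u).1 hu.1.2.2, (hm.conductor v).1 hv.1.2.2] with x h1 h2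
          by_cases hx : x ∈ m.energyDomain
          · rw [indicator_of_mem hx]
          · rw [indicator_of_notMem hx, h1 hx, h2 hx]
            simp [hs0]
      _ = _ := by
        rw [setLIntegral_indicator hm.measurableSet, inter_eq_left.2 hm.subset]
  have iu := hm.integrable_of_extension hu
  have iv := hm.integrable_of_extension hv
  have im := hm.integrable_of_extension hmid
  have hmidgrad : ∀ᵐ x ∂(volume.restrict m.energyDomain), m.grad ((1 / 2 : ℝ) • (u + v)) x =
      (1 / 2 : ℝ) • (m.grad u x + m.grad v x) := by
    filter_upwards [hm.ae_energyDomain (hm.grad_smul (1 / 2) (hu.1.1.add hm.isOpen hv.1.1)),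
      hm.ae_energyDomain (hm.grad_add hu.1.1 hv.1.1)] with x h1 h2
    rw [h1, h2]
  set R : Space n → ℝ := fun x => ε * (1 + m.energyDensity x ‖m.grad u x‖
    + m.energyDensity x ‖m.grad v x‖) + K * (m.energyDensity x ‖m.grad u x‖
    + m.energyDensity x ‖m.grad v x‖
    - 2 * m.energyDensity x ‖m.grad ((1 / 2 : ℝ) • (u + v)) x‖) with hR
  have hRle : ∀ᵐ x ∂(volume.restrict m.energyDomain),
      ‖m.grad u x - m.grad v x‖ ^ m.exponent ≤ R x := by
    filter_upwards [hKuc, hmidgrad] with x h1 h2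
    have := h1 (m.grad u x) (m.grad v x)
    rw [← h2] at this
    exact this
  have i1 := (((integrable_const (μ := volume.restrict m.energyDomain) (1 : ℝ)).add iu).add
    iv).const_mul ε
  have i2 := ((iu.add iv).sub (im.const_mul 2)).const_mul K
  have hRint : IntegrableOn R m.energyDomain := i1.add i2
  have hRval : ∫ x in m.energyDomain, R x = ε * (volume.real m.energyDomain + (m.energy u).toReal
      + (m.energy v).toReal) + K * ((m.energy u).toReal + (m.energy v).toReal
      - 2 * (m.energy ((1 / 2 : ℝ) • (u + v))).toReal) := by
    rw [hm.energy_toReal hu.1.1, hm.energy_toReal hv.1.1, hm.energy_toReal hmid.1.1]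
    rw [show R = fun x => _ from rfl]
    rw [integral_add (by exact i1) (by exact i2), integral_const_mul, integral_const_mul,
      integral_add (by exact (integrable_const _).add iu) iv, integral_add (integrable_const _) iu,
      integral_sub (by exact iu.add iv) (by exact im.const_mul 2), integral_add iu iv,
      integral_const_mul]
    simp
  rw [hDU]
  calc ∫⁻ x in m.energyDomain, ‖m.grad u x - m.grad v x‖ₑ ^ m.exponent
      ≤ ∫⁻ x in m.energyDomain, ENNReal.ofReal (R x) := by
        refine lintegral_mono_ae (hRle.mono fun x hx => ?_)
        rw [← ofReal_norm, ENNReal.ofReal_rpow_of_nonneg (norm_nonneg _) hs0.le]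
        exact ENNReal.ofReal_le_ofReal hx
    _ = ENNReal.ofReal (∫ x in m.energyDomain, R x) :=
        (ofReal_integral_eq_lintegral_ofReal hRint
          (hRle.mono fun x hx => le_trans (by positivity) hx)).symm
    _ ≤ _ := by
        rw [hRval]
        refine ENNReal.ofReal_le_ofReal ?_
        gcongr
        -- The midpoint is a competitor with the same datum, so its energy is at least I.
        exact hI _ hmid

end IsRegular

end Medium

/-! ### Minimizers, the Euler–Lagrange equation and the Dirichlet-to-Neumann pairing -/

namespace Medium

variable {m : Medium n} {f g u v w : Space n → ℝ}

namespace IsRegular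

lemma eLpNorm_grad_eq (hm : m.IsRegular) (G : Space n → Space n) :
    eLpNorm G (ENNReal.ofReal m.exponent) (volume.restrict m.potentialDomain) =
      (∫⁻ x in m.potentialDomain, ‖G x‖ₑ ^ m.exponent) ^ (1 / m.exponent) := by
  have hs0 : 0 < m.exponent := zero_lt_one.trans_le hm.one_le
  rw [eLpNorm_eq_lintegral_rpow_enorm_toReal (by simpa using hs0) (by simp),
    ENNReal.toReal_ofReal hs0.le]

/-- A sequence of potentials whose energies tend to the infimum has a Cauchy sequence of
gradients. -/
lemma cauchy_of_tendsto_energy (hm : m.IsRegular) {I : ℝ}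
    (hI : ∀ w, m.IsExtension f w → I ≤ (m.energy w).toReal) {u : ℕ → Space n → ℝ}
    (hu : ∀ k, m.IsExtension f (u k))
    (hlim : Tendsto (fun k => (m.energy (u k)).toReal) atTop (𝓝 I)) :
    ∀ δ > 0, ∃ N, ∀ j ≥ N, ∀ k ≥ N, eLpNorm (fun x => m.grad (u j) x - m.grad (u k) x)
      (ENNReal.ofReal m.exponent) (volume.restrict m.potentialDomain) < δ := by
  intro δ hδ
  have hs0 : 0 < m.exponent := zero_lt_one.trans_le hm.one_le
  have hδ' : (0 : ℝ≥0∞) < δ ^ m.exponent := ENNReal.rpow_pos_of_nonneg hδ hs0.le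
  obtain ⟨η, hη0, hη⟩ : ∃ η : ℝ, 0 < η ∧ ENNReal.ofReal η < δ ^ m.exponent := by
    obtain ⟨η, hη0, h1, h2⟩ := ENNReal.lt_iff_exists_real_btwn.1 hδ'
    exact ⟨η, ENNReal.ofReal_pos.1 h1, h2⟩
  have hI0 : 0 ≤ I := ge_of_tendsto' hlim fun k => ENNReal.toReal_nonneg
  -- M bounds the volume plus two energies below I + 1. With ε = η/(2M), and energies within η/(4K)
  -- of I, each of the two terms of the estimate is at most η/2.
  set M := volume.real m.energyDomain + 2 * (I + 1) with hM
  have hM0 : 0 < M := by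
    have : 0 ≤ volume.real m.energyDomain := measureReal_nonneg
    linarith
  obtain ⟨K, hK, hKle⟩ := hm.lintegral_grad_sub_le hI (ε := η / (2 * M)) (by positivity)
  have hev : ∀ᶠ k in atTop, (m.energy (u k)).toReal < I + min 1 (η / (4 * K)) :=
    hlim.eventually (gt_mem_nhds (by
      have : 0 < min 1 (η / (4 * K)) := by positivity
      linarith))
  obtain ⟨N, hN⟩ := eventually_atTop.1 hev
  refine ⟨N, fun j hj k hk => ?_⟩
  have hj1 := hN j hj
  have hk1 := hN k hk
  have m1 := min_le_left 1 (η / (4 * K))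
  have m2 := min_le_right 1 (η / (4 * K))
  have key := hKle (u j) (u k) (hu j) (hu k)
  have hle : η / (2 * M) * (volume.real m.energyDomain + (m.energy (u j)).toReal
      + (m.energy (u k)).toReal) + K * ((m.energy (u j)).toReal + (m.energy (u k)).toReal - 2 * I)
      ≤ η := by
    have e1 : η / (2 * M) * (volume.real m.energyDomain + (m.energy (u j)).toReal
        + (m.energy (u k)).toReal) ≤ η / (2 * M) * M := by
      gcongr
      linarith
    have e2 : K * ((m.energy (u j)).toReal + (m.energy (u k)).toReal - 2 * I)
        ≤ K * (2 * (η / (4 * K))) := by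
      gcongr
      linarith
    have e3 : η / (2 * M) * M = η / 2 := by field_simp
    have e4 : K * (2 * (η / (4 * K))) = η / 2 := by field_simp; norm_num
    linarith
  rw [hm.eLpNorm_grad_eq, one_div, ENNReal.rpow_inv_lt_iff hs0]
  exact (key.trans (ENNReal.ofReal_le_ofReal hle)).trans_lt hη

/-- Existence of a minimizer. -/
theorem exists_isMinimizer (hm : m.IsRegular) (hex : ∃ u, m.IsExtension f u) :
    ∃ u, m.IsMinimizer f u := by
  set S : Set ℝ≥0∞ := m.energy '' {u | m.IsExtension f u} with hS
  obtain ⟨a, -, ha, haS⟩ := exists_seq_tendsto_sInf (S := S)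
    (by obtain ⟨u, hu⟩ := hex; exact ⟨_, u, hu, rfl⟩) (OrderBot.bddBelow S)
  choose u hu hua using haS
  have hu : ∀ k, m.IsExtension f (u k) := hu
  have hSle : ∀ v, m.IsExtension f v → sInf S ≤ m.energy v := fun v hv =>
    sInf_le ⟨v, hv, rfl⟩
  have hStop : sInf S ≠ ⊤ := ne_top_of_le_ne_top (hu 0).2 (hSle _ (hu 0))
  have hlim : Tendsto (fun k => (m.energy (u k)).toReal) atTop (𝓝 (sInf S).toReal) := by
    have := (ENNReal.tendsto_toReal hStop).comp ha
    refine this.congr fun k => ?_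
    simp only [Function.comp, hua]
  have hcau := hm.cauchy_of_tendsto_energy (I := (sInf S).toReal)
    (fun w hw => ENNReal.toReal_mono hw.2 (hSle w hw)) hu hlim
  have hd : ∀ k, ∀ᵐ x ∂(volume.restrict m.potentialDomain),
      weakGrad m.potentialDomain (u k - u 0) x = m.grad (u k) x - m.grad (u 0) x := fun k =>
    hm.grad_sub (hu k).1.1 (hu 0).1.1
  -- Subtracting u 0 removes the boundary datum, so the Poincaré inequality applies to the
  -- differences; the minimizer will be u 0 + v.
  have hvan : ∀ k, VanishesOnBoundary m.exponent m.Ω m.potentialDomain (u k - u 0) := fun k => by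
    have := (hu k).1.2.1.sub hm.isOpen hm.one_le (hu 0).1.2.1
    rwa [sub_sub_sub_cancel_right] at this
  obtain ⟨v, hv, hvt⟩ := hm.poincare.exists_tendsto_of_cauchy hm.isOpen hm.finite hm.one_le hvan
    (by
      intro ε hε
      obtain ⟨N, hN⟩ := hcau ε hε
      refine ⟨N, fun j hj k hk => lt_of_eq_of_lt (eLpNorm_congr_ae ?_) (hN j hj k hk)⟩
      filter_upwards [hd j, hd k] with x h1 h2
      rw [Pi.sub_apply, h1, h2, sub_sub_sub_cancel_right])
  have hmem : MemSobolev m.exponent m.potentialDomain (u 0 + v) := (hu 0).1.1.add hm.isOpen hv.1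
  have hconv : Tendsto (fun k => eLpNorm (m.grad (u k) - m.grad (u 0 + v))
      (ENNReal.ofReal m.exponent) (volume.restrict m.potentialDomain)) atTop (𝓝 0) := by
    refine hvt.congr fun k => eLpNorm_congr_ae ?_
    filter_upwards [hd k, hm.grad_add (hu 0).1.1 hv.1] with x h1 h2
    rw [Pi.sub_apply, Pi.sub_apply, h1, h2]
    simp only [grad]
    abel
  have hmeas : TendstoInMeasure (volume.restrict m.potentialDomain) (fun k => m.grad (u k)) atTop
      (m.grad (u 0 + v)) :=
    tendstoInMeasure_of_tendsto_eLpNorm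
      (by simpa using zero_lt_one.trans_le hm.one_le)
      (fun k => ((hu k).1.1.memLp_weakGrad hm.isOpen).1) (hmem.memLp_weakGrad hm.isOpen).1 hconv
  -- Almost everywhere convergence of the gradients along a subsequence serves twice: it preserves
  -- the conductor constraint, and it lets Fatou's lemma bound the energy of the limit.
  obtain ⟨ns, hns, hae⟩ := hmeas.exists_seq_tendsto_ae
  have hadm : m.IsAdmissible f (u 0 + v) := by
    refine ⟨hmem, ?_, ?_⟩
    · rw [add_sub_right_comm]
      exact (hu 0).1.2.1.add hm.isOpen hm.one_le hv
    · rw [hm.conductor]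
      have hall := ae_all_iff.2 fun k => (hm.conductor (u k)).1 (hu k).1.2.2
      filter_upwards [hae, hall] with x h1 h2 hx
      refine tendsto_nhds_unique h1 ?_
      simp only [h2 _ hx]
      exact tendsto_const_nhds
  have hfatou : m.energy (u 0 + v) ≤ sInf S := by
    calc m.energy (u 0 + v) = ∫⁻ x in m.energyDomain,
          liminf (fun k => ENNReal.ofReal (m.energyDensity x ‖m.grad (u (ns k)) x‖)) atTop := by
          refine lintegral_congr_ae ?_
          filter_upwards [hm.ae_energyDomain hae, hm.integrand.continuous_potential] with x h1 h2
          exact (((ENNReal.continuous_ofReal.comp h2).tendsto _).comp h1).liminf_eq.symm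
      _ ≤ liminf (fun k => m.energy (u (ns k))) atTop :=
          lintegral_liminf_le' fun k =>
            (hm.aestronglyMeasurable_energyDensity (hu (ns k)).1.1).aemeasurable.ennreal_ofReal
      _ = sInf S := by
          refine Tendsto.liminf_eq ?_
          refine (ha.comp hns.tendsto_atTop).congr fun k => ?_
          simp only [Function.comp, hua]
  refine ⟨u 0 + v, hadm, fun w hw => ?_⟩
  by_cases hwt : m.energy w = ⊤
  · rw [hwt]; exact le_top
  · exact hfatou.trans (hSle w ⟨hw, hwt⟩)

lemma isExtension_of_isMinimizer (hex : ∃ u, m.IsExtension f u) (hu : m.IsMinimizer f u) :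
    m.IsExtension f u := by
  obtain ⟨v, hv⟩ := hex
  exact ⟨hu.1, ne_top_of_le_ne_top hv.2 (hu.2 v hv.1)⟩

/-- Uniqueness of the minimizer. -/
theorem isMinimizer_unique (hm : m.IsRegular) (hex : ∃ u, m.IsExtension f u)
    (hu : m.IsMinimizer f u) (hv : m.IsMinimizer f v) :
    u =ᵐ[volume.restrict m.potentialDomain] v := by
  have hs0 : 0 < m.exponent := zero_lt_one.trans_le hm.one_le
  have hu' := isExtension_of_isMinimizer hex hu
  have hv' := isExtension_of_isMinimizer hex hv
  have heq : (m.energy u).toReal = (m.energy v).toReal := by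
    rw [le_antisymm (hu.2 v hv.1) (hv.2 u hu.1)]
  have hI : ∀ w, m.IsExtension f w → (m.energy v).toReal ≤ (m.energy w).toReal := fun w hw =>
    ENNReal.toReal_mono hw.2 (hv.2 w hw.1)
  -- The alternating sequence u, v, u, v, … is minimizing, hence Cauchy in the gradient, which
  -- forces ∇u = ∇v; the Poincaré inequality then gives u = v.
  have hcau := hm.cauchy_of_tendsto_energy hI (u := fun k => if Even k then u else v)
    (fun k => by split_ifs <;> assumption)
    (by
      refine tendsto_const_nhds.congr fun k => ?_
      split_ifs
      · exact heq.symm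
      · rfl)
  have hzero : eLpNorm (fun x => m.grad u x - m.grad v x)
      (ENNReal.ofReal m.exponent) (volume.restrict m.potentialDomain) = 0 := by
    refine le_antisymm (le_of_forall_gt fun δ hδ => ?_) zero_le
    obtain ⟨N, hN⟩ := hcau δ hδ
    have := hN (2 * N) (by omega) (2 * N + 1) (by omega)
    simpa using this
  obtain ⟨C, -, hP⟩ := hm.poincare.exists_eLpNorm_le hm.isOpen hm.one_le
  have hvan : VanishesOnBoundary m.exponent m.Ω m.potentialDomain (u - v) := by
    have := hu.1.2.1.sub hm.isOpen hm.one_le hv.1.2.1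
    rwa [sub_sub_sub_cancel_right] at this
  have h1 := hP _ hvan
  have h2 : eLpNorm (weakGrad m.potentialDomain (u - v)) (ENNReal.ofReal m.exponent)
      (volume.restrict m.potentialDomain) = 0 :=
    (eLpNorm_congr_ae (hm.grad_sub hu.1.1 hv.1.1)).trans hzero
  rw [h2, mul_zero, nonpos_iff_eq_zero,
    eLpNorm_eq_zero_iff hvan.1.1.1 (by simpa using hs0)] at h1
  filter_upwards [h1] with x hx
  exact sub_eq_zero.1 hx

/-- The Euler–Lagrange equation in integrated form, as an inequality. -/
lemma integral_powerDensity_nonneg (hm : m.IsRegular) (hex : ∃ u, m.IsExtension f u)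
    (hu : m.IsMinimizer f u) (hw : m.IsExtension 0 w) :
    0 ≤ ∫ x in m.energyDomain, m.powerDensity u w x := by
  have := hm.isFiniteMeasure
  have hu' := isExtension_of_isMinimizer hex hu
  have hut : ∀ t : ℝ, m.IsExtension f (u + t • w) := fun t => by
    have := hm.isExtension_add_smul hu' hw t
    rwa [smul_zero, add_zero] at this
  have hgrad : ∀ t : ℝ, ∀ᵐ x ∂(volume.restrict m.energyDomain),
      m.grad (u + t • w) x = m.grad u x + t • m.grad w x := fun t => by
    filter_upwards [hm.ae_energyDomain (hm.grad_add hu.1.1 (hw.1.1.const_smul hm.isOpen t)),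
      hm.ae_energyDomain (hm.grad_smul t hw.1.1)] with x h1 h2
    rw [h1, h2]
  -- The tangent inequality is taken at u + t w and evaluated at the minimizer u, so only minimality
  -- enters and the energy need not be differentiated. Letting t → 0 by dominated convergence gives
  -- the claim.
  have hpos : ∀ t : ℝ, 0 < t → 0 ≤ ∫ x in m.energyDomain, m.powerDensity (u + t • w) w x := by
    intro t ht
    have h1 := hm.integral_powerDensity_le (hut t) hu'
    have h2 := ENNReal.toReal_mono (hut t).2 (hu.2 _ (hut t).1)
    have h3 := hm.integral_powerDensity_sub (hut t) hu' (hut t)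
    have h4 := hm.integral_powerDensity_add_smul (hut t) hu' hw t
    have h5 : 0 ≤ t * ∫ x in m.energyDomain, m.powerDensity (u + t • w) w x := by linarith
    exact nonneg_of_mul_nonneg_right h5 ht
  set t : ℕ → ℝ := fun k => 1 / ((k : ℝ) + 1) with ht
  have ht0 : ∀ k, 0 < t k := fun k => by positivity
  have ht1 : ∀ k, |t k| ≤ 1 := fun k => by
    rw [abs_of_pos (ht0 k)]
    exact (div_le_one (by positivity)).2 (by
      have : (0 : ℝ) ≤ k := by positivity
      linarith)
  have htlim : Tendsto t atTop (𝓝 0) := tendsto_one_div_add_atTop_nhds_zero_nat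
  obtain ⟨C, hC0, hC⟩ := hm.integrand.flux_le
  obtain ⟨C', hC0', hC'⟩ := hm.integrand.doubling 1
  have iu := hm.integrable_of_extension hu'
  have iw := hm.integrable_of_extension hw
  refine ge_of_tendsto' (x := atTop) (f := fun k : ℕ =>
    ∫ x in m.energyDomain, m.powerDensity (u + t k • w) w x) ?_ (fun k => hpos (t k) (ht0 k))
  refine tendsto_integral_of_dominated_convergence
    (fun x => C * (1 + C' * (1 + m.energyDensity x ‖m.grad u x‖ + m.energyDensity x ‖m.grad w x‖)
      + m.energyDensity x ‖m.grad w x‖))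
    (fun k => (hm.integrable_powerDensity (hut (t k)) hw).1) ?_ ?_ ?_
  · exact (((integrable_const (1 : ℝ)).add ((((integrable_const (1 : ℝ)).add iu).add iw).const_mul
      C')).add iw).const_mul C
  · intro k
    filter_upwards [hgrad (t k), hC, hC'] with x h1 h2 h3
    rw [Real.norm_eq_abs]
    refine (h2 _ _).trans ?_
    refine mul_le_mul_of_nonneg_left (add_le_add (add_le_add le_rfl ?_) le_rfl) hC0
    rw [h1]
    exact h3 _ _ _ (ht1 k)
  · filter_upwards [ae_all_iff.2 fun k => hgrad (t k), hm.integrand.continuous_flux] with x h1 h2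
    have e : ∀ a b, m.powerDensity a b x =
        ⟪(m.σ x ‖m.grad a x‖).toReal • m.grad a x, m.grad b x⟫ := fun a b => by
      simp only [powerDensity, real_inner_smul_left]
    simp only [e, h1]
    have h3 : Tendsto (fun k => m.grad u x + t k • m.grad w x) atTop (𝓝 (m.grad u x)) := by
      have := (htlim.smul_const (m.grad w x)).const_add (m.grad u x)
      simpa using this
    exact ((h2.tendsto _).comp h3).inner tendsto_const_nhds

/-- The Euler–Lagrange equation in integrated form. -/
lemma integral_powerDensity_eq_zero (hm : m.IsRegular) (hex : ∃ u, m.IsExtension f u)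
    (hu : m.IsMinimizer f u) (hw : m.IsExtension 0 w) :
    ∫ x in m.energyDomain, m.powerDensity u w x = 0 := by
  have hu' := isExtension_of_isMinimizer hex hu
  have h1 := hm.integral_powerDensity_nonneg hex hu hw
  have h0 : m.IsExtension 0 (w - w) := by simpa using hm.isExtension_sub hw hw
  -- Testing with −w, written as w − w + (−1) • w so that the linearity lemmas apply, gives the
  -- reverse inequality.
  have h2 := hm.integral_powerDensity_nonneg hex hu
    (by simpa using hm.isExtension_add_smul h0 hw (-1) : m.IsExtension 0 (w - w + (-1 : ℝ) • w))
  rw [hm.integral_powerDensity_add_smul hu' h0 hw, hm.integral_powerDensity_sub hu' hw hw] at h2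
  linarith

lemma isMinimizer_solution (hm : m.IsRegular) (hex : ∃ u, m.IsExtension f u) :
    m.IsMinimizer f (m.solution f) :=
  Classical.epsilon_spec (p := m.IsMinimizer f) (hm.exists_isMinimizer hex)

lemma isExtension_solution (hm : m.IsRegular) (hex : ∃ u, m.IsExtension f u) :
    m.IsExtension f (m.solution f) :=
  isExtension_of_isMinimizer hex (hm.isMinimizer_solution hex)

/-- The Dirichlet-to-Neumann pairing does not depend on the extension. -/
lemma integral_powerDensity_eq_dtn (hm : m.IsRegular) (hex : ∃ u, m.IsExtension f u)
    (hv : m.IsExtension g v) :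
    ∫ x in m.energyDomain, m.powerDensity (m.solution f) v x = m.dtn f g := by
  have hv' : m.IsExtension g (Classical.epsilon (m.IsExtension g)) :=
    Classical.epsilon_spec (p := m.IsExtension g) ⟨v, hv⟩
  have hu := hm.isExtension_solution hex
  have h0 := hm.isExtension_sub hv hv'
  rw [sub_self] at h0
  have := hm.integral_powerDensity_eq_zero hex (hm.isMinimizer_solution hex) h0
  rw [hm.integral_powerDensity_sub hu hv hv'] at this
  rw [dtn]
  linarith

/-- `⟨Λ(αf), f⟩` is a subgradient at `α` of the energy of the solution with datum `αf`. -/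
lemma mul_dtn_le (hm : m.IsRegular) (hex : ∃ u, m.IsExtension f u) (α β : ℝ) :
    (β - α) * m.dtn (α • f) f ≤
      (m.energy (m.solution (β • f))).toReal - (m.energy (m.solution (α • f))).toReal := by
  obtain ⟨Φ, hΦ⟩ := hex
  have hexα : ∀ α : ℝ, ∃ u, m.IsExtension (α • f) u := fun α => ⟨_, hm.isExtension_smul hΦ α⟩
  have ha := hm.isExtension_solution (hexα α)
  have hb := hm.isExtension_solution (hexα β)
  have h1 := hm.integral_powerDensity_le ha hb
  have hd : m.IsExtension ((β - α) • f) (m.solution (β • f) - m.solution (α • f)) := by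
    rw [sub_smul]
    exact hm.isExtension_sub hb ha
  have h2 := hm.integral_powerDensity_eq_dtn (hexα α) hd
  have h3 := hm.integral_powerDensity_eq_dtn (hexα α) (hm.isExtension_smul hΦ (β - α))
  have h4 := hm.integral_powerDensity_eq_dtn (hexα α) hΦ
  -- Homogeneity in the second argument: the extension (β − α)Φ of (β − α)f is written as Φ plus a
  -- multiple of Φ.
  have h5 := hm.integral_powerDensity_add_smul ha hΦ hΦ (β - α - 1)
  have e : Φ + (β - α - 1) • Φ = (β - α) • Φ := by module
  rw [e, h3, h4] at h5
  linarith

/-- The potential 0 • Φ is a competitor with vanishing gradient. -/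
lemma energy_solution_zero (hm : m.IsRegular) (hex : ∃ u, m.IsExtension f u) :
    m.energy (m.solution ((0 : ℝ) • f)) = 0 := by
  obtain ⟨Φ, hΦ⟩ := hex
  have h0 := hm.isExtension_smul hΦ 0
  refine le_antisymm (((hm.isMinimizer_solution ⟨_, h0⟩).2 _ h0.1).trans (le_of_eq ?_)) zero_le
  rw [energy, lintegral_congr_ae (g := fun _ => 0), lintegral_zero]
  filter_upwards [hm.ae_energyDomain (hm.grad_smul 0 hΦ.1.1)] with x hx
  rw [hx]
  simp [energyDensity]

end IsRegular

end Medium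

/-- A function with a subgradient everywhere is the integral of the subgradient. -/
lemma monotone_and_integral_of_subgradient {g h : ℝ → ℝ}
    (hsub : ∀ α β, (β - α) * h α ≤ g β - g α) :
    Monotone h ∧ ∀ a b, ∫ α in a..b, h α = g b - g a := by
  have hmono : Monotone h := by
    intro a b hab
    rcases hab.eq_or_lt with rfl | hlt
    · exact le_rfl
    have h1 := hsub a b
    have h2 := hsub b a
    have : 0 ≤ (h b - h a) * (b - a) := by linarith
    linarith [nonneg_of_mul_nonneg_left this (sub_pos.2 hlt)]
  have hderiv : ∀ a, ContinuousAt h a → HasDerivAt g (h a) a := by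
    intro a ha
    rw [hasDerivAt_iff_tendsto_slope]
    -- The two subgradient inequalities squeeze the difference quotient between h(a) and h(b).
    have hsq : ∀ b ≠ a, |slope g a b - h a| ≤ |h b - h a| := by
      intro b hb
      have h1 := hsub a b
      have h2 := hsub b a
      rw [slope_def_field]
      rcases lt_or_gt_of_ne hb with hlt | hlt
      · have hpos : 0 < a - b := sub_pos.2 hlt
        have e : (g b - g a) / (b - a) = (g a - g b) / (a - b) := by
          rw [← neg_sub (g a), ← neg_sub a b, neg_div_neg_eq]
        have l1 : h b ≤ (g a - g b) / (a - b) := (le_div_iff₀ hpos).2 (by linarith)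
        have l2 : (g a - g b) / (a - b) ≤ h a := (div_le_iff₀ hpos).2 (by linarith)
        rw [e, abs_of_nonpos (by linarith), abs_of_nonpos (by linarith)]
        linarith
      · have hpos : 0 < b - a := sub_pos.2 hlt
        have l1 : h a ≤ (g b - g a) / (b - a) := (le_div_iff₀ hpos).2 (by linarith)
        have l2 : (g b - g a) / (b - a) ≤ h b := (div_le_iff₀ hpos).2 (by linarith)
        rw [abs_of_nonneg (by linarith), abs_of_nonneg (by linarith)]
        linarith
    have hlim : Tendsto (fun b => |h b - h a|) (𝓝[≠] a) (𝓝 0) := by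
      have := ((ha.tendsto.sub_const (h a)).abs).mono_left (nhdsWithin_le_nhds (s := {a}ᶜ))
      simpa using this
    refine tendsto_iff_norm_sub_tendsto_zero.2 (squeeze_zero' (Eventually.of_forall fun b =>
      norm_nonneg _) ?_ hlim)
    filter_upwards [self_mem_nhdsWithin] with b hb using hsq b hb
  have hcont : Continuous g := by
    rw [continuous_iff_continuousAt]
    intro a
    have hev : ∀ᶠ b in 𝓝 a, |g b - g a| ≤ |b - a| * (|h (a - 1)| + |h (a + 1)|) := by
      filter_upwards [Ioo_mem_nhds (sub_one_lt a) (lt_add_one a)] with b hb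
      have h1 := hsub a b
      have h2 := hsub b a
      have bd : ∀ c ∈ Icc (a - 1) (a + 1), |h c| ≤ |h (a - 1)| + |h (a + 1)| := by
        intro c hc
        have l1 := hmono hc.1
        have l2 := hmono hc.2
        rw [abs_le]
        constructor
        · linarith [neg_abs_le (h (a - 1)), abs_nonneg (h (a + 1))]
        · linarith [le_abs_self (h (a + 1)), abs_nonneg (h (a - 1))]
      have p1 : |(b - a) * h a| ≤ |b - a| * (|h (a - 1)| + |h (a + 1)|) := by
        rw [abs_mul]
        gcongr
        exact bd a ⟨by linarith, by linarith⟩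
      have p2 : |(a - b) * h b| ≤ |b - a| * (|h (a - 1)| + |h (a + 1)|) := by
        rw [abs_mul, abs_sub_comm a b]
        gcongr
        exact bd b ⟨hb.1.le, hb.2.le⟩
      rw [abs_le] at p1 p2 ⊢
      constructor <;> linarith
    have hlim : Tendsto (fun b => |b - a| * (|h (a - 1)| + |h (a + 1)|)) (𝓝 a) (𝓝 0) := by
      have : Continuous fun b => |b - a| * (|h (a - 1)| + |h (a + 1)|) := by fun_prop
      simpa using this.tendsto a
    exact tendsto_iff_norm_sub_tendsto_zero.2
      (squeeze_zero' (Eventually.of_forall fun b => norm_nonneg _) hev hlim)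
  refine ⟨hmono, fun a b => ?_⟩
  -- A monotone function has at most countably many discontinuities, and the fundamental theorem of
  -- calculus tolerates a countable exceptional set for a continuous primitive.
  exact integral_eq_of_hasDerivAt_off_countable g h hmono.countable_not_continuousAt
    hcont.continuousOn (fun x hx => hderiv x (not_not.1 hx.2)) hmono.intervalIntegrable

/-! ### The four media -/

/-- The cutoff equals 1 near K rather than only on K, so its gradient vanishes on K as well. -/
lemma exists_cutoff {K Ω : Set (Space n)} (hK : IsCompact K) (hΩ : IsOpen Ω) (hKΩ : K ⊆ Ω) :
    ∃ η : Space n → ℝ, ContDiff ℝ ∞ η ∧ HasCompactSupport η ∧ tsupport η ⊆ Ω ∧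
      ∀ x ∈ K, η =ᶠ[𝓝 x] fun _ => 1 := by
  obtain ⟨L, hL, hKL, hLΩ⟩ := exists_compact_between hK hΩ hKΩ
  obtain ⟨η, h1, h0, -⟩ := exists_contMDiffMap_one_nhds_of_subset_interior
    (n := (⊤ : ℕ∞)) (modelWithCornersSelf ℝ (Space n)) hK.isClosed hKL
  have hsupp : tsupport η ⊆ L := closure_minimal (fun x hx => by
    by_contra h
    exact hx (h0 x h)) hL.isClosed
  exact ⟨η, η.contMDiff.contDiff, hL.of_isClosed_subset (isClosed_tsupport _) hsupp,
    hsupp.trans hLΩ, fun x hx => h1.filter_mono (nhds_le_nhdsSet hx)⟩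

section Cutoff

variable {p : ℝ} {U : Set (Space n)} {u : Space n → ℝ} {η : Space n → ℝ}

lemma exists_bound_of_cutoff (hη : ContDiff ℝ ∞ η) (hc : HasCompactSupport η) :
    ∃ C : ℝ, 0 ≤ C ∧ (∀ x, ‖η x‖ ≤ C) ∧ ∀ x, ‖gradient η x‖ ≤ C := by
  have hη1 : ContDiff ℝ 1 η := hη.of_le (by simp)
  obtain ⟨C₁, h₁⟩ := hc.exists_bound_of_continuous hη.continuous
  obtain ⟨C₂, h₂⟩ := HasCompactSupport.exists_bound_of_continuous (f := gradient η)
    ((hc.fderiv ℝ).comp_left (map_zero _)) (continuous_gradient hη1)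
  exact ⟨max C₁ C₂, (norm_nonneg _).trans ((h₁ 0).trans (le_max_left _ _)),
    fun x => (h₁ x).trans (le_max_left _ _), fun x => (h₂ x).trans (le_max_right _ _)⟩

lemma MemSobolev.smooth_mul (hη : ContDiff ℝ ∞ η) (hc : HasCompactSupport η) (hU : IsOpen U)
    (hu : MemSobolev p U u) : MemSobolev p U (fun x => η x * u x) := by
  obtain ⟨C, -, h1, h2⟩ := exists_bound_of_cutoff hη hc
  have hη1 : ContDiff ℝ 1 η := hη.of_le (by simp)
  have hG := hu.memLp_weakGrad hU
  refine (hu.hasWeakGrad.smooth_mul hη hU).memSobolev ?_ (MemLp.add ?_ ?_)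
  · refine hu.1.of_le_mul (c := C) (hη.continuous.aestronglyMeasurable.mul hu.1.1)
      (Eventually.of_forall fun x => ?_)
    rw [norm_mul]
    gcongr
    exact h1 x
  · refine hG.of_le_mul (c := C) (hη.continuous.aestronglyMeasurable.smul hG.1)
      (Eventually.of_forall fun x => ?_)
    rw [norm_smul]
    gcongr
    exact h1 x
  · refine hu.1.of_le_mul (c := C)
      (hu.1.1.smul (continuous_gradient hη1).aestronglyMeasurable)
      (Eventually.of_forall fun x => ?_)
    rw [norm_smul, mul_comm]
    gcongr
    exact h2 x

lemma HasWeakGrad.sobolevNorm_smooth_mul_le {C : ℝ} {G : Space n → Space n} (hp : 1 ≤ p)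
    (hη : ContDiff ℝ ∞ η) (h1 : ∀ x, ‖η x‖ ≤ C) (h2 : ∀ x, ‖gradient η x‖ ≤ C) (hU : IsOpen U)
    (hu : HasWeakGrad U u G) :
    sobolevNorm p U (fun x => η x * u x) ≤ 2 * ENNReal.ofReal C * sobolevNorm p U u := by
  have hη1 : ContDiff ℝ 1 η := hη.of_le (by simp)
  rw [(hu.smooth_mul hη hU).sobolevNorm_eq hU, hu.sobolevNorm_eq hU]
  have e1 : eLpNorm (fun x => η x * u x) (ENNReal.ofReal p) (volume.restrict U) ≤
      ENNReal.ofReal C * eLpNorm u (ENNReal.ofReal p) (volume.restrict U) :=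
    eLpNorm_le_mul_eLpNorm_of_ae_le_mul (Eventually.of_forall fun x => by
      rw [norm_mul]; gcongr; exact h1 x) _
  have e2 : eLpNorm (fun x => η x • G x) (ENNReal.ofReal p) (volume.restrict U) ≤
      ENNReal.ofReal C * eLpNorm G (ENNReal.ofReal p) (volume.restrict U) :=
    eLpNorm_le_mul_eLpNorm_of_ae_le_mul (Eventually.of_forall fun x => by
      rw [norm_smul]; gcongr; exact h1 x) _
  have e3 : eLpNorm (fun x => u x • gradient η x) (ENNReal.ofReal p) (volume.restrict U) ≤
      ENNReal.ofReal C * eLpNorm u (ENNReal.ofReal p) (volume.restrict U) :=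
    eLpNorm_le_mul_eLpNorm_of_ae_le_mul (Eventually.of_forall fun x => by
      rw [norm_smul, mul_comm]; gcongr; exact h2 x) _
  have e4 := eLpNorm_add_le (f := fun x => η x • G x) (g := fun x => u x • gradient η x)
    (hη.continuous.aestronglyMeasurable.smul hu.aestronglyMeasurable.2)
    (hu.aestronglyMeasurable.1.smul (continuous_gradient hη1).aestronglyMeasurable)
    (one_le_ofReal hp)
  refine (add_le_add e1 (e4.trans (add_le_add e2 e3))).trans ?_
  set a := eLpNorm u (ENNReal.ofReal p) (volume.restrict U)
  set b := eLpNorm G (ENNReal.ofReal p) (volume.restrict U)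
  calc ENNReal.ofReal C * a + (ENNReal.ofReal C * b + ENNReal.ofReal C * a)
      ≤ ENNReal.ofReal C * a + (ENNReal.ofReal C * b + ENNReal.ofReal C * a)
        + ENNReal.ofReal C * b := le_self_add
    _ = _ := by ring

end Cutoff

/-- Forgetting the inclusion turns the Poincaré inequality on the perforated domain into the one on
Ω. -/
lemma IsTwoPhaseDomain.empty {Ω A : Set (Space n)} (h : IsTwoPhaseDomain Ω A) :
    IsTwoPhaseDomain Ω (∅ : Set (Space n)) where
  isOpen_Ω := h.isOpen_Ω
  isBounded_Ω := h.isBounded_Ω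
  isConnected_Ω := h.isConnected_Ω
  lipschitz_Ω := h.lipschitz_Ω
  isOpen_A := isOpen_empty
  closure_A_subset := by simp
  lipschitz_A := fun x hx => by simp at hx
  finite_components_A := by simp
  isConnected_B := by simpa using h.isConnected_Ω

namespace IsTwoPhaseDomain

variable {Ω A : Set (Space n)}

lemma isCompact_closure_A (h : IsTwoPhaseDomain Ω A) : IsCompact (closure A) :=
  (h.isBounded_Ω.subset (subset_closure.trans h.closure_A_subset)).isCompact_closure

lemma volume_ne_top (h : IsTwoPhaseDomain Ω A) : volume Ω ≠ ⊤ := h.isBounded_Ω.measure_lt_top.ne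

lemma ae_mem_of_mem_closure (h : IsTwoPhaseDomain Ω A) :
    ∀ᵐ x : Space n, x ∈ closure A → x ∈ A := by
  have h0 := h.lipschitz_A.volume_frontier h.isOpen_A
  filter_upwards [measure_eq_zero_iff_ae_notMem.1 h0] with x hx hxA
  by_contra hn
  exact hx (by rw [h.isOpen_A.frontier_eq]; exact ⟨hxA, hn⟩)

/-- The Lipschitz boundary of A is a null set, so integrals over Ω split into the two materials. -/
lemma restrict_eq_add (h : IsTwoPhaseDomain Ω A) :
    (volume : Measure (Space n)).restrict Ω =
      volume.restrict (Ω \ closure A) + volume.restrict A := by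
  rw [← Measure.restrict_union (disjoint_sdiff_left.mono_right subset_closure)
    h.isOpen_A.measurableSet]
  refine Measure.restrict_congr_set ?_
  filter_upwards [h.ae_mem_of_mem_closure] with x hx
  refine propext ⟨fun hxΩ => ?_, ?_⟩
  · by_cases hxA : x ∈ closure A
    · exact Or.inr (hx hxA)
    · exact Or.inl ⟨hxΩ, hxA⟩
  · rintro (hx | hx)
    · exact hx.1
    · exact h.closure_A_subset (subset_closure hx)

end IsTwoPhaseDomain

namespace Medium

variable {m : Medium n}

lemma potentialDomain_cases (m : Medium n) :
    m.potentialDomain = m.Ω ∨ m.potentialDomain = m.B := by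
  unfold potentialDomain
  split <;> simp

lemma energyDomain_cases (m : Medium n) : m.energyDomain = m.Ω ∨ m.energyDomain = m.B := by
  unfold energyDomain
  split <;> simp

lemma potentialDomain_subset (m : Medium n) : m.potentialDomain ⊆ m.Ω := by
  rcases m.potentialDomain_cases with h | h <;> rw [h]
  exact sdiff_subset

lemma energyDomain_subset (m : Medium n) : m.energyDomain ⊆ m.potentialDomain := by
  unfold energyDomain potentialDomain
  split <;> simp [B]

lemma exponent_le (m : Medium n) : m.exponent ≤ m.p := by
  unfold exponent
  split <;> simp

lemma one_lt_exponent (hp : 1 < m.p) (hq : 1 < m.q) : 1 < m.exponent := by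
  unfold exponent
  split <;> simp [hp, hq]

lemma isOpen_B (hdom : IsTwoPhaseDomain m.Ω m.A) : IsOpen m.B :=
  hdom.isOpen_Ω.sdiff isClosed_closure

lemma isOpen_potentialDomain (hdom : IsTwoPhaseDomain m.Ω m.A) : IsOpen m.potentialDomain := by
  rcases m.potentialDomain_cases with h | h <;> rw [h]
  exacts [hdom.isOpen_Ω, isOpen_B hdom]

lemma measurableSet_energyDomain (hdom : IsTwoPhaseDomain m.Ω m.A) :
    MeasurableSet m.energyDomain := by
  rcases m.energyDomain_cases with h | h <;> rw [h]
  exacts [hdom.isOpen_Ω.measurableSet, (isOpen_B hdom).measurableSet]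

lemma poincareOn_potentialDomain (hn : 2 ≤ n) (hdom : IsTwoPhaseDomain m.Ω m.A) {s : ℝ}
    (hs : 1 ≤ s) : PoincareOn s m.Ω m.potentialDomain m.potentialDomain := by
  rcases m.potentialDomain_cases with h | h <;> rw [h]
  · simpa using poincareOn_of_isTwoPhaseDomain hn hdom.empty hs
  · exact poincareOn_of_isTwoPhaseDomain hn hdom hs

/-- For a conductor the two domains differ by the closure of A, that is, by A up to a null set. In
the other cases they coincide and both sides hold trivially. -/
lemma conductor_condition_iff (hdom : IsTwoPhaseDomain m.Ω m.A) (u : Space n → ℝ) :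
    (m.phase = .conductor → ∀ᵐ x ∂(volume.restrict m.A), m.grad u x = 0) ↔
      ∀ᵐ x ∂(volume.restrict m.potentialDomain), x ∉ m.energyDomain → m.grad u x = 0 := by
  by_cases hph : m.phase = .conductor
  · have hU : m.potentialDomain = m.Ω := by simp [potentialDomain, hph]
    have hD : m.energyDomain = m.B := by simp [energyDomain, hph]
    rw [hU, hD, ae_restrict_iff' hdom.isOpen_Ω.measurableSet]
    simp only [hph, forall_const]
    rw [ae_restrict_iff' hdom.isOpen_A.measurableSet]
    constructor
    · intro h
      filter_upwards [h, hdom.ae_mem_of_mem_closure] with x h1 h2 hxΩ hxB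
      refine h1 (h2 ?_)
      by_contra hx
      exact hxB ⟨hxΩ, hx⟩
    · intro h
      filter_upwards [h] with x h1 hxA
      exact h1 (hdom.closure_A_subset (subset_closure hxA)) fun hx => hx.2 (subset_closure hxA)
  · have hUD : m.potentialDomain = m.energyDomain := by
      unfold potentialDomain energyDomain
      split <;> simp_all
    simp only [hph, false_imp_iff, true_iff]
    rw [hUD]
    filter_upwards [ae_restrict_mem (measurableSet_energyDomain hdom)] with x hx hx'
    exact absurd hx hx'

lemma isEnergyIntegrand (hn : 2 ≤ n) (hdom : IsTwoPhaseDomain m.Ω m.A) (hp : 1 < m.p)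
    (hq : 1 < m.q) (hP1 : IsCaratheodory m.B m.σ ∧ IsCaratheodory m.A m.σ)
    (hP2 : HasGrowth m.p m.B m.σ) (hP3 : IsStronglyMonotone m.p m.B m.σ)
    (hinner : m.InnerAssumption) :
    IsEnergyIntegrand (volume.restrict m.energyDomain) m.exponent
      fun x E => (m.σ x E).toReal := by
  have hs0 : 0 < m.exponent := zero_lt_one.trans (one_lt_exponent hp hq)
  have key : ∀ {r : ℝ} {V : Set (Space n)}, 1 < r → m.exponent ≤ r → IsCaratheodory V m.σ →
      HasGrowth r V m.σ → IsStronglyMonotone r V m.σ →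
      IsEnergyIntegrand (volume.restrict V) m.exponent fun x E => (m.σ x E).toReal := by
    intro r V hr hsr h1 h2 h3
    obtain ⟨c, C, κ, hc, hC, hκ, h⟩ := exists_isConductivity h1 h2 h3
    exact IsEnergyIntegrand.of_isConductivity hn hr hc hκ hC hs0 hsr
      (fun E hE => (h1.1 E hE).ereal_toReal) h
  have hB := key hp m.exponent_le hP1.1 hP2 hP3
  cases hph : m.phase with
  | absent =>
    simp only [InnerAssumption, hph] at hinner
    have : m.energyDomain = m.B := by simp [energyDomain, hph, B, hinner]
    rw [this]
    exact hB
  | growth =>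
    simp only [InnerAssumption, hph] at hinner
    have : m.energyDomain = m.Ω := by simp [energyDomain, hph]
    rw [this, hdom.restrict_eq_add]
    exact hB.add (key hq (by simp [exponent, hph]) hP1.2 hinner.1 hinner.2)
  | insulator =>
    have : m.energyDomain = m.B := by simp [energyDomain, hph]
    rw [this]
    exact hB
  | conductor =>
    have : m.energyDomain = m.B := by simp [energyDomain, hph]
    rw [this]
    exact hB

lemma isRegular (hn : 2 ≤ n) (hdom : IsTwoPhaseDomain m.Ω m.A) (hp : 1 < m.p)
    (hq : 1 < m.q) (hP1 : IsCaratheodory m.B m.σ ∧ IsCaratheodory m.A m.σ)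
    (hP2 : HasGrowth m.p m.B m.σ) (hP3 : IsStronglyMonotone m.p m.B m.σ)
    (hinner : m.InnerAssumption) : m.IsRegular where
  one_le := (one_lt_exponent hp hq).le
  isOpen := isOpen_potentialDomain hdom
  finite := ne_top_of_le_ne_top hdom.volume_ne_top (measure_mono m.potentialDomain_subset)
  measurableSet := measurableSet_energyDomain hdom
  subset := m.energyDomain_subset
  poincare := poincareOn_potentialDomain hn hdom (one_lt_exponent hp hq).le
  conductor := conductor_condition_iff hdom
  integrand := isEnergyIntegrand hn hdom hp hq hP1 hP2 hP3 hinner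

/-- Every boundary datum has an extension of finite energy, which vanishes near `A`. -/
lemma exists_isExtension (hn : 2 ≤ n) (hdom : IsTwoPhaseDomain m.Ω m.A) (hm : m.IsRegular)
    (hp : 1 < m.p) (hP1 : IsCaratheodory m.B m.σ) (hP2 : HasGrowth m.p m.B m.σ)
    (hP3 : IsStronglyMonotone m.p m.B m.σ) {f : Space n → ℝ}
    (hf : MemBoundaryData m.p m.Ω f) : ∃ Φ, m.IsExtension f Φ := by
  obtain ⟨hfS, -, ⟨-, φ, hφ, hφt, -⟩, -⟩ := hf
  have hΩo := hdom.isOpen_Ω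
  have hs1 := hm.one_le
  have hs0 : 0 < m.exponent := zero_lt_one.trans_le hs1
  obtain ⟨η, hη, hηc, hηΩ, hηA⟩ := exists_cutoff hdom.isCompact_closure_A hΩo
    hdom.closure_A_subset
  have hη1 : ContDiff ℝ 1 η := hη.of_le (by simp)
  obtain ⟨C, hC, hηC, hηC'⟩ := exists_bound_of_cutoff hη hηc
  have hηf : MemSobolev m.p m.Ω (fun x => η x * f x) := hfS.smooth_mul hη hηc hΩo
  -- Φ = (1 − η) f has zero gradient on the closure of A: it meets the conductor constraint, and its
  -- energy in A vanishes whatever the exponent q. Only the p-growth in B matters for finiteness.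
  set Φ : Space n → ℝ := f - fun x => η x * f x with hΦ
  have hΦS : MemSobolev m.p m.Ω Φ := hfS.sub hΩo hηf
  set G : Space n → Space n := weakGrad m.Ω f -
    fun x => η x • weakGrad m.Ω f x + f x • gradient η x with hG
  have hΦG : HasWeakGrad m.Ω Φ G := hfS.hasWeakGrad.sub (hfS.hasWeakGrad.smooth_mul hη hΩo)
  have hGp : MemLp G (ENNReal.ofReal m.p) (volume.restrict m.Ω) :=
    (memLp_congr_ae (hΦG.weakGrad_ae_eq hΩo)).1 (hΦS.memLp_weakGrad hΩo)
  have hGA : ∀ x ∈ closure m.A, G x = 0 := by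
    intro x hx
    have h1 : η x = 1 := (hηA x hx).self_of_nhds
    have h2 : gradient η x = 0 := by
      rw [gradient, (hηA x hx).fderiv_eq]
      simp
    simp [hG, h1, h2]
  have hgrad : ∀ᵐ x ∂(volume.restrict m.potentialDomain), m.grad Φ x = G x :=
    (hΦG.mono m.potentialDomain_subset).weakGrad_ae_eq hm.isOpen
  have hΦU : MemSobolev m.exponent m.potentialDomain Φ :=
    hΦS.mono hΩo m.potentialDomain_subset hm.finite m.exponent_le
  have hηfU : MemSobolev m.exponent m.potentialDomain (fun x => η x * f x) :=
    hηf.mono hΩo m.potentialDomain_subset hm.finite m.exponent_le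
  refine ⟨Φ, ⟨hΦU, ?_, ?_⟩, ?_⟩
  · have e : Φ - f = (-1 : ℝ) • fun x => η x * f x := by
      rw [hΦ, neg_one_smul]
      abel
    rw [e]
    -- The C¹ functions φ k that approximate f in W^{1,p}(Ω) are part of the trace condition; the
    -- products η φ k have compact support in Ω and approximate η f.
    refine VanishesOnBoundary.const_smul hm.isOpen _ ⟨hηfU, fun k x => η x * φ k x,
      fun k => ⟨hη1.mul (hφ k), hηc.mul_right,
        (tsupport_mul_subset_left (f := η) (g := φ k)).trans hηΩ⟩, ?_⟩
    have hlim := ENNReal.Tendsto.mul_const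
      (b := volume m.potentialDomain ^ (1 / m.exponent - 1 / m.p))
      (ENNReal.Tendsto.const_mul (a := 2 * ENNReal.ofReal C) hφt
        (Or.inr (ENNReal.mul_ne_top (by simp) (by simp))))
      (Or.inr (ENNReal.rpow_ne_top_of_nonneg (sub_nonneg.2
        (one_div_le_one_div_of_le hs0 m.exponent_le)) hm.finite))
    rw [mul_zero, zero_mul] at hlim
    refine tendsto_of_tendsto_of_tendsto_of_le_of_le tendsto_const_nhds hlim (fun _ => zero_le)
      fun k => ?_
    have hk : HasWeakGrad m.Ω (φ k - f) (gradient (φ k) - weakGrad m.Ω f) :=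
      (HasWeakGrad.of_contDiff (hφ k)).sub hfS.hasWeakGrad
    have e2 : ((fun x => η x * φ k x) - fun x => η x * f x) = fun x => η x * (φ k - f) x := by
      ext x
      simp [mul_sub]
    beta_reduce
    rw [e2]
    refine ((hk.smooth_mul hη hΩo).sobolevNorm_mono hΩo hm.isOpen m.potentialDomain_subset hs0
      m.exponent_le).trans ?_
    gcongr
    exact hk.sobolevNorm_smooth_mul_le hp.le hη hηC hηC' hΩo
  · rw [hm.conductor]
    filter_upwards [hgrad, ae_restrict_mem hm.isOpen.measurableSet] with x hx hxU hxD
    rw [hx]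
    refine hGA x ?_
    by_contra hxA
    refine hxD ?_
    rcases m.energyDomain_cases with h | h <;> rw [h]
    · exact m.potentialDomain_subset hxU
    · exact ⟨m.potentialDomain_subset hxU, hxA⟩
  · obtain ⟨c, C, κ, hc, hC, hκ, hcond⟩ := exists_isConductivity hP1 hP2 hP3
    rw [hm.energy_ne_top_iff hΦU]
    have hfin := hm.isFiniteMeasure
    have hGi : Integrable (fun x => ‖G x‖ ^ m.p) (volume.restrict m.energyDomain) := by
      have := hGp.integrable_norm_rpow (by simpa using zero_lt_one.trans hp) (by simp)
      rw [ENNReal.toReal_ofReal (zero_lt_one.trans hp).le] at this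
      exact this.mono_measure
        (Measure.restrict_mono (m.energyDomain_subset.trans m.potentialDomain_subset) le_rfl)
    refine Integrable.mono' (((integrable_const (1 : ℝ)).add hGi).const_mul (4 * C))
      (hm.aestronglyMeasurable_energyDensity hΦU) ?_
    have hcond' : ∀ᵐ x ∂(volume.restrict m.energyDomain), x ∈ m.B →
        IsConductivity n m.p c C κ fun E => (m.σ x E).toReal :=
      ae_restrict_of_ae ((ae_restrict_iff' (isOpen_B hdom).measurableSet).1 hcond)
    filter_upwards [hm.ae_energyDomain hgrad, hcond', hm.integrand.nonneg,
      ae_restrict_mem hm.measurableSet] with x h1 h2 h3 hxD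
    have h4 : 0 ≤ m.energyDensity x ‖m.grad Φ x‖ := h3 _
    rw [Real.norm_of_nonneg h4, h1]
    by_cases hxA : x ∈ closure m.A
    · rw [hGA x hxA]
      have : m.energyDensity x ‖(0 : Space n)‖ = 0 := by simp [energyDensity]
      rw [this]
      have hz : 0 ≤ ‖(0 : Space n)‖ ^ m.p := by positivity
      exact mul_nonneg (by positivity) (by simpa [hGA x hxA] using add_nonneg zero_le_one hz)
    · exact (h2 ⟨m.potentialDomain_subset (m.energyDomain_subset hxD), hxA⟩).potential_upper
        hn hp hc.le hκ.le hC (G x)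

end Medium

end NonlinearConduction
end

open NonlinearConduction
/-- In each of the four cases for the inner material: every boundary datum `f` has a minimizer `u^f`,
unique a.e.; `⟨Λ_σ(f), φ⟩` is given by a convergent integral that does not depend on the extension
of `φ`; and the energy of `u^f` is finite and equal to `⟨Λ̄_σ(f), f⟩`. -/
theorem theorem5p2 {n : ℕ} (hn : 2 ≤ n) (m : Medium n)
    (hdom : IsTwoPhaseDomain m.Ω m.A) (hp : 1 < m.p) (hq : 1 < m.q)
    (hP1 : IsCaratheodory m.B m.σ ∧ IsCaratheodory m.A m.σ)
    (hP2 : HasGrowth m.p m.B m.σ)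
    (hP3 : IsStronglyMonotone m.p m.B m.σ)
    (hinner : m.InnerAssumption) :
    ∀ f : Space n → ℝ, MemBoundaryData m.p m.Ω f →
      (m.IsMinimizer f (m.solution f) ∧
        ∀ v, m.IsMinimizer f v → v =ᵐ[volume.restrict m.potentialDomain] m.solution f) ∧
      (∀ φ : Space n → ℝ, MemBoundaryData m.p m.Ω φ →
        (∃ Φ, m.IsExtension φ Φ) ∧
        ∀ Φ, m.IsExtension φ Φ →
          IntegrableOn (m.powerDensity (m.solution f) Φ) m.energyDomain ∧
          ∫ x in m.energyDomain, m.powerDensity (m.solution f) Φ x = m.dtn f φ) ∧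
      IntervalIntegrable (fun α : ℝ => m.dtn (α • f) f) volume 0 1 ∧
      m.energy (m.solution f) ≠ ⊤ ∧
      (m.energy (m.solution f)).toReal = m.averageDtn f f := by
  intro f hf
  have hm := Medium.isRegular hn hdom hp hq hP1 hP2 hP3 hinner
  have hext : ∀ φ, MemBoundaryData m.p m.Ω φ → ∃ Φ, m.IsExtension φ Φ := fun φ hφ =>
    Medium.exists_isExtension hn hdom hm hp hP1.1 hP2 hP3 hφ
  have hex := hext f hf
  have hmin := hm.isMinimizer_solution hex
  have hsol := hm.isExtension_solution hex
  -- The energy along the ray α ↦ αf has the pairing as a subgradient at every real α, not only on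
  -- [0, 1].
  obtain ⟨hmono, hint⟩ := monotone_and_integral_of_subgradient
    (g := fun α : ℝ => (m.energy (m.solution (α • f))).toReal)
    (h := fun α : ℝ => m.dtn (α • f) f) (hm.mul_dtn_le hex)
  refine ⟨⟨hmin, fun v hv => hm.isMinimizer_unique hex hv hmin⟩, fun φ hφ => ⟨hext φ hφ,
    fun Φ hΦ => ⟨hm.integrable_powerDensity hsol hΦ, hm.integral_powerDensity_eq_dtn hex hΦ⟩⟩,
    hmono.intervalIntegrable, hsol.2, ?_⟩
  have h := hint 0 1
  beta_reduce at h
  rw [one_smul, hm.energy_solution_zero hex, ENNReal.toReal_zero, sub_zero] at h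
  exact h.symm
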